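/- Let $n\in\{2,3\}$. Write $\langle a\rangle=(1+|a|^2)^{1/2}$, $\widehat{w}(\xi,\tau)=\int_{\mathbb{R}^n\times\mathbb{R}}e^{-i(x\cdot\xi+t\tau)}w(x,t)\,dx\,dt$ and, for $s,\theta\in\mathbb{R}$, $$\|w\|_{X^{s,\theta}}=\big\|\langle\xi\rangle^{s}\langle\tau-|\xi|^2\rangle^{\theta}\,\widehat{w}(\xi,\tau)\big\|_{L^2_{\xi,\tau}(\mathbb{R}^n\times\mathbb{R})}.$$ Call $(n,s,\theta)$ admissible if one of the following holds: - $n=2$, $\tfrac12<\theta\neq\tfrac34$ and $\max\{\theta-\tfrac54,\,2\theta-2\}\le s<0$; - $n=2$, $\theta=\tfrac34$ and $-\tfrac12<s<0$; - $n=3$, $\theta>\tfrac12$ and $2\theta-\tfrac32\le s<0$. **Proposition.** If $(n,s,\theta)$ is admissible, then there is a constant $C>0$, depending only on $n,s,\theta$, such that $$\|u\,v\|_{X^{s,\theta-1}(\mathbb{R}^n\times\mathbb{R})}\le C\,\|u\|_{X^{s,\theta}(\mathbb{R}^n\times\mathbb{R})}\,\|v\|_{X^{s,\theta}(\mathbb{R}^n\times\mathbb{R})}$$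 for all Schwartz functions $u,v:\mathbb{R}^n\times\mathbb{R}\to\mathbb{C}$, and, with the same $C$, for all $u,v\in X^{s,\theta}$, where in the latter case $u\,v$ is defined by $\widehat{uv}=(2\pi)^{-(n+1)}\,\widehat{u}*\widehat{v}$, the convolution integral being absolutely convergent almost everywhere. (Here $X^{s,\theta}$ is the space of tempered distributions whose Fourier transform is a measurable function with finite norm above.) In particular, for $n=2$ and $\theta\ne\tfrac34$ the endpoint $s=\max\{\theta-\tfrac54,2\theta-2\}$ is included whenever $\theta>\tfrac12$ and $s<0$. -/

import Mathlib

open MeasureTheory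
open scoped NNReal ENNReal SchwartzMap

/-- Space-time `ℝⁿ × ℝ`; points are `(x, t)` on the physical side, `(ξ, τ)` on the Fourier side. -/
abbrev Spacetime (n : ℕ) : Type := EuclideanSpace ℝ (Fin n) × ℝ

/-- The bracket `⟨a⟩ = (1 + |a|²)^{1/2}`. -/
noncomputable def japaneseBracket {E : Type*} [Norm E] (a : E) : ℝ :=
  Real.sqrt (1 + ‖a‖ ^ 2)

/-- The space-time Fourier transform `ŵ(ξ, τ) = ∫ e^{-i(x·ξ + tτ)} w(x, t) dx dt`. -/
noncomputable def spacetimeFourier {n : ℕ} (w : Spacetime n → ℂ) (ζ : Spacetime n) : ℂ :=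
  ∫ p : Spacetime n,
    Complex.exp (-Complex.I * ((inner ℝ p.1 ζ.1 + p.2 * ζ.2 : ℝ) : ℂ)) * w p

/-- The weighted norm `‖⟨ξ⟩^s ⟨τ - |ξ|²⟩^θ W(ξ, τ)‖_{L²}` of a function `W` on the Fourier side,
with values in `[0, ∞]`. -/
noncomputable def bourgainFourierNorm {n : ℕ} (s θ : ℝ) (W : Spacetime n → ℂ) : ℝ≥0∞ :=
  eLpNorm (fun ζ : Spacetime n =>
    ((japaneseBracket ζ.1 ^ s * japaneseBracket (ζ.2 - ‖ζ.1‖ ^ 2) ^ θ : ℝ) : ℂ) * W ζ) 2 volume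

/-- The Bourgain norm `‖w‖_{X^{s,θ}} = ‖⟨ξ⟩^s ⟨τ - |ξ|²⟩^θ ŵ(ξ, τ)‖_{L²}`. -/
noncomputable def bourgainNorm {n : ℕ} (s θ : ℝ) (w : Spacetime n → ℂ) : ℝ≥0∞ :=
  bourgainFourierNorm s θ (spacetimeFourier w)

/-- `(2π)^{-(n+1)} (U ⋆ V)`: the Fourier transform of the product `u v` when `U = û`, `V = v̂`. -/
noncomputable def fourierProduct {n : ℕ} (U V : Spacetime n → ℂ) (ζ : Spacetime n) : ℂ :=
  (((2 * Real.pi) ^ (n + 1) : ℝ) : ℂ)⁻¹ * ∫ η : Spacetime n, U η * V (ζ - η)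

/-- Admissible triplets `(n, s, θ)`. -/
def Admissible (n : ℕ) (s θ : ℝ) : Prop :=
  (n = 2 ∧ 1 / 2 < θ ∧ θ ≠ 3 / 4 ∧ max (θ - 5 / 4) (2 * θ - 2) ≤ s ∧ s < 0) ∨
  (n = 2 ∧ θ = 3 / 4 ∧ -(1 / 2) < s ∧ s < 0) ∨
  (n = 3 ∧ 1 / 2 < θ ∧ 2 * θ - 3 / 2 ≤ s ∧ s < 0)

/-!
The proof is by duality. With `U = û`, `V = v̂`, `r = -s > 0` and `L²` functions `f`, `g` standing
for the weighted `|U|`, `|V|`, the estimate says that the trilinear form `∬ f(ζ₁) g(ζ₂) h(ζ₁ + ζ₂) ·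
bilinearKernel r θ (ζ₁, ζ₂)` is bounded on `L² × L² × L²`, where the kernel is `(⟨ξ₁⟩⟨ξ₂⟩/⟨ξ₁+ξ₂⟩)^r
⟨σ⟩^{θ-1} ⟨σ₁⟩^{-θ} ⟨σ₂⟩^{-θ}` and `σ = τ - |ξ|²` is the modulation.

The modulations satisfy `σ = σ₁ + σ₂ - 2 ξ₁·ξ₂` (`modulation_add`), so the largest of the three
controls `⟨ξ₁·ξ₂⟩`. Its weight is spent on a power of `⟨ξ₁·ξ₂⟩`. The other two modulations keep the
exponent `-θ'` with `θ' > 1/2`, so that they can be integrated by Cauchy–Schwarz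
(`exists_trilinear_le`). What remains are two trilinear forms for functions on paraboloids, with the
weight `(⟨x⟩⟨y⟩/⟨x+y⟩)^r ⟨x·y⟩^{-δ}`: in `OutputBound` both inputs live on the paraboloid, in
`InputBound` one input and the output do.

Both forms are bounded without any decomposition of the frequencies into shells. The first input is
written in polar coordinates `x = ρe`. For a fixed direction `e`, Cauchy–Schwarz and a change of
variables leave only a majorant in `ρ` of the squared weight, times `ρ^{n-2}`, to be integrated over
`e` (`sq_lintegral_output_direction_le`, `sq_lintegral_input_direction_le`). Such a majorant is
`|cos ∠(e, y)|^{-2δ}` when the output frequency is not small, and, when the inputs nearly cancel,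
`⟨y⟩^p ⟨|y| sin ∠(e, y)⟩^{-2r}` with `p = 4r - 4δ + n - 2` (`exists_ofReal_pow_mul_weight_sq_le`).
By the admissibility conditions both are integrable over the sphere, uniformly in `y`; the endpoint
`s = θ - 5/4` for `n = 2` is the case `p = 1`, where the second integral behaves like that of `N
⟨Nt⟩^{-2r}` over `t`, with `2r > 1`. Two regions are treated apart, by Cauchy–Schwarz on the fibres:
where `x·y` is close to `|x|²`, and the change of variables degenerates
(`exists_parallel_sphere_bound`), and, for `n = 3`, where one input is larger than the cube of the
other (`inputBound_three_of_small`).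

For Schwartz functions the Fourier transform of the product is the convolution of the Fourier
transforms, by Fourier inversion (`spacetimeFourier_mul`), so both parts of the theorem follow from
the estimate for measurable functions on the Fourier side (`Admissible.exists_fourierProduct_le`).
-/

/-! ### Integration tools -/

/-- The Cauchy–Schwarz inequality `(∫ I)² ≤ ∫ P ∫ Q` from the pointwise inequality `I² ≤ P Q`. All
bounds are kept in this squared form, which iterates under integral signs and needs no roots. -/
theorem lintegral_sq_le_of_sq_le {α : Type*} [MeasurableSpace α] {μ : Measure α}
    {I P Q : α → ℝ≥0∞} (hP : AEMeasurable P μ) (hQ : AEMeasurable Q μ)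
    (h : ∀ᵐ x ∂μ, I x ^ 2 ≤ P x * Q x) :
    (∫⁻ x, I x ∂μ) ^ 2 ≤ (∫⁻ x, P x ∂μ) * ∫⁻ x, Q x ∂μ := by
  have key : ∀ a : ℝ≥0∞, (a ^ (1 / 2 : ℝ)) ^ 2 = a := fun a => by
    rw [← ENNReal.rpow_natCast, ← ENNReal.rpow_mul]; norm_num
  have key' : ∀ a : ℝ≥0∞, (a ^ (1 / 2 : ℝ)) ^ (2 : ℝ) = a := fun a => by
    rw [← ENNReal.rpow_mul]; norm_num
  have hI : ∀ᵐ x ∂μ, I x ≤ P x ^ (1 / 2 : ℝ) * Q x ^ (1 / 2 : ℝ) := by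
    filter_upwards [h] with x hx
    refine (ENNReal.pow_le_pow_left_iff two_ne_zero).1 ?_
    rwa [mul_pow, key, key]
  have h1 := ENNReal.lintegral_mul_le_Lp_mul_Lq μ (p := 2) (q := 2)
    (by constructor <;> norm_num) (hP.pow_const (1 / 2 : ℝ)) (hQ.pow_const (1 / 2 : ℝ))
  simp only [key', Pi.mul_apply] at h1
  calc (∫⁻ x, I x ∂μ) ^ 2
      ≤ ((∫⁻ x, P x ∂μ) ^ (1 / 2 : ℝ) * (∫⁻ x, Q x ∂μ) ^ (1 / 2 : ℝ)) ^ 2 := by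
        gcongr; exact (lintegral_mono_ae hI).trans h1
    _ = _ := by rw [mul_pow, key, key]

theorem lintegral_polar {m : ℕ} {F : EuclideanSpace ℝ (Fin (m + 2)) → ℝ≥0∞} (hF : Measurable F) :
    ∫⁻ x, F x = ∫⁻ e, ∫⁻ ρ in Set.Ioi (0 : ℝ), ENNReal.ofReal (ρ ^ (m + 1)) * F (ρ • e.1)
      ∂volume ∂(volume : Measure (EuclideanSpace ℝ (Fin (m + 2)))).toSphere := by
  have h1 : ∫⁻ x, F x = ∫⁻ x : ({0}ᶜ : Set (EuclideanSpace ℝ (Fin (m + 2)))), F x.1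
      ∂(Measure.comap Subtype.val volume) := by
    rw [lintegral_subtype_comap (measurableSet_singleton _).compl,
      restrict_compl_singleton]
  rw [h1]
  have hmp := Measure.measurePreserving_homeomorphUnitSphereProd
    (volume : Measure (EuclideanSpace ℝ (Fin (m + 2))))
  have h2 := hmp.symm (homeomorphUnitSphereProd _).toMeasurableEquiv
  rw [← h2.lintegral_comp_emb (MeasurableEquiv.measurableEmbedding _)]
  have hd : Module.finrank ℝ (EuclideanSpace ℝ (Fin (m + 2))) - 1 = m + 1 := by simp
  rw [hd]
  have hm : Measurable fun p : (Metric.sphere (0 : EuclideanSpace ℝ (Fin (m + 2))) 1) ×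
      Set.Ioi (0 : ℝ) => F (p.2.1 • p.1.1) := by fun_prop
  rw [lintegral_prod _ (by
    refine (Measurable.comp hF ?_).aemeasurable
    exact measurable_subtype_coe.comp (MeasurableEquiv.measurable _))]
  refine lintegral_congr fun e => ?_
  have : ∀ y : Set.Ioi (0 : ℝ), F (((homeomorphUnitSphereProd
      (EuclideanSpace ℝ (Fin (m + 2)))).toMeasurableEquiv.symm (e, y)).1) =
      F (y.1 • e.1) := fun y => rfl
  simp only [this]
  rw [Measure.volumeIoiPow, lintegral_withDensity_eq_lintegral_mul _ (by fun_prop) (by fun_prop)]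
  simp only [Pi.mul_apply]
  exact lintegral_subtype_comap measurableSet_Ioi
    (fun ρ : ℝ => ENNReal.ofReal (ρ ^ (m + 1)) * F (ρ • e.1))

/-- Measure-preserving coordinates `(a, b)` adapted to a line: `a` is the component along the unit
vector `e`, and `b` the components along an orthonormal basis of its complement. -/
theorem exists_line_coordinates {m : ℕ} {e : EuclideanSpace ℝ (Fin (m + 2))} (he : ‖e‖ = 1) :
    ∃ Ψ : ℝ × (Fin (m + 1) → ℝ) → EuclideanSpace ℝ (Fin (m + 2)),
      MeasurePreserving Ψ ∧ (∀ a ρ b, Ψ (a + ρ, b) = Ψ (a, b) + ρ • e) ∧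
      (∀ a b, inner ℝ e (Ψ (a, b)) = a) ∧ ∀ a b i, |b i| ≤ ‖Ψ (a, b)‖ := by
  obtain ⟨B, hB⟩ := Orthonormal.exists_orthonormalBasis_extension_of_card_eq (𝕜 := ℝ)
    (E := EuclideanSpace ℝ (Fin (m + 2))) (ι := Fin (m + 2)) (by simp)
    (v := fun _ => e) (s := {0}) (by
      rw [orthonormal_iff_ite]
      rintro ⟨i, hi⟩ ⟨j, hj⟩
      simp only [Set.mem_singleton_iff] at hi hj
      subst hi; subst hj
      simp [he])
  have hB0 : B 0 = e := hB 0 rfl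
  refine ⟨fun p => B.repr.symm (WithLp.toLp 2 (Fin.cons p.1 p.2)), ?_, ?_, ?_, ?_⟩
  · have h1 := (volume_preserving_piFinSuccAbove (fun _ : Fin (m + 2) => ℝ) 0).symm
    have h2 := PiLp.volume_preserving_toLp (Fin (m + 2))
    have h3 := (B.repr.symm).measurePreserving
    have := h3.comp (h2.comp h1)
    convert this using 1
    ext1 p
    simp [MeasurableEquiv.piFinSuccAbove, Fin.insertNthEquiv]
  · intro a ρ b
    have h : (WithLp.toLp 2 (Fin.cons (a + ρ) b) : EuclideanSpace ℝ (Fin (m + 2))) =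
        WithLp.toLp 2 (Fin.cons a b) + ρ • EuclideanSpace.single 0 1 := by
      ext i
      refine Fin.cases ?_ (fun i => ?_) i <;> simp
    simp only [h, map_add, map_smul, B.repr_symm_single, hB0]
  · intro a b
    rw [← hB0, ← B.repr_apply_apply]
    simp
  · intro a b i
    simp only [LinearIsometryEquiv.norm_map]
    simpa using PiLp.norm_apply_le (WithLp.toLp 2 (Fin.cons a b : Fin (m + 2) → ℝ)) i.succ

theorem lintegral_Ioi_quadratic_le {H : ℝ → ℝ≥0∞} (c : ℝ) :
    ∫⁻ s in Set.Ioi (0 : ℝ), ENNReal.ofReal (4 * s) * H (2 * s ^ 2 + c) ≤ ∫⁻ t, H t := by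
  have h := lintegral_image_eq_lintegral_abs_deriv_mul (s := Set.Ioi (0 : ℝ))
    (f := fun s => 2 * s ^ 2 + c) (f' := fun s => 4 * s) measurableSet_Ioi
    (fun x _ => by
      have := ((hasDerivAt_pow 2 x).const_mul 2).add_const c
      refine (this.congr_deriv ?_).hasDerivWithinAt
      norm_num; ring)
    (fun x hx y hy hxy => by
      simp only [Set.mem_Ioi] at hx hy
      have : (x - y) * (x + y) = 0 := by nlinarith [hxy]
      rcases mul_eq_zero.1 this with h | h <;> linarith) H
  rw [setLIntegral_congr_fun (g := fun s => ENNReal.ofReal |4 * s| * H (2 * s ^ 2 + c))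
    measurableSet_Ioi (fun x hx => by
      simp only [Set.mem_Ioi] at hx
      simp only []
      rw [abs_of_pos (by positivity : 0 < 4 * x)]), ← h]
  exact setLIntegral_le_lintegral _ _

theorem lintegral_quadratic_le {H : ℝ → ℝ≥0∞} (c : ℝ) :
    ∫⁻ s : ℝ, ENNReal.ofReal (4 * |s|) * H (2 * s ^ 2 + c) ≤ 2 * ∫⁻ t, H t := by
  rw [← lintegral_add_compl _ (measurableSet_Ioi (a := (0 : ℝ))), two_mul]
  refine add_le_add ?_ ?_
  · rw [setLIntegral_congr_fun (f := fun s => ENNReal.ofReal (4 * |s|) * H (2 * s ^ 2 + c))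
      (g := fun s => ENNReal.ofReal (4 * s) * H (2 * s ^ 2 + c))
      measurableSet_Ioi (fun x hx => by
        simp only [Set.mem_Ioi] at hx
        simp only []
        rw [abs_of_pos hx])]
    exact lintegral_Ioi_quadratic_le c
  · rw [Set.compl_Ioi, ← setLIntegral_congr Iio_ae_eq_Iic]
    have := (Measure.measurePreserving_neg (volume : Measure ℝ)).setLIntegral_comp_preimage_emb
      (MeasurableEquiv.neg ℝ).measurableEmbedding
      (fun s => ENNReal.ofReal (4 * |s|) * H (2 * s ^ 2 + c)) (Set.Iio 0)
    rw [← this]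
    have h0 : Neg.neg ⁻¹' Set.Iio (0 : ℝ) = Set.Ioi 0 := by ext; simp
    rw [h0, setLIntegral_congr_fun (g := fun s => ENNReal.ofReal (4 * s) * H (2 * s ^ 2 + c))
      measurableSet_Ioi (fun x hx => by
        simp only [Set.mem_Ioi] at hx
        simp only []
        rw [abs_neg, abs_of_pos hx, neg_sq])]
    exact lintegral_Ioi_quadratic_le c

theorem setLIntegral_comp_abs_le (ψ : ℝ → ℝ≥0∞) :
    ∫⁻ t in Set.Icc (-1 : ℝ) 1, ψ |t| ≤ 2 * ∫⁻ t in Set.Ioc (0 : ℝ) 1, ψ t := by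
  have h1 : ∫⁻ t in Set.Ioc (0 : ℝ) 1, ψ |t| = ∫⁻ t in Set.Ioc (0 : ℝ) 1, ψ t :=
    setLIntegral_congr_fun measurableSet_Ioc fun t ht => by
      simp only [abs_of_pos (show 0 < t from ht.1)]
  have h2 : ∫⁻ t in Set.Icc (-1 : ℝ) 0, ψ |t| = ∫⁻ t in Set.Ioc (0 : ℝ) 1, ψ t := by
    have h := (Measure.measurePreserving_neg (volume : Measure ℝ)).setLIntegral_comp_preimage_emb
      (MeasurableEquiv.neg ℝ).measurableEmbedding (fun s => ψ |s|) (Set.Icc (-1) 0)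
    have h0 : Neg.neg ⁻¹' Set.Icc (-1 : ℝ) 0 = Set.Icc 0 1 := by
      ext x
      simp only [Set.mem_preimage, Set.mem_Icc]
      constructor <;> rintro ⟨a, b⟩ <;> constructor <;> linarith
    simp only [abs_neg] at h
    rw [← h, h0, ← setLIntegral_congr Ioc_ae_eq_Icc, h1]
  calc _ ≤ ∫⁻ t in Set.Icc (-1 : ℝ) 0 ∪ Set.Ioc 0 1, ψ |t| := by
        refine lintegral_mono_set fun t ht => ?_
        rcases le_or_gt t 0 with h | h
        · exact .inl ⟨ht.1, h⟩
        · exact .inr ⟨h, ht.2⟩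
    _ ≤ _ := (lintegral_union_le _ _ _).trans (by rw [h1, h2, two_mul])

/-- In dimension at least two, the integral over the sphere of a decreasing function of `|cos ∠(v,
e)|` is controlled by its integral over `(0, 1]`. Since the function decreases, its value at `e` is
at most its average over the segment `(0, e]`, so the integral over the sphere can be replaced by
one over the ball, and then by one over a box with an edge along `v`. -/
theorem lintegral_sphere_le_of_antitone {m : ℕ} {ψ : ℝ → ℝ≥0∞} (hψm : Measurable ψ)
    (hψ : ∀ a b, 0 ≤ a → a ≤ b → ψ b ≤ ψ a) {v : EuclideanSpace ℝ (Fin (m + 2))} (hv : ‖v‖ = 1) :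
    ∫⁻ e, ψ |inner ℝ v e.1| ∂(volume : Measure (EuclideanSpace ℝ (Fin (m + 2)))).toSphere ≤
      (m + 2) * 2 ^ (m + 2) * ∫⁻ t in Set.Ioc (0 : ℝ) 1, ψ t := by
  have habs := setLIntegral_comp_abs_le ψ
  rw [pow_succ, ← mul_assoc, mul_assoc]
  refine le_trans ?_ (mul_le_mul' le_rfl habs)
  clear habs
  set F : EuclideanSpace ℝ (Fin (m + 2)) → ℝ≥0∞ :=
    (Metric.closedBall 0 1).indicator fun x => ψ |inner ℝ v x| with hF
  have hFm : Measurable F := by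
    refine Measurable.indicator ?_ measurableSet_closedBall
    fun_prop
  -- by monotonicity, pass from the sphere to the unit ball
  have lower : ∫⁻ e, ψ |inner ℝ v e.1| ∂(volume : Measure (EuclideanSpace ℝ (Fin (m + 2)))).toSphere
      ≤ (m + 2) * ∫⁻ x, F x := by
    rw [lintegral_polar hFm, ← lintegral_const_mul']
    · refine lintegral_mono fun e => ?_
      have hle : ∫⁻ ρ in Set.Ioc (0 : ℝ) 1, ENNReal.ofReal (ρ ^ (m + 1)) * ψ |inner ℝ v e.1| ≤
          ∫⁻ ρ in Set.Ioi (0 : ℝ), ENNReal.ofReal (ρ ^ (m + 1)) * F (ρ • e.1) := by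
        refine le_trans ?_ (lintegral_mono_set (fun x (hx : x ∈ Set.Ioc (0 : ℝ) 1) => hx.1))
        refine setLIntegral_mono' measurableSet_Ioc fun ρ hρ => ?_
        gcongr
        have hmem : ρ • e.1 ∈ Metric.closedBall (0 : EuclideanSpace ℝ (Fin (m + 2))) 1 := by
          simp [norm_smul, abs_of_pos hρ.1, hρ.2]
        rw [hF, Set.indicator_of_mem hmem, inner_smul_right, abs_mul, abs_of_pos hρ.1]
        exact hψ _ _ (by have := hρ.1; positivity)
          (mul_le_of_le_one_left (abs_nonneg _) hρ.2)
      have hint : ∫⁻ ρ in Set.Ioc (0 : ℝ) 1, ENNReal.ofReal (ρ ^ (m + 1)) =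
          ENNReal.ofReal (1 / (m + 2)) := by
        rw [← ofReal_integral_eq_lintegral_ofReal, ← intervalIntegral.integral_of_le zero_le_one]
        · simp [integral_pow]; ring_nf
        · exact (intervalIntegrable_iff_integrableOn_Ioc_of_le zero_le_one).1
            (intervalIntegral.intervalIntegrable_pow _)
        · filter_upwards [ae_restrict_mem measurableSet_Ioc] with y hy
          exact pow_nonneg hy.1.le _
      rw [lintegral_mul_const _ (by fun_prop), hint] at hle
      calc ψ |inner ℝ v e.1| = (m + 2) * (ENNReal.ofReal (1 / (m + 2)) * ψ |inner ℝ v e.1|) := by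
            rw [← mul_assoc]
            have : ((m : ℝ≥0∞) + 2) = ENNReal.ofReal (m + 2) := by
              rw [ENNReal.ofReal_add (by positivity) (by norm_num)]; simp
            rw [this, ← ENNReal.ofReal_mul (by positivity)]
            rw [mul_one_div_cancel (by positivity)]; simp
        _ ≤ _ := by gcongr
    · finiteness
  refine lower.trans ?_
  rw [mul_assoc]
  gcongr
  obtain ⟨Ψ, hmp, -, hinner, hb⟩ := exists_line_coordinates hv
  rw [← hmp.lintegral_comp hFm]
  -- the ball is contained in the box `[-1, 1] × [-1, 1]^(m + 1)` in coordinates along `v`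
  have hbox : ∀ p : ℝ × (Fin (m + 1) → ℝ), F (Ψ p) ≤
      (Set.Icc (-1 : ℝ) 1).indicator (fun a => ψ |a|) p.1 *
        (Set.Icc (-1 : Fin (m + 1) → ℝ) 1).indicator 1 p.2 := by
    rintro ⟨a, b⟩
    by_cases h : Ψ (a, b) ∈ Metric.closedBall (0 : EuclideanSpace ℝ (Fin (m + 2))) 1
    · have h1 : ‖Ψ (a, b)‖ ≤ 1 := by simpa using h
      have ha : |a| ≤ 1 := by
        rw [← hinner a b]
        exact (abs_real_inner_le_norm _ _).trans (by rw [hv, one_mul]; exact h1)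
      rw [hF, Set.indicator_of_mem h, Set.indicator_of_mem (s := Set.Icc (-1 : ℝ) 1) (abs_le.1 ha),
        Set.indicator_of_mem ?_]
      · simp [hinner]
      · exact ⟨fun i => (abs_le.1 ((hb a b i).trans h1)).1,
          fun i => (abs_le.1 ((hb a b i).trans h1)).2⟩
    · rw [hF, Set.indicator_of_notMem h]; exact zero_le
  refine (lintegral_mono hbox).trans ?_
  rw [Measure.volume_eq_prod, lintegral_prod_mul, lintegral_indicator measurableSet_Icc,
    lintegral_indicator_one measurableSet_Icc, mul_comm]
  · gcongr
    rw [Real.volume_Icc_pi]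
    simp; norm_num
  · exact ((by fun_prop : Measurable fun a : ℝ => ψ |a|).indicator measurableSet_Icc).aemeasurable
  · exact (measurable_one.indicator measurableSet_Icc).aemeasurable

/-! ### Trilinear forms on the paraboloid -/

theorem lintegral_comp_affine_le {φ : ℝ → ℝ≥0∞} {ρ : ℝ} (hρ : 0 < ρ) (c : ℝ) :
    ENNReal.ofReal ρ * ∫⁻ a, φ (c + ρ * a) ≤ ∫⁻ t, φ t := by
  have h := lintegral_image_eq_lintegral_abs_deriv_mul (s := Set.univ)
    (f := fun a => c + ρ * a) (f' := fun _ => ρ) MeasurableSet.univ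
    (fun x _ => by
      have := ((hasDerivAt_id x).const_mul ρ).const_add c
      exact (this.congr_deriv (by simp)).hasDerivWithinAt)
    (fun x _ y _ hxy => by
      have : ρ * (x - y) = 0 := by simp only at hxy; linarith
      rcases mul_eq_zero.1 this with h | h <;> linarith) φ
  rw [abs_of_pos hρ, setLIntegral_univ, lintegral_const_mul' _ _ (by finiteness)] at h
  rw [← h]
  exact setLIntegral_le_lintegral _ _

/-- Cauchy–Schwarz on the fibres of `(x, y) ↦ (x + y, |x|² + |y|²)`. With `x = ξ/2 + η`, `y = ξ/2 -
η` the second component is `2|η|² + |ξ|²/2`, so the fibres are spheres in `η`, and it suffices to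
bound the square integral of the weight over each of them. -/
theorem sq_lintegral_output_fibre_le {m : ℕ}
    {w : EuclideanSpace ℝ (Fin (m + 2)) × EuclideanSpace ℝ (Fin (m + 2)) → ℝ≥0∞}
    (hw : Measurable w) {K : ℝ≥0∞}
    (hK : ∀ (ξ : EuclideanSpace ℝ (Fin (m + 2))) (R : ℝ), 0 < R →
      ENNReal.ofReal (R ^ m) * ∫⁻ e, w ((1 / 2 : ℝ) • ξ + R • e.1, (1 / 2 : ℝ) • ξ - R • e.1) ^ 2
        ∂(volume : Measure (EuclideanSpace ℝ (Fin (m + 2)))).toSphere ≤ K)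
    {f g : EuclideanSpace ℝ (Fin (m + 2)) → ℝ≥0∞} {H : Spacetime (m + 2) → ℝ≥0∞}
    (hf : Measurable f) (hg : Measurable g) (hH : Measurable H) :
    (∫⁻ x, ∫⁻ y, f x * g y * H (x + y, ‖x‖ ^ 2 + ‖y‖ ^ 2) * w (x, y)) ^ 2 ≤
      K * (∫⁻ x, f x ^ 2) * (∫⁻ x, g x ^ 2) * ∫⁻ ζ, H ζ ^ 2 := by
  have hQ : Measurable fun p : EuclideanSpace ℝ (Fin (m + 2)) × EuclideanSpace ℝ (Fin (m + 2)) =>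
      H (p.1 + p.2, ‖p.1‖ ^ 2 + ‖p.2‖ ^ 2) ^ 2 * w p ^ 2 := by fun_prop
  have cs : (∫⁻ x, ∫⁻ y, f x * g y * H (x + y, ‖x‖ ^ 2 + ‖y‖ ^ 2) * w (x, y)) ^ 2 ≤
      (∫⁻ x, ∫⁻ y, f x ^ 2 * g y ^ 2) *
        ∫⁻ x, ∫⁻ y, H (x + y, ‖x‖ ^ 2 + ‖y‖ ^ 2) ^ 2 * w (x, y) ^ 2 := by
    refine lintegral_sq_le_of_sq_le
      ((by fun_prop : Measurable fun p : EuclideanSpace ℝ (Fin (m + 2)) ×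
        EuclideanSpace ℝ (Fin (m + 2)) => f p.1 ^ 2 * g p.2 ^ 2).lintegral_prod_right').aemeasurable
      hQ.lintegral_prod_right'.aemeasurable (.of_forall fun x => ?_)
    refine lintegral_sq_le_of_sq_le (by fun_prop)
      (hQ.comp (by fun_prop : Measurable fun y => (x, y))).aemeasurable (.of_forall fun y => ?_)
    exact le_of_eq (by ring)
  have hfg : ∫⁻ x, ∫⁻ y, f x ^ 2 * g y ^ 2 = (∫⁻ x, f x ^ 2) * ∫⁻ y, g y ^ 2 := by
    simp_rw [lintegral_const_mul _ (hg.pow_const 2)]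
    rw [lintegral_mul_const _ (hf.pow_const 2)]
  have hcov : ∫⁻ x, ∫⁻ y, H (x + y, ‖x‖ ^ 2 + ‖y‖ ^ 2) ^ 2 * w (x, y) ^ 2 =
      ∫⁻ ξ : EuclideanSpace ℝ (Fin (m + 2)), ∫⁻ η : EuclideanSpace ℝ (Fin (m + 2)),
        H (ξ, 2 * ‖η‖ ^ 2 + ‖ξ‖ ^ 2 / 2) ^ 2 *
          w ((1 / 2 : ℝ) • ξ + η, (1 / 2 : ℝ) • ξ - η) ^ 2 := by
    have h1 : ∀ x, ∫⁻ y, H (x + y, ‖x‖ ^ 2 + ‖y‖ ^ 2) ^ 2 * w (x, y) ^ 2 =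
        ∫⁻ ξ, H (x + (ξ - x), ‖x‖ ^ 2 + ‖ξ - x‖ ^ 2) ^ 2 * w (x, ξ - x) ^ 2 := fun x =>
      (lintegral_sub_right_eq_self
        (fun y => H (x + y, ‖x‖ ^ 2 + ‖y‖ ^ 2) ^ 2 * w (x, y) ^ 2) x).symm
    simp_rw [h1]
    rw [lintegral_lintegral_swap (by
      exact (hQ.comp (by fun_prop : Measurable fun p : EuclideanSpace ℝ (Fin (m + 2)) ×
        EuclideanSpace ℝ (Fin (m + 2)) => (p.1, p.2 - p.1))).aemeasurable)]
    refine lintegral_congr fun ξ => ?_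
    rw [← lintegral_add_left_eq_self _ ((1 / 2 : ℝ) • ξ)]
    refine lintegral_congr fun η => ?_
    have e1 : ξ - ((1 / 2 : ℝ) • ξ + η) = (1 / 2 : ℝ) • ξ - η := by module
    have e2 : (1 / 2 : ℝ) • ξ + η + ((1 / 2 : ℝ) • ξ - η) = ξ := by module
    have e3 : ‖(1 / 2 : ℝ) • ξ + η‖ ^ 2 + ‖(1 / 2 : ℝ) • ξ - η‖ ^ 2 =
        2 * ‖η‖ ^ 2 + ‖ξ‖ ^ 2 / 2 := by
      have := parallelogram_law_with_norm ℝ ((1 / 2 : ℝ) • ξ) η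
      rw [norm_smul] at this
      norm_num at this
      linarith
    rw [e1, e2, e3]
  have hfibre : ∀ ξ : EuclideanSpace ℝ (Fin (m + 2)), ∫⁻ η : EuclideanSpace ℝ (Fin (m + 2)),
        H (ξ, 2 * ‖η‖ ^ 2 + ‖ξ‖ ^ 2 / 2) ^ 2 *
          w ((1 / 2 : ℝ) • ξ + η, (1 / 2 : ℝ) • ξ - η) ^ 2 ≤ K * ∫⁻ τ, H (ξ, τ) ^ 2 := by
    intro ξ
    rw [lintegral_polar (by fun_prop), lintegral_lintegral_swap (by fun_prop)]
    have h2 : ∀ ρ ∈ Set.Ioi (0 : ℝ), ∫⁻ e, ENNReal.ofReal (ρ ^ (m + 1)) *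
        (H (ξ, 2 * ‖ρ • e.1‖ ^ 2 + ‖ξ‖ ^ 2 / 2) ^ 2 *
          w ((1 / 2 : ℝ) • ξ + ρ • e.1, (1 / 2 : ℝ) • ξ - ρ • e.1) ^ 2)
        ∂(volume : Measure (EuclideanSpace ℝ (Fin (m + 2)))).toSphere ≤
        K * (ENNReal.ofReal (4 * ρ) * H (ξ, 2 * ρ ^ 2 + ‖ξ‖ ^ 2 / 2) ^ 2) := by
      intro ρ hρ
      have hρ' : 0 < ρ := hρ
      have h3 : ∀ e : Metric.sphere (0 : EuclideanSpace ℝ (Fin (m + 2))) 1,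
          ENNReal.ofReal (ρ ^ (m + 1)) * (H (ξ, 2 * ‖ρ • e.1‖ ^ 2 + ‖ξ‖ ^ 2 / 2) ^ 2 *
          w ((1 / 2 : ℝ) • ξ + ρ • e.1, (1 / 2 : ℝ) • ξ - ρ • e.1) ^ 2) =
          (ENNReal.ofReal ρ * H (ξ, 2 * ρ ^ 2 + ‖ξ‖ ^ 2 / 2) ^ 2) * (ENNReal.ofReal (ρ ^ m)) *
          w ((1 / 2 : ℝ) • ξ + ρ • e.1, (1 / 2 : ℝ) • ξ - ρ • e.1) ^ 2 := by
        intro e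
        have : ‖ρ • e.1‖ = ρ := by simp [norm_smul, abs_of_pos hρ']
        rw [this, pow_succ, ENNReal.ofReal_mul (by positivity)]
        ring
      simp_rw [h3]
      rw [lintegral_const_mul _ (by fun_prop), mul_assoc]
      calc _ ≤ (ENNReal.ofReal (4 * ρ) * H (ξ, 2 * ρ ^ 2 + ‖ξ‖ ^ 2 / 2) ^ 2) * K := by
            gcongr
            · linarith
            · exact hK ξ ρ hρ'
        _ = _ := mul_comm _ _
    refine (setLIntegral_mono' measurableSet_Ioi h2).trans ?_
    rw [lintegral_const_mul _ (by fun_prop)]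
    refine mul_le_mul' le_rfl ?_
    exact lintegral_Ioi_quadratic_le (H := fun τ => H (ξ, τ) ^ 2) _
  rw [hfg, hcov] at cs
  refine cs.trans ?_
  have hHint : ∫⁻ ζ, H ζ ^ 2 = ∫⁻ ξ, ∫⁻ τ, H (ξ, τ) ^ 2 := by
    rw [Measure.volume_eq_prod, lintegral_prod _ (by fun_prop)]
  calc _ ≤ ((∫⁻ x, f x ^ 2) * ∫⁻ x, g x ^ 2) * (∫⁻ ξ, K * ∫⁻ τ, H (ξ, τ) ^ 2) := by
        gcongr; exact hfibre _
    _ = _ := by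
        rw [lintegral_const_mul _ (by
          exact (hH.pow_const 2).lintegral_prod_right'), hHint]; ring

theorem lintegral_polar_sq {m : ℕ} {f : EuclideanSpace ℝ (Fin (m + 2)) → ℝ≥0∞}
    (hf : Measurable f) : ∫⁻ x, f x ^ 2 = ∫⁻ e, ∫⁻ ρ in Set.Ioi (0 : ℝ),
      ENNReal.ofReal (ρ ^ (m + 1)) * f (ρ • e.1) ^ 2
      ∂volume ∂(volume : Measure (EuclideanSpace ℝ (Fin (m + 2)))).toSphere :=
  lintegral_polar (hf.pow_const 2)

/-- For a fixed direction `e` the map `(ρ, y) ↦ (ρ e + y, ρ² + |y|²)` is at most two-to-one, with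
Jacobian `2 |ρ - e·y|`. -/
theorem lintegral_direction_output_le {m : ℕ} {H : Spacetime (m + 2) → ℝ≥0∞} (hH : Measurable H)
    {e : EuclideanSpace ℝ (Fin (m + 2))} (he : ‖e‖ = 1) :
    ∫⁻ ρ in Set.Ioi (0 : ℝ), ∫⁻ y, ENNReal.ofReal (2 * |ρ - inner ℝ e y|) *
      H (ρ • e + y, ρ ^ 2 + ‖y‖ ^ 2) ^ 2 ≤ 2 * ∫⁻ ζ, H ζ ^ 2 := by
  have h1 : ∀ ρ : ℝ, ∫⁻ y, ENNReal.ofReal (2 * |ρ - inner ℝ e y|) *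
      H (ρ • e + y, ρ ^ 2 + ‖y‖ ^ 2) ^ 2 = ∫⁻ ξ, ENNReal.ofReal (4 * |ρ - inner ℝ e ξ / 2|) *
      H (ξ, 2 * (ρ - inner ℝ e ξ / 2) ^ 2 + (‖ξ‖ ^ 2 - (inner ℝ e ξ) ^ 2 / 2)) ^ 2 := by
    intro ρ
    rw [← lintegral_sub_right_eq_self _ (ρ • e)]
    refine lintegral_congr fun ξ => ?_
    have i1 : inner ℝ e (ξ - ρ • e) = inner ℝ e ξ - ρ := by
      rw [inner_sub_right, inner_smul_right, real_inner_self_eq_norm_sq, he]; ring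
    have i2 : ‖ξ - ρ • e‖ ^ 2 = ‖ξ‖ ^ 2 - 2 * ρ * inner ℝ e ξ + ρ ^ 2 := by
      rw [norm_sub_sq_real, inner_smul_right, norm_smul, he, real_inner_comm]
      simp; ring
    have i3 : 2 * |ρ - inner ℝ e (ξ - ρ • e)| = 4 * |ρ - inner ℝ e ξ / 2| := by
      rw [i1, show ρ - (inner ℝ e ξ - ρ) = 2 * (ρ - inner ℝ e ξ / 2) by ring, abs_mul]
      norm_num; ring
    rw [i3, i2]
    congr 3
    ext1
    · simp
    · simp; ring
  simp_rw [h1]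
  refine (setLIntegral_le_lintegral _ _).trans ?_
  rw [lintegral_lintegral_swap (by fun_prop), Measure.volume_eq_prod,
    lintegral_prod _ (by fun_prop), ← lintegral_const_mul _ (by
      exact (hH.pow_const 2).lintegral_prod_right')]
  refine lintegral_mono fun ξ => ?_
  rw [lintegral_sub_right_eq_self (fun s => ENNReal.ofReal (4 * |s|) *
      H (ξ, 2 * s ^ 2 + (‖ξ‖ ^ 2 - (inner ℝ e ξ) ^ 2 / 2)) ^ 2) (inner ℝ e ξ / 2)]
  exact lintegral_quadratic_le (H := fun τ => H (ξ, τ) ^ 2) _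

/-- Cauchy–Schwarz for a fixed direction `e` of the first input, and then in `e`. Where the Jacobian
`2 |ρ - e·y|` is at least `ρ`, it absorbs one power of the polar density `ρ^(m+1)`; the remaining
`ρ^m` is attached to the weight, and only the average over the directions `e` of a majorant `B` of
`ρ^m w²` has to be finite. -/
theorem sq_lintegral_output_direction_le {m : ℕ}
    {w : EuclideanSpace ℝ (Fin (m + 2)) × EuclideanSpace ℝ (Fin (m + 2)) → ℝ≥0∞}
    (hw : Measurable w)
    (hsupp : ∀ x y, w (x, y) ≠ 0 → ‖x‖ ^ 2 / 2 ≤ |‖x‖ ^ 2 - inner ℝ x y|)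
    {B : EuclideanSpace ℝ (Fin (m + 2)) × EuclideanSpace ℝ (Fin (m + 2)) → ℝ≥0∞}
    (hB : Measurable B) {K : ℝ≥0∞}
    (hwB : ∀ e y ρ, ‖e‖ = 1 → 0 < ρ → ENNReal.ofReal (ρ ^ m) * w (ρ • e, y) ^ 2 ≤ B (e, y))
    (hK : ∀ y, y ≠ 0 → ∫⁻ e, B (e.1, y)
      ∂(volume : Measure (EuclideanSpace ℝ (Fin (m + 2)))).toSphere ≤ K)
    {f g : EuclideanSpace ℝ (Fin (m + 2)) → ℝ≥0∞} {H : Spacetime (m + 2) → ℝ≥0∞}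
    (hf : Measurable f) (hg : Measurable g) (hH : Measurable H) :
    (∫⁻ x, ∫⁻ y, f x * g y * H (x + y, ‖x‖ ^ 2 + ‖y‖ ^ 2) * w (x, y)) ^ 2 ≤
      2 * K * (∫⁻ x, f x ^ 2) * (∫⁻ x, g x ^ 2) * ∫⁻ ζ, H ζ ^ 2 := by
  set σ := (volume : Measure (EuclideanSpace ℝ (Fin (m + 2)))).toSphere with hσ
  rw [lintegral_polar (by
    exact (by fun_prop : Measurable fun p : EuclideanSpace ℝ (Fin (m + 2)) ×
      EuclideanSpace ℝ (Fin (m + 2)) => f p.1 * g p.2 *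
        H (p.1 + p.2, ‖p.1‖ ^ 2 + ‖p.2‖ ^ 2) * w p).lintegral_prod_right')]
  have hfm : Measurable fun p : (Metric.sphere (0 : EuclideanSpace ℝ (Fin (m + 2))) 1) × ℝ =>
      ENNReal.ofReal (p.2 ^ (m + 1)) * f (p.2 • p.1.1) ^ 2 := by fun_prop
  have hgm : Measurable fun p : (Metric.sphere (0 : EuclideanSpace ℝ (Fin (m + 2))) 1) ×
      EuclideanSpace ℝ (Fin (m + 2)) => g p.2 ^ 2 * B (p.1.1, p.2) := by fun_prop
  have main : ∀ e : Metric.sphere (0 : EuclideanSpace ℝ (Fin (m + 2))) 1,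
      (∫⁻ ρ in Set.Ioi (0 : ℝ), ENNReal.ofReal (ρ ^ (m + 1)) *
        ∫⁻ y, f (ρ • e.1) * g y * H (ρ • e.1 + y, ‖ρ • e.1‖ ^ 2 + ‖y‖ ^ 2) *
          w (ρ • e.1, y)) ^ 2 ≤
      (∫⁻ ρ in Set.Ioi (0 : ℝ), ENNReal.ofReal (ρ ^ (m + 1)) * f (ρ • e.1) ^ 2) *
        (((∫⁻ y, g y ^ 2 * B (e.1, y))) * (2 * ∫⁻ ζ, H ζ ^ 2)) := by
    intro e
    have he : ‖e.1‖ = 1 := by simp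
    have hQm : Measurable fun p : ℝ × EuclideanSpace ℝ (Fin (m + 2)) =>
        ENNReal.ofReal (2 * |p.1 - inner ℝ e.1 p.2|) *
          H (p.1 • e.1 + p.2, p.1 ^ 2 + ‖p.2‖ ^ 2) ^ 2 := by fun_prop
    have hPm : Measurable fun p : ℝ × EuclideanSpace ℝ (Fin (m + 2)) =>
        ENNReal.ofReal (p.1 ^ (m + 1)) * f (p.1 • e.1) ^ 2 * (g p.2 ^ 2 * B (e.1, p.2)) := by
      fun_prop
    have cs : (∫⁻ ρ in Set.Ioi (0 : ℝ), ∫⁻ y, ENNReal.ofReal (ρ ^ (m + 1)) *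
        (f (ρ • e.1) * g y * H (ρ • e.1 + y, ‖ρ • e.1‖ ^ 2 + ‖y‖ ^ 2) * w (ρ • e.1, y))) ^ 2 ≤
        (∫⁻ ρ in Set.Ioi (0 : ℝ), ∫⁻ y,
          ENNReal.ofReal (ρ ^ (m + 1)) * f (ρ • e.1) ^ 2 * (g y ^ 2 * B (e.1, y))) *
        ∫⁻ ρ in Set.Ioi (0 : ℝ), ∫⁻ y, ENNReal.ofReal (2 * |ρ - inner ℝ e.1 y|) *
          H (ρ • e.1 + y, ρ ^ 2 + ‖y‖ ^ 2) ^ 2 := by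
      refine lintegral_sq_le_of_sq_le hPm.lintegral_prod_right'.aemeasurable
        hQm.lintegral_prod_right'.aemeasurable ?_
      filter_upwards [ae_restrict_mem measurableSet_Ioi] with ρ hρ
      have hρ' : 0 < ρ := hρ
      refine lintegral_sq_le_of_sq_le (by fun_prop) (by fun_prop) (.of_forall fun y => ?_)
      have hn : ‖ρ • e.1‖ = ρ := by simp [norm_smul, abs_of_pos hρ']
      rw [hn]
      by_cases h0 : w (ρ • e.1, y) = 0
      · simp [h0]
      have h1 := hsupp _ _ h0
      rw [hn, inner_smul_left] at h1
      have h2 : ρ ≤ 2 * |ρ - inner ℝ e.1 y| := by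
        have : ρ ^ 2 - (starRingEnd ℝ) ρ * inner ℝ e.1 y = ρ * (ρ - inner ℝ e.1 y) := by
          simp; ring
        rw [this, abs_mul, abs_of_pos hρ'] at h1
        have h3 : ρ * ρ ≤ ρ * (2 * |ρ - inner ℝ e.1 y|) := by nlinarith
        exact le_of_mul_le_mul_left h3 hρ'
      calc _ = ENNReal.ofReal (ρ ^ (m + 1)) * f (ρ • e.1) ^ 2 *
            (g y ^ 2 * (ENNReal.ofReal (ρ ^ m) * w (ρ • e.1, y) ^ 2)) *
            (ENNReal.ofReal ρ * H (ρ • e.1 + y, ρ ^ 2 + ‖y‖ ^ 2) ^ 2) := by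
            rw [pow_succ ρ m, ENNReal.ofReal_mul (by positivity)]; ring
        _ ≤ _ := by
            gcongr
            exact hwB e.1 y ρ he hρ'
    have hIeq : ∀ ρ, ∫⁻ y, ENNReal.ofReal (ρ ^ (m + 1)) *
        (f (ρ • e.1) * g y * H (ρ • e.1 + y, ‖ρ • e.1‖ ^ 2 + ‖y‖ ^ 2) * w (ρ • e.1, y)) =
        ENNReal.ofReal (ρ ^ (m + 1)) *
        ∫⁻ y, f (ρ • e.1) * g y * H (ρ • e.1 + y, ‖ρ • e.1‖ ^ 2 + ‖y‖ ^ 2) *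
          w (ρ • e.1, y) := fun ρ => lintegral_const_mul _ (by fun_prop)
    simp_rw [hIeq] at cs
    refine cs.trans ?_
    rw [← mul_assoc]
    refine mul_le_mul' (le_of_eq ?_) (lintegral_direction_output_le hH he)
    rw [← lintegral_mul_const _ (by fun_prop)]
    refine lintegral_congr fun ρ => ?_
    rw [lintegral_const_mul _ (by fun_prop)]
  refine (lintegral_sq_le_of_sq_le (hfm.lintegral_prod_right'.aemeasurable)
    ((hgm.lintegral_prod_right'.mul_const _).aemeasurable) (.of_forall main)).trans ?_
  rw [← lintegral_polar_sq hf, lintegral_mul_const _ hgm.lintegral_prod_right',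
    lintegral_lintegral_swap (by fun_prop)]
  have h4 : ∫⁻ y, ∫⁻ e, g y ^ 2 * B (e.1, y) ∂σ ≤ (∫⁻ y, g y ^ 2) * K := by
    rw [← lintegral_mul_const _ (by fun_prop)]
    refine lintegral_mono_ae ?_
    filter_upwards [Measure.ae_ne volume (0 : EuclideanSpace ℝ (Fin (m + 2)))] with y hy
    rw [lintegral_const_mul _ (by fun_prop)]
    gcongr
    exact hK y hy
  calc _ ≤ (∫⁻ x, f x ^ 2) * ((∫⁻ y, g y ^ 2) * K * (2 * ∫⁻ ζ, H ζ ^ 2)) := by gcongr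
    _ = _ := by ring

/-- For a fixed direction `e`, the form splits into forms over the lines parallel to `e`, on which
Cauchy–Schwarz is applied in `ρ` and in the coordinate `a` along the line. -/
theorem sq_lintegral_direction_slice_le {m : ℕ}
    {e : EuclideanSpace ℝ (Fin (m + 2))} (he : ‖e‖ = 1)
    {F : ℝ × ℝ → ℝ≥0∞} {G h : EuclideanSpace ℝ (Fin (m + 2)) → ℝ≥0∞}
    (hF : Measurable F) (hG : Measurable G) (hh : Measurable h)
    {I : ℝ × EuclideanSpace ℝ (Fin (m + 2)) → ℝ≥0∞} (hI : Measurable I)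
    (hle : ∀ ρ y, 0 < ρ → I (ρ, y) ^ 2 ≤ F (ρ, inner ℝ e y) * (G y * h (y + ρ • e) ^ 2)) :
    (∫⁻ ρ in Set.Ioi (0 : ℝ), ∫⁻ y, I (ρ, y)) ^ 2 ≤
      (∫⁻ ρ in Set.Ioi (0 : ℝ), ∫⁻ a, F (ρ, a)) * ((∫⁻ y, G y) * ∫⁻ x, h x ^ 2) := by
  obtain ⟨Ψ, hmp, hadd, hinner, -⟩ := exists_line_coordinates he
  have hΨ := hmp.measurable
  have slice : ∀ {u : EuclideanSpace ℝ (Fin (m + 2)) → ℝ≥0∞}, Measurable u →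
      ∫⁻ y, u y = ∫⁻ b, ∫⁻ a, u (Ψ (a, b)) := fun {u} hu => by
    rw [← hmp.lintegral_comp hu, Measure.volume_eq_prod,
      lintegral_prod_symm _ (by fun_prop)]
  have e1 : ∫⁻ ρ in Set.Ioi (0 : ℝ), ∫⁻ y, I (ρ, y) =
      ∫⁻ b, ∫⁻ ρ in Set.Ioi (0 : ℝ), ∫⁻ a, I (ρ, Ψ (a, b)) := by
    have : ∀ ρ, ∫⁻ y, I (ρ, y) = ∫⁻ b, ∫⁻ a, I (ρ, Ψ (a, b)) := fun ρ =>
      slice (u := fun y => I (ρ, y)) (by fun_prop)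
    simp_rw [this]
    rw [lintegral_lintegral_swap]
    exact (Measurable.lintegral_prod_right' (by fun_prop :
      Measurable fun q : (ℝ × (Fin (m + 1) → ℝ)) × ℝ => I (q.1.1, Ψ (q.2, q.1.2)))).aemeasurable
  have hgb : Measurable fun b => ∫⁻ a, G (Ψ (a, b)) :=
    (by fun_prop : Measurable fun q : (Fin (m + 1) → ℝ) × ℝ =>
      G (Ψ (q.2, q.1))).lintegral_prod_right'
  have hhb : Measurable fun b => ∫⁻ a, h (Ψ (a, b)) ^ 2 :=
    (by fun_prop : Measurable fun q : (Fin (m + 1) → ℝ) × ℝ =>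
      h (Ψ (q.2, q.1)) ^ 2).lintegral_prod_right'
  have main : ∀ b, (∫⁻ ρ in Set.Ioi (0 : ℝ), ∫⁻ a, I (ρ, Ψ (a, b))) ^ 2 ≤
      ((∫⁻ ρ in Set.Ioi (0 : ℝ), ∫⁻ a, F (ρ, a)) * ∫⁻ a, G (Ψ (a, b))) *
        ∫⁻ a, h (Ψ (a, b)) ^ 2 := by
    intro b
    have hQm : Measurable fun p : ℝ × ℝ => G (Ψ (p.2, b)) * h (Ψ (p.2 + p.1, b)) ^ 2 := by
      fun_prop
    have cs : (∫⁻ ρ in Set.Ioi (0 : ℝ), ∫⁻ a, I (ρ, Ψ (a, b))) ^ 2 ≤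
        (∫⁻ ρ in Set.Ioi (0 : ℝ), ∫⁻ a, F (ρ, a)) *
        ∫⁻ ρ in Set.Ioi (0 : ℝ), ∫⁻ a, G (Ψ (a, b)) * h (Ψ (a + ρ, b)) ^ 2 := by
      refine lintegral_sq_le_of_sq_le hF.lintegral_prod_right'.aemeasurable
        hQm.lintegral_prod_right'.aemeasurable ?_
      filter_upwards [ae_restrict_mem measurableSet_Ioi] with ρ hρ
      refine lintegral_sq_le_of_sq_le (by fun_prop) (by fun_prop) (.of_forall fun a => ?_)
      have := hle ρ (Ψ (a, b)) hρ
      rwa [hinner, ← hadd] at this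
    refine cs.trans ?_
    rw [mul_assoc]
    refine mul_le_mul' le_rfl ((setLIntegral_le_lintegral _ _).trans ?_)
    rw [lintegral_lintegral_swap (by fun_prop), ← lintegral_mul_const _ (by fun_prop)]
    refine lintegral_mono fun a => ?_
    rw [lintegral_const_mul _ (by fun_prop),
      lintegral_add_left_eq_self (fun ρ => h (Ψ (ρ, b)) ^ 2) a]
  rw [e1]
  refine (lintegral_sq_le_of_sq_le (hgb.const_mul _).aemeasurable hhb.aemeasurable
    (.of_forall main)).trans ?_
  rw [lintegral_const_mul _ hgb, ← slice hG, ← slice (hh.pow_const 2), mul_assoc]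

/-- The counterpart of `sq_lintegral_output_direction_le` when the time frequency is free at the
first input. For a fixed direction the time frequency `ρ² + 2 ρ e·y` is affine in the component
`e·y`, with slope `2ρ`, so that no transversality condition on the support of the weight is needed.
-/
theorem sq_lintegral_input_direction_le {m : ℕ}
    {w : EuclideanSpace ℝ (Fin (m + 2)) × EuclideanSpace ℝ (Fin (m + 2)) → ℝ≥0∞}
    (hw : Measurable w)
    {B : EuclideanSpace ℝ (Fin (m + 2)) × EuclideanSpace ℝ (Fin (m + 2)) → ℝ≥0∞}
    (hB : Measurable B) {K : ℝ≥0∞}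
    (hwB : ∀ e y ρ, ‖e‖ = 1 → 0 < ρ → ENNReal.ofReal (ρ ^ m) * w (ρ • e, y) ^ 2 ≤ B (e, y))
    (hK : ∀ y, y ≠ 0 → ∫⁻ e, B (e.1, y)
      ∂(volume : Measure (EuclideanSpace ℝ (Fin (m + 2)))).toSphere ≤ K)
    {F : Spacetime (m + 2) → ℝ≥0∞} {g h : EuclideanSpace ℝ (Fin (m + 2)) → ℝ≥0∞}
    (hF : Measurable F) (hg : Measurable g) (hh : Measurable h) :
    (∫⁻ x, ∫⁻ y, F (x, ‖x‖ ^ 2 + 2 * inner ℝ x y) * g y * h (x + y) * w (x, y)) ^ 2 ≤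
      K * (∫⁻ ζ, F ζ ^ 2) * (∫⁻ x, g x ^ 2) * ∫⁻ x, h x ^ 2 := by
  set σ := (volume : Measure (EuclideanSpace ℝ (Fin (m + 2)))).toSphere with hσ
  have hI0 : Measurable fun p : EuclideanSpace ℝ (Fin (m + 2)) × EuclideanSpace ℝ (Fin (m + 2)) =>
      F (p.1, ‖p.1‖ ^ 2 + 2 * inner ℝ p.1 p.2) * g p.2 * h (p.1 + p.2) * w p := by fun_prop
  have hgm : Measurable fun p : (Metric.sphere (0 : EuclideanSpace ℝ (Fin (m + 2))) 1) ×
      EuclideanSpace ℝ (Fin (m + 2)) => g p.2 ^ 2 * B (p.1.1, p.2) := by fun_prop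
  have hFm : Measurable fun x => ∫⁻ τ, F (x, τ) ^ 2 := (hF.pow_const 2).lintegral_prod_right'
  have hfm : Measurable fun p : (Metric.sphere (0 : EuclideanSpace ℝ (Fin (m + 2))) 1) × ℝ =>
      ENNReal.ofReal (p.2 ^ (m + 1)) * ∫⁻ τ, F (p.2 • p.1.1, τ) ^ 2 :=
    (by fun_prop : Measurable fun p : (Metric.sphere (0 : EuclideanSpace ℝ (Fin (m + 2))) 1) × ℝ =>
      ENNReal.ofReal (p.2 ^ (m + 1))).mul (hFm.comp (by fun_prop : Measurable fun
        p : (Metric.sphere (0 : EuclideanSpace ℝ (Fin (m + 2))) 1) × ℝ => p.2 • p.1.1))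
  rw [lintegral_polar hI0.lintegral_prod_right']
  have main : ∀ e : Metric.sphere (0 : EuclideanSpace ℝ (Fin (m + 2))) 1,
      (∫⁻ ρ in Set.Ioi (0 : ℝ), ENNReal.ofReal (ρ ^ (m + 1)) *
        ∫⁻ y, F (ρ • e.1, ‖ρ • e.1‖ ^ 2 + 2 * inner ℝ (ρ • e.1) y) * g y * h (ρ • e.1 + y) *
          w (ρ • e.1, y)) ^ 2 ≤
      (∫⁻ ρ in Set.Ioi (0 : ℝ), ENNReal.ofReal (ρ ^ (m + 1)) * ∫⁻ τ, F (ρ • e.1, τ) ^ 2) *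
        ((∫⁻ y, g y ^ 2 * B (e.1, y)) * ∫⁻ x, h x ^ 2) := by
    intro e
    have he : ‖e.1‖ = 1 := by simp
    have hIeq : ∀ ρ, ENNReal.ofReal (ρ ^ (m + 1)) *
        ∫⁻ y, F (ρ • e.1, ‖ρ • e.1‖ ^ 2 + 2 * inner ℝ (ρ • e.1) y) * g y * h (ρ • e.1 + y) *
          w (ρ • e.1, y) =
        ∫⁻ y, ENNReal.ofReal (ρ ^ (m + 1)) *
          (F (ρ • e.1, ‖ρ • e.1‖ ^ 2 + 2 * inner ℝ (ρ • e.1) y) * g y * h (ρ • e.1 + y) *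
          w (ρ • e.1, y)) := fun ρ => (lintegral_const_mul _ (by fun_prop)).symm
    simp_rw [hIeq]
    refine (sq_lintegral_direction_slice_le he
      (F := fun p => ENNReal.ofReal (p.1 ^ (m + 1)) * (ENNReal.ofReal (2 * p.1) *
        F (p.1 • e.1, p.1 ^ 2 + (2 * p.1) * p.2) ^ 2))
      (G := fun y => g y ^ 2 * B (e.1, y)) (h := h)
      (I := fun p => ENNReal.ofReal (p.1 ^ (m + 1)) *
          (F (p.1 • e.1, ‖p.1 • e.1‖ ^ 2 + 2 * inner ℝ (p.1 • e.1) p.2) * g p.2 *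
            h (p.1 • e.1 + p.2) * w (p.1 • e.1, p.2)))
      (by fun_prop) (by fun_prop) hh (by fun_prop) ?_).trans ?_
    · intro ρ y hρ
      have hn : ‖ρ • e.1‖ = ρ := by simp [norm_smul, abs_of_pos hρ]
      have hi : ρ ^ 2 + 2 * inner ℝ (ρ • e.1) y = ρ ^ 2 + 2 * ρ * inner ℝ e.1 y := by
        rw [inner_smul_left]; simp; ring
      simp only []
      rw [hn, hi, add_comm (ρ • e.1) y]
      calc _ = ENNReal.ofReal (ρ ^ (m + 1)) * (ENNReal.ofReal ρ *
              F (ρ • e.1, ρ ^ 2 + 2 * ρ * inner ℝ e.1 y) ^ 2) *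
            ((g y ^ 2 * (ENNReal.ofReal (ρ ^ m) * w (ρ • e.1, y) ^ 2)) *
              h (y + ρ • e.1) ^ 2) := by
            rw [pow_succ ρ m, ENNReal.ofReal_mul (by positivity)]; ring
        _ ≤ _ := by
            gcongr
            · linarith
            · exact hwB e.1 y ρ he hρ
    · refine mul_le_mul' ?_ le_rfl
      refine setLIntegral_mono' measurableSet_Ioi fun ρ hρ => ?_
      have hρ' : 0 < ρ := hρ
      dsimp only
      rw [lintegral_const_mul _ (by fun_prop), lintegral_const_mul _ (by fun_prop)]
      refine mul_le_mul' le_rfl ?_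
      exact lintegral_comp_affine_le (φ := fun τ => F (ρ • e.1, τ) ^ 2)
        (by positivity : 0 < 2 * ρ) (ρ ^ 2)
  refine (lintegral_sq_le_of_sq_le (hfm.lintegral_prod_right'.aemeasurable)
    ((hgm.lintegral_prod_right'.mul_const _).aemeasurable) (.of_forall main)).trans ?_
  rw [← lintegral_polar hFm, lintegral_mul_const _ hgm.lintegral_prod_right']
  have h4 : ∫⁻ e, ∫⁻ y, g y ^ 2 * B (e.1, y) ∂volume ∂σ ≤ (∫⁻ y, g y ^ 2) * K := by
    rw [lintegral_lintegral_swap (by fun_prop), ← lintegral_mul_const _ (by fun_prop)]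
    refine lintegral_mono_ae ?_
    filter_upwards [Measure.ae_ne volume (0 : EuclideanSpace ℝ (Fin (m + 2)))] with y hy
    rw [lintegral_const_mul _ (by fun_prop)]
    gcongr
    exact hK y hy
  have h5 : ∫⁻ ζ, F ζ ^ 2 = ∫⁻ x, ∫⁻ τ, F (x, τ) ^ 2 := by
    rw [Measure.volume_eq_prod, lintegral_prod _ (by fun_prop)]
  rw [h5]
  calc _ ≤ (∫⁻ x, ∫⁻ τ, F (x, τ) ^ 2) * ((∫⁻ y, g y ^ 2) * K * ∫⁻ x, h x ^ 2) := by gcongr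
    _ = _ := by ring

/-- Cauchy–Schwarz for a fixed first input `x`: it suffices to integrate the square of the weight
over the hyperplanes on which `x·y` is constant. -/
theorem sq_lintegral_input_fibre_le {m : ℕ}
    {w : EuclideanSpace ℝ (Fin (m + 2)) × EuclideanSpace ℝ (Fin (m + 2)) → ℝ≥0∞}
    (hw : Measurable w) {K : ℝ≥0∞}
    (hK : ∀ x, x ≠ 0 → ∀ φ : ℝ → ℝ≥0∞, Measurable φ →
      ∫⁻ y, φ (inner ℝ x y) * w (x, y) ^ 2 ≤ K * ∫⁻ t, φ t)
    {F : Spacetime (m + 2) → ℝ≥0∞} {g h : EuclideanSpace ℝ (Fin (m + 2)) → ℝ≥0∞}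
    (hF : Measurable F) (hg : Measurable g) (hh : Measurable h) :
    (∫⁻ x, ∫⁻ y, F (x, ‖x‖ ^ 2 + 2 * inner ℝ x y) * g y * h (x + y) * w (x, y)) ^ 2 ≤
      K * (∫⁻ ζ, F ζ ^ 2) * (∫⁻ x, g x ^ 2) * ∫⁻ x, h x ^ 2 := by
  have hPm : Measurable fun p : EuclideanSpace ℝ (Fin (m + 2)) × EuclideanSpace ℝ (Fin (m + 2)) =>
      F (p.1, ‖p.1‖ ^ 2 + 2 * inner ℝ p.1 p.2) ^ 2 * w p ^ 2 := by fun_prop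
  have hQm : Measurable fun p : EuclideanSpace ℝ (Fin (m + 2)) × EuclideanSpace ℝ (Fin (m + 2)) =>
      g p.2 ^ 2 * h (p.1 + p.2) ^ 2 := by fun_prop
  have cs : (∫⁻ x, ∫⁻ y, F (x, ‖x‖ ^ 2 + 2 * inner ℝ x y) * g y * h (x + y) * w (x, y)) ^ 2 ≤
      (∫⁻ x, ∫⁻ y, F (x, ‖x‖ ^ 2 + 2 * inner ℝ x y) ^ 2 * w (x, y) ^ 2) *
        ∫⁻ x, ∫⁻ y, g y ^ 2 * h (x + y) ^ 2 := by
    refine lintegral_sq_le_of_sq_le hPm.lintegral_prod_right'.aemeasurable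
      hQm.lintegral_prod_right'.aemeasurable (.of_forall fun x => ?_)
    refine lintegral_sq_le_of_sq_le
      (hPm.comp (by fun_prop : Measurable fun y => (x, y))).aemeasurable
      (hQm.comp (by fun_prop : Measurable fun y => (x, y))).aemeasurable (.of_forall fun y => ?_)
    exact le_of_eq (by ring)
  have hFm : Measurable fun x => ∫⁻ τ, F (x, τ) ^ 2 := (hF.pow_const 2).lintegral_prod_right'
  have h1 : ∫⁻ x, ∫⁻ y, F (x, ‖x‖ ^ 2 + 2 * inner ℝ x y) ^ 2 * w (x, y) ^ 2 ≤
      K * ∫⁻ ζ, F ζ ^ 2 := by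
    rw [Measure.volume_eq_prod, lintegral_prod _ (by fun_prop), ← lintegral_const_mul _ hFm]
    refine lintegral_mono_ae ?_
    filter_upwards [Measure.ae_ne volume (0 : EuclideanSpace ℝ (Fin (m + 2)))] with x hx
    refine (hK x hx (fun t => F (x, ‖x‖ ^ 2 + 2 * t) ^ 2) (by fun_prop)).trans ?_
    refine mul_le_mul' le_rfl (le_trans ?_ (lintegral_comp_affine_le
      (φ := fun τ => F (x, τ) ^ 2) two_pos (‖x‖ ^ 2)))
    exact le_mul_of_one_le_left (by simp) (by simp)
  have h2 : ∫⁻ x, ∫⁻ y, g y ^ 2 * h (x + y) ^ 2 = (∫⁻ x, g x ^ 2) * ∫⁻ x, h x ^ 2 := by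
    rw [lintegral_lintegral_swap (by fun_prop), ← lintegral_mul_const _ (by fun_prop)]
    refine lintegral_congr fun y => ?_
    rw [lintegral_const_mul _ (by fun_prop), lintegral_add_right_eq_self (fun x => h x ^ 2) y]
  rw [h2] at cs
  refine cs.trans ?_
  rw [mul_assoc (K * _)]
  gcongr

/-! ### Elementary bounds for the interaction weight -/

section Bracket

variable {E F : Type*} [SeminormedAddCommGroup E] [SeminormedAddCommGroup F]

theorem one_le_japaneseBracket (a : E) : 1 ≤ japaneseBracket a :=
  Real.one_le_sqrt.2 (by nlinarith [sq_nonneg ‖a‖])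

theorem japaneseBracket_pos (a : E) : 0 < japaneseBracket a :=
  zero_lt_one.trans_le (one_le_japaneseBracket a)

theorem japaneseBracket_sq (a : E) : japaneseBracket a ^ 2 = 1 + ‖a‖ ^ 2 :=
  Real.sq_sqrt (by positivity)

theorem norm_le_japaneseBracket (a : E) : ‖a‖ ≤ japaneseBracket a :=
  Real.le_sqrt_of_sq_le (by linarith)

theorem japaneseBracket_le_one_add (a : E) : japaneseBracket a ≤ 1 + ‖a‖ :=
  Real.sqrt_le_iff.2 ⟨by positivity, by nlinarith [norm_nonneg a]⟩

theorem japaneseBracket_le_mul {a : E} {b : F} {c : ℝ} (hc : 1 ≤ c) (h : ‖a‖ ≤ c * ‖b‖) :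
    japaneseBracket a ≤ c * japaneseBracket b := by
  refine Real.sqrt_le_iff.2 ⟨mul_nonneg (by linarith) (japaneseBracket_pos b).le, ?_⟩
  rw [mul_pow, japaneseBracket_sq]
  have h1 : ‖a‖ ^ 2 ≤ (c * ‖b‖) ^ 2 := by gcongr
  nlinarith

theorem japaneseBracket_mono {a : E} {b : F} (h : ‖a‖ ≤ ‖b‖) :
    japaneseBracket a ≤ japaneseBracket b := by
  simpa using japaneseBracket_le_mul le_rfl (by simpa using h)

theorem continuous_japaneseBracket : Continuous (japaneseBracket : E → ℝ) := by
  unfold japaneseBracket; fun_prop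

end Bracket

@[fun_prop]
theorem measurable_japaneseBracket {E : Type*} [NormedAddCommGroup E] [MeasurableSpace E]
    [OpensMeasurableSpace E] : Measurable (japaneseBracket : E → ℝ) :=
  continuous_japaneseBracket.measurable

/-- The part of the kernel of the trilinear form which depends on the spatial frequencies only. -/
noncomputable def interactionWeight {n : ℕ} (r δ : ℝ)
    (p : EuclideanSpace ℝ (Fin n) × EuclideanSpace ℝ (Fin n)) : ℝ :=
  (japaneseBracket p.1 * japaneseBracket p.2 / japaneseBracket (p.1 + p.2)) ^ r *
    japaneseBracket (inner ℝ p.1 p.2) ^ (-δ)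

section Weight

variable {n : ℕ} {r δ δ' : ℝ} {x y : EuclideanSpace ℝ (Fin n)}

theorem interactionWeight_nonneg (p : EuclideanSpace ℝ (Fin n) × EuclideanSpace ℝ (Fin n)) :
    0 ≤ interactionWeight r δ p := by
  have h1 := japaneseBracket_pos p.1
  have h2 := japaneseBracket_pos p.2
  have h3 := japaneseBracket_pos (p.1 + p.2)
  have h4 := japaneseBracket_pos (inner ℝ p.1 p.2)
  unfold interactionWeight
  positivity

theorem measurable_interactionWeight :
    Measurable (interactionWeight r δ :
      EuclideanSpace ℝ (Fin n) × EuclideanSpace ℝ (Fin n) → ℝ) := by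
  unfold interactionWeight
  fun_prop

theorem interactionWeight_comm : interactionWeight r δ (x, y) = interactionWeight r δ (y, x) := by
  simp only [interactionWeight, add_comm y x, real_inner_comm y x,
    mul_comm (japaneseBracket x) (japaneseBracket y)]

theorem interactionWeight_anti (h : δ ≤ δ')
    (p : EuclideanSpace ℝ (Fin n) × EuclideanSpace ℝ (Fin n)) :
    interactionWeight r δ' p ≤ interactionWeight r δ p := by
  have h1 := japaneseBracket_pos p.1
  have h2 := japaneseBracket_pos p.2
  have h3 := japaneseBracket_pos (p.1 + p.2)
  unfold interactionWeight
  gcongr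
  exact one_le_japaneseBracket _

/-- When the output frequency is not much smaller than the inputs, the quotient of brackets in the
weight is bounded by the bracket of either input. -/
theorem interactionWeight_le_of_le_add (hr : 0 ≤ r) (h : ‖y‖ ≤ 4 * ‖x + y‖) {N : ℝ}
    (hN : N = ‖x‖ ∨ N = ‖y‖) :
    interactionWeight r δ (x, y) ≤
      5 ^ r * japaneseBracket N ^ r * japaneseBracket (inner ℝ x y) ^ (-δ) := by
  have hx : ‖x‖ ≤ 5 * ‖x + y‖ := by
    have : ‖x‖ ≤ ‖x + y‖ + ‖y‖ := by simpa using norm_sub_le (x + y) y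
    linarith
  have h1 : japaneseBracket x ≤ 5 * japaneseBracket (x + y) :=
    japaneseBracket_le_mul (by norm_num) hx
  have h2 : japaneseBracket y ≤ 5 * japaneseBracket (x + y) :=
    japaneseBracket_le_mul (by norm_num) (by linarith [norm_nonneg (x + y)])
  have px := japaneseBracket_pos x
  have py := japaneseBracket_pos y
  have pz := japaneseBracket_pos (x + y)
  have pN := japaneseBracket_pos N
  have hq : japaneseBracket x * japaneseBracket y / japaneseBracket (x + y) ≤
      5 * japaneseBracket N := by
    rw [div_le_iff₀ pz]
    rcases hN with rfl | rfl
    · have : japaneseBracket x ≤ japaneseBracket ‖x‖ := japaneseBracket_mono (by simp)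
      calc _ ≤ japaneseBracket ‖x‖ * (5 * japaneseBracket (x + y)) := by gcongr
        _ = _ := by ring
    · have : japaneseBracket y ≤ japaneseBracket ‖y‖ := japaneseBracket_mono (by simp)
      calc _ ≤ (5 * japaneseBracket (x + y)) * japaneseBracket ‖y‖ := by gcongr
        _ = _ := by ring
  have pk := japaneseBracket_pos (inner ℝ x y)
  unfold interactionWeight
  rw [← Real.mul_rpow (by norm_num) pN.le]
  gcongr

theorem bracket_rpow_mul_le {N c k : ℝ} (hδ : 0 ≤ δ) (hc0 : 0 < c) (hc1 : c ≤ 1)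
    (hk : N ^ 2 * c ≤ |k|) :
    japaneseBracket N ^ r * japaneseBracket k ^ (-δ) ≤
      2 ^ δ * japaneseBracket N ^ (r - 2 * δ) * c ^ (-δ) := by
  have pN := japaneseBracket_pos N
  have pk := japaneseBracket_pos k
  have h1 : japaneseBracket N ^ 2 * c / 2 ≤ japaneseBracket k := by
    have a1 := one_le_japaneseBracket k
    have a2 := norm_le_japaneseBracket k
    rw [Real.norm_eq_abs] at a2
    rw [japaneseBracket_sq, Real.norm_eq_abs, sq_abs]
    nlinarith
  have h2 : japaneseBracket k ^ (-δ) ≤ (japaneseBracket N ^ 2 * c / 2) ^ (-δ) :=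
    Real.rpow_le_rpow_of_nonpos (by positivity) h1 (by linarith)
  have h3 : (japaneseBracket N ^ 2 * c / 2) ^ (-δ) =
      2 ^ δ * japaneseBracket N ^ (-(2 * δ)) * c ^ (-δ) := by
    rw [Real.div_rpow (by positivity) (by norm_num), Real.mul_rpow (by positivity) hc0.le,
      ← Real.rpow_natCast, ← Real.rpow_mul pN.le, Real.rpow_neg (by norm_num : (0 : ℝ) ≤ 2)]
    norm_num
    ring
  calc _ ≤ japaneseBracket N ^ r * (2 ^ δ * japaneseBracket N ^ (-(2 * δ)) * c ^ (-δ)) := by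
        rw [← h3]; gcongr
    _ = _ := by
        rw [sub_eq_add_neg, Real.rpow_add pN]; ring

/-- The weight when the output frequency is comparable to the larger input, or larger. Here `c` is a
lower bound for `|cos ∠(x, y)|`, and the powers of the smaller input cancel by `2r + m ≤ 4δ`. -/
theorem pow_mul_interactionWeight_sq_le_of_far {m : ℕ} (hr : 0 ≤ r) (hδ : 0 ≤ δ)
    (hA : 2 * r + m ≤ 4 * δ) (hfar : ‖y‖ ≤ 4 * ‖x + y‖) (hmin : ‖x‖ ≤ ‖y‖ ∨ m = 0)
    {c : ℝ} (hc0 : 0 < c) (hc1 : c ≤ 1) (hk : ‖x‖ * ‖y‖ * c ≤ |inner ℝ x y|) :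
    ‖x‖ ^ m * interactionWeight r δ (x, y) ^ 2 ≤ (5 ^ r * 2 ^ δ) ^ 2 * c ^ (-(2 * δ)) := by
  set N := min ‖x‖ ‖y‖ with hN
  have hN0 : 0 ≤ N := by positivity
  have hNk : N ^ 2 * c ≤ |inner ℝ x y| := by
    refine le_trans ?_ hk
    rw [sq]
    gcongr
    · exact min_le_left _ _
    · exact min_le_right _ _
  have h1 : interactionWeight r δ (x, y) ≤
      5 ^ r * 2 ^ δ * (japaneseBracket N ^ (r - 2 * δ) * c ^ (-δ)) := by
    refine (interactionWeight_le_of_le_add hr hfar (min_choice _ _)).trans ?_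
    have := bracket_rpow_mul_le (r := r) hδ hc0 hc1 hNk
    calc _ = 5 ^ r * (japaneseBracket N ^ r * japaneseBracket (inner ℝ x y) ^ (-δ)) := by ring
      _ ≤ 5 ^ r * (2 ^ δ * japaneseBracket N ^ (r - 2 * δ) * c ^ (-δ)) := by gcongr
      _ = _ := by ring
  have pN := japaneseBracket_pos N
  have hpow : ‖x‖ ^ m ≤ japaneseBracket N ^ (m : ℝ) := by
    rw [Real.rpow_natCast]
    rcases hmin with h | h
    · rw [hN, min_eq_left h]
      gcongr
      simpa using norm_le_japaneseBracket ‖x‖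
    · simp [h]
  calc _ ≤ japaneseBracket N ^ (m : ℝ) *
        (5 ^ r * 2 ^ δ * (japaneseBracket N ^ (r - 2 * δ) * c ^ (-δ))) ^ 2 := by
        gcongr
        exact interactionWeight_nonneg _
    _ = (5 ^ r * 2 ^ δ) ^ 2 * (japaneseBracket N ^ (2 * r + m - 4 * δ)) * c ^ (-(2 * δ)) := by
        have e1 : (japaneseBracket N ^ (r - 2 * δ)) ^ 2 = japaneseBracket N ^ (2 * r - 4 * δ) := by
          rw [← Real.rpow_natCast, ← Real.rpow_mul pN.le]; congr 1; push_cast; ring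
        have e2 : (c ^ (-δ)) ^ 2 = c ^ (-(2 * δ)) := by
          rw [← Real.rpow_natCast, ← Real.rpow_mul hc0.le]; congr 1; push_cast; ring
        rw [show 2 * r + m - 4 * δ = m + (2 * r - 4 * δ) by ring, Real.rpow_add pN, mul_pow,
          mul_pow (japaneseBracket N ^ (r - 2 * δ)), e1, e2]
        ring
    _ ≤ (5 ^ r * 2 ^ δ) ^ 2 * 1 * c ^ (-(2 * δ)) := by
        gcongr
        exact Real.rpow_le_one_of_one_le_of_nonpos (one_le_japaneseBracket N) (by linarith)
    _ = _ := by ring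

/-- The weight when the inputs nearly cancel: then `|x·y| ~ |y|²`, and the output frequency is
bounded below through `t`, which stands for `sin ∠(x, y)`. -/
theorem pow_mul_interactionWeight_sq_le_of_near {m : ℕ} (hr : 0 ≤ r) (hδ : 0 ≤ δ)
    (hnear : 4 * ‖x + y‖ ≤ ‖y‖) {t : ℝ} (ht : ‖x‖ * |t| ≤ ‖x + y‖) :
    ‖x‖ ^ m * interactionWeight r δ (x, y) ^ 2 ≤
      2 ^ m * (2 ^ r * 3 ^ δ * 2 ^ r) ^ 2 *
        (japaneseBracket y ^ (4 * r - 4 * δ + m) * japaneseBracket (‖y‖ * t) ^ (-(2 * r))) := by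
  have px := japaneseBracket_pos x
  have py := japaneseBracket_pos y
  have pz := japaneseBracket_pos (x + y)
  have pk := japaneseBracket_pos (inner ℝ x y)
  have pt := japaneseBracket_pos (‖y‖ * t)
  have hx : ‖x‖ ≤ 2 * ‖y‖ := by
    have : ‖x‖ ≤ ‖x + y‖ + ‖y‖ := by simpa using norm_sub_le (x + y) y
    linarith [norm_nonneg y]
  have hy : ‖y‖ ≤ 2 * ‖x‖ := by
    have : ‖y‖ ≤ ‖x + y‖ + ‖x‖ := by simpa using norm_sub_le (x + y) x
    linarith [norm_nonneg x]
  have hX : japaneseBracket x ≤ 2 * japaneseBracket y := japaneseBracket_le_mul (by norm_num) hx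
  have hT : japaneseBracket (‖y‖ * t) ≤ 2 * japaneseBracket (x + y) := by
    refine japaneseBracket_le_mul (by norm_num) ?_
    rw [norm_mul, norm_norm, Real.norm_eq_abs]
    nlinarith [abs_nonneg t]
  have hk : japaneseBracket y ^ 2 / 3 ≤ japaneseBracket (inner ℝ x y) := by
    have a1 := one_le_japaneseBracket (inner ℝ x y)
    have a2 := norm_le_japaneseBracket (inner ℝ x y)
    have a3 : inner ℝ x y = inner ℝ (x + y) y - ‖y‖ ^ 2 := by
      rw [inner_add_left, real_inner_self_eq_norm_sq]; ring
    have a4 := real_inner_le_norm (x + y) y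
    have a5 := neg_le_abs (inner ℝ x y)
    rw [Real.norm_eq_abs] at a2
    rw [japaneseBracket_sq]
    nlinarith [norm_nonneg y]
  have h1 : interactionWeight r δ (x, y) ≤ 2 ^ r * 3 ^ δ * 2 ^ r *
      (japaneseBracket y ^ (2 * r - 2 * δ) * japaneseBracket (‖y‖ * t) ^ (-r)) := by
    have b1 : (japaneseBracket x * japaneseBracket y / japaneseBracket (x + y)) ^ r ≤
        (4 * (japaneseBracket y ^ 2 / japaneseBracket (‖y‖ * t))) ^ r := by
      gcongr
      rw [← mul_div_assoc, div_le_div_iff₀ pz pt]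
      calc _ ≤ (2 * japaneseBracket y) * japaneseBracket y * (2 * japaneseBracket (x + y)) := by
            gcongr
        _ = _ := by ring
    have b2 : japaneseBracket (inner ℝ x y) ^ (-δ) ≤ (japaneseBracket y ^ 2 / 3) ^ (-δ) :=
      Real.rpow_le_rpow_of_nonpos (by positivity) hk (by linarith)
    have b3 : (4 * (japaneseBracket y ^ 2 / japaneseBracket (‖y‖ * t))) ^ r =
        2 ^ r * 2 ^ r * (japaneseBracket y ^ (2 * r) * japaneseBracket (‖y‖ * t) ^ (-r)) := by
      rw [Real.mul_rpow (by norm_num) (by positivity), Real.div_rpow (by positivity) pt.le,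
        ← Real.rpow_natCast, ← Real.rpow_mul py.le, Real.rpow_neg pt.le,
        show (4 : ℝ) = 2 * 2 by norm_num, Real.mul_rpow (by norm_num) (by norm_num)]
      simp only [Nat.cast_ofNat]
      ring
    have b4 : (japaneseBracket y ^ 2 / 3) ^ (-δ) =
        3 ^ δ * japaneseBracket y ^ (-(2 * δ)) := by
      rw [Real.div_rpow (by positivity) (by norm_num), ← Real.rpow_natCast,
        ← Real.rpow_mul py.le, Real.rpow_neg (by norm_num : (0 : ℝ) ≤ 3)]
      norm_num
      ring
    unfold interactionWeight
    calc _ ≤ (4 * (japaneseBracket y ^ 2 / japaneseBracket (‖y‖ * t))) ^ r *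
          (japaneseBracket y ^ 2 / 3) ^ (-δ) := by
          dsimp only
          gcongr
      _ = _ := by
          rw [b3, b4, sub_eq_add_neg (2 * r), Real.rpow_add py]; ring
  calc _ ≤ (2 * japaneseBracket y) ^ m * (2 ^ r * 3 ^ δ * 2 ^ r *
      (japaneseBracket y ^ (2 * r - 2 * δ) * japaneseBracket (‖y‖ * t) ^ (-r))) ^ 2 := by
        gcongr
        · exact hx.trans (by gcongr; exact norm_le_japaneseBracket y)
        · exact interactionWeight_nonneg _
    _ = _ := by
        have e1 : (japaneseBracket y ^ (2 * r - 2 * δ)) ^ 2 =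
            japaneseBracket y ^ (4 * r - 4 * δ) := by
          rw [← Real.rpow_natCast, ← Real.rpow_mul py.le]; congr 1; push_cast; ring
        have e2 : (japaneseBracket (‖y‖ * t) ^ (-r)) ^ 2 =
            japaneseBracket (‖y‖ * t) ^ (-(2 * r)) := by
          rw [← Real.rpow_natCast, ← Real.rpow_mul pt.le]; congr 1; push_cast; ring
        rw [Real.rpow_add py, Real.rpow_natCast, mul_pow _ (_ * _), mul_pow _ (_ ^ (-r)), e1, e2,
          mul_pow 2]
        ring

/-- The weight in the region where `x·y` is close to `|x|²`, so that `x·y ≥ |x|² / 2`. -/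
theorem interactionWeight_sq_le_of_parallel {m : ℕ} (hr : 0 ≤ r) (hδ : 0 ≤ δ)
    (hA : 2 * r + m ≤ 4 * δ) (hD : |‖x‖ ^ 2 - inner ℝ x y| < ‖x‖ ^ 2 / 2) :
    interactionWeight r δ (x, y) ^ 2 ≤ (5 ^ r * 2 ^ δ) ^ 2 * 2 ^ (2 * δ) *
      (japaneseBracket x ^ m)⁻¹ := by
  have hk := (abs_lt.1 hD).2
  have hk2 : ‖x‖ ^ 2 * (1 / 2) ≤ |inner ℝ x y| := le_trans (by linarith) (le_abs_self _)
  have hfar : ‖y‖ ≤ 4 * ‖x + y‖ := by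
    have : ‖y‖ ^ 2 ≤ ‖x + y‖ ^ 2 := by
      rw [norm_add_sq_real]; nlinarith [sq_nonneg ‖x‖]
    have := abs_le_of_sq_le_sq' this (norm_nonneg _)
    linarith [norm_nonneg (x + y)]
  have px := japaneseBracket_pos x
  have h1 : interactionWeight r δ (x, y) ≤
      5 ^ r * 2 ^ δ * (japaneseBracket x ^ (r - 2 * δ) * (1 / 2) ^ (-δ)) := by
    refine (interactionWeight_le_of_le_add hr hfar (.inl rfl)).trans ?_
    have := bracket_rpow_mul_le (r := r) hδ (by norm_num : (0 : ℝ) < 1 / 2) (by norm_num) hk2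
    have e : japaneseBracket ‖x‖ = japaneseBracket x := by simp [japaneseBracket]
    rw [e] at this ⊢
    calc _ = 5 ^ r * (japaneseBracket x ^ r * japaneseBracket (inner ℝ x y) ^ (-δ)) := by ring
      _ ≤ 5 ^ r * (2 ^ δ * japaneseBracket x ^ (r - 2 * δ) * (1 / 2) ^ (-δ)) := by gcongr
      _ = _ := by ring
  calc _ ≤ (5 ^ r * 2 ^ δ * (japaneseBracket x ^ (r - 2 * δ) * (1 / 2) ^ (-δ))) ^ 2 := by
        gcongr
        exact interactionWeight_nonneg _
    _ = (5 ^ r * 2 ^ δ) ^ 2 * 2 ^ (2 * δ) * japaneseBracket x ^ (2 * r - 4 * δ) := by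
        have e1 : (japaneseBracket x ^ (r - 2 * δ)) ^ 2 = japaneseBracket x ^ (2 * r - 4 * δ) := by
          rw [← Real.rpow_natCast, ← Real.rpow_mul px.le]; congr 1; push_cast; ring
        have e2 : (((1 : ℝ) / 2) ^ (-δ)) ^ 2 = 2 ^ (2 * δ) := by
          rw [one_div, Real.inv_rpow (by norm_num), ← Real.rpow_neg (by norm_num), neg_neg,
            ← Real.rpow_natCast, ← Real.rpow_mul (by norm_num)]
          congr 1; push_cast; ring
        rw [mul_pow, mul_pow (japaneseBracket x ^ (r - 2 * δ)), e1, e2]; ring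
    _ ≤ _ := by
        gcongr
        rw [← Real.rpow_natCast, ← Real.rpow_neg px.le]
        exact Real.rpow_le_rpow_of_exponent_le (one_le_japaneseBracket x) (by linarith)

/-- The weight in dimension three when the larger input `x` is at most the cube of the smaller one:
the worst case is `|x| = |y|³`, where the powers balance to `|y|^(3 + 2r - 4γ)`. -/
theorem mul_interactionWeight_sq_le_of_le_cube {γ : ℝ} (hr : 0 ≤ r) (hγ1 : γ ≤ 1)
    (hexp : 3 + 2 * r ≤ 4 * γ) (hfar : ‖y‖ ≤ 4 * ‖x + y‖) (hy : y ≠ 0) (hyx : ‖y‖ ≤ ‖x‖)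
    (hxy : ‖x‖ ≤ ‖y‖ ^ 3) {c : ℝ} (hc0 : 0 < c)
    (hk : ‖x‖ * ‖y‖ * c ≤ |inner ℝ x y|) :
    ‖x‖ * interactionWeight r (γ / 2) (x, y) ^ 2 ≤ (5 ^ r * 2 ^ r) ^ 2 * c ^ (-γ) := by
  have py : 0 < ‖y‖ := norm_pos_iff.2 hy
  have px : 0 < ‖x‖ := py.trans_le hyx
  have hy1 : 1 ≤ ‖y‖ := by
    by_contra! h
    have : ‖y‖ ^ 3 < ‖y‖ := by
      have : ‖y‖ ^ 2 < 1 := by nlinarith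
      nlinarith
    linarith
  have pk := japaneseBracket_pos (inner ℝ x y)
  have hY : japaneseBracket ‖y‖ ≤ 2 * ‖y‖ := by
    have := japaneseBracket_le_one_add ‖y‖
    rw [norm_norm] at this
    linarith
  have pY := japaneseBracket_pos ‖y‖
  have hK : ‖x‖ * ‖y‖ * c ≤ japaneseBracket (inner ℝ x y) :=
    hk.trans (by simpa using norm_le_japaneseBracket (inner ℝ x y))
  have h1 : interactionWeight r (γ / 2) (x, y) ≤
      5 ^ r * 2 ^ r * (‖y‖ ^ r * (‖x‖ * ‖y‖ * c) ^ (-(γ / 2))) := by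
    refine (interactionWeight_le_of_le_add hr hfar (.inr rfl)).trans ?_
    have b1 : japaneseBracket ‖y‖ ^ r ≤ 2 ^ r * ‖y‖ ^ r := by
      rw [← Real.mul_rpow (by norm_num) py.le]; gcongr
    have b2 : japaneseBracket (inner ℝ x y) ^ (-(γ / 2)) ≤ (‖x‖ * ‖y‖ * c) ^ (-(γ / 2)) :=
      Real.rpow_le_rpow_of_nonpos (by positivity) hK (by linarith)
    calc _ ≤ 5 ^ r * (2 ^ r * ‖y‖ ^ r) * (‖x‖ * ‖y‖ * c) ^ (-(γ / 2)) := by gcongr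
      _ = _ := by ring
  calc _ ≤ ‖x‖ * (5 ^ r * 2 ^ r * (‖y‖ ^ r * (‖x‖ * ‖y‖ * c) ^ (-(γ / 2)))) ^ 2 := by
        gcongr
        exact interactionWeight_nonneg _
    _ = (5 ^ r * 2 ^ r) ^ 2 * (‖x‖ ^ (1 - γ) * ‖y‖ ^ (2 * r - γ)) * c ^ (-γ) := by
        have e1 : (‖y‖ ^ r) ^ 2 = ‖y‖ ^ (2 * r) := by
          rw [← Real.rpow_natCast, ← Real.rpow_mul py.le]; congr 1; push_cast; ring
        have e2 : ((‖x‖ * ‖y‖ * c) ^ (-(γ / 2))) ^ 2 = ‖x‖ ^ (-γ) * ‖y‖ ^ (-γ) * c ^ (-γ) := by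
          rw [← Real.rpow_natCast, ← Real.rpow_mul (by positivity),
            ← Real.mul_rpow px.le py.le, ← Real.mul_rpow (by positivity) hc0.le]
          congr 1; push_cast; ring
        rw [mul_pow, mul_pow (‖y‖ ^ r), e1, e2, sub_eq_add_neg, sub_eq_add_neg,
          Real.rpow_add px, Real.rpow_add py, Real.rpow_one]
        ring
    _ ≤ (5 ^ r * 2 ^ r) ^ 2 * 1 * c ^ (-γ) := by
        gcongr
        calc ‖x‖ ^ (1 - γ) * ‖y‖ ^ (2 * r - γ) ≤ (‖y‖ ^ 3) ^ (1 - γ) * ‖y‖ ^ (2 * r - γ) := by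
              gcongr
          _ = ‖y‖ ^ (3 + 2 * r - 4 * γ) := by
              rw [← Real.rpow_natCast, ← Real.rpow_mul py.le, ← Real.rpow_add py]
              congr 1; push_cast; ring
          _ ≤ 1 := Real.rpow_le_one_of_one_le_of_nonpos hy1 (by linarith)
    _ = _ := by ring

/-- A bound without angular gain, used where `y` is confined to a set of small volume. -/
theorem interactionWeight_sq_le_of_small (hr : 0 ≤ r) (hr2 : 2 * r ≤ 1) (hδ : 0 ≤ δ)
    (hfar : ‖y‖ ≤ 4 * ‖x + y‖) :
    interactionWeight r δ (x, y) ^ 2 ≤ (5 ^ r) ^ 2 * (1 + ‖y‖) := by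
  have h1 : interactionWeight r δ (x, y) ≤ 5 ^ r * japaneseBracket ‖y‖ ^ r := by
    refine (interactionWeight_le_of_le_add hr hfar (.inr rfl)).trans ?_
    refine mul_le_of_le_one_right ?_ ?_
    · have := japaneseBracket_pos ‖y‖
      positivity
    · exact Real.rpow_le_one_of_one_le_of_nonpos (one_le_japaneseBracket _) (by linarith)
  have pY := japaneseBracket_pos ‖y‖
  calc _ ≤ (5 ^ r * japaneseBracket ‖y‖ ^ r) ^ 2 := by
        gcongr
        exact interactionWeight_nonneg _
    _ = (5 ^ r) ^ 2 * japaneseBracket ‖y‖ ^ (2 * r) := by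
        rw [mul_pow, ← Real.rpow_natCast (japaneseBracket ‖y‖ ^ r), ← Real.rpow_mul pY.le]
        congr 2; push_cast; ring
    _ ≤ (5 ^ r) ^ 2 * japaneseBracket ‖y‖ ^ (1 : ℝ) := by
        gcongr
        exact one_le_japaneseBracket _
    _ ≤ _ := by
        rw [Real.rpow_one]
        gcongr
        simpa using japaneseBracket_le_one_add ‖y‖

end Weight

/-! ### Angular integrals -/

theorem exists_unit_orthogonal {m : ℕ} (ξ : EuclideanSpace ℝ (Fin (m + 2))) :
    ∃ v : EuclideanSpace ℝ (Fin (m + 2)), ‖v‖ = 1 ∧ inner ℝ v ξ = 0 := by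
  have h1 : Module.finrank ℝ (ℝ ∙ ξ) ≤ 1 := by
    simpa using finrank_span_le_card (R := ℝ) ({ξ} : Set (EuclideanSpace ℝ (Fin (m + 2))))
  have h2 := Submodule.finrank_add_finrank_orthogonal (ℝ ∙ ξ)
  have h3 : 0 < Module.finrank ℝ (ℝ ∙ ξ)ᗮ := by
    simp only [finrank_euclideanSpace, Fintype.card_fin] at h2
    omega
  have := Module.finrank_pos_iff.1 h3
  obtain ⟨u, hu⟩ := exists_ne (0 : (ℝ ∙ ξ)ᗮ)
  have hu' : u.1 ≠ 0 := fun h => hu (Subtype.ext h)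
  refine ⟨‖u.1‖⁻¹ • u.1, norm_smul_inv_norm hu', ?_⟩
  rw [inner_smul_left, (Submodule.mem_orthogonal_singleton_iff_inner_left.1 u.2), mul_zero]

theorem inner_sq_add_inner_sq_le {E : Type*} [NormedAddCommGroup E] [InnerProductSpace ℝ E]
    {u v e : E} (hu : ‖u‖ = 1) (hv : ‖v‖ = 1) (huv : inner ℝ u v = 0) (he : ‖e‖ = 1) :
    inner ℝ u e ^ 2 + inner ℝ v e ^ 2 ≤ 1 := by
  have h := sq_nonneg ‖e - (inner ℝ u e • u + inner ℝ v e • v)‖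
  rw [norm_sub_sq_real, norm_add_sq_real, inner_add_right, inner_smul_right, inner_smul_right,
    inner_smul_left, inner_smul_right, huv, norm_smul, norm_smul, hu, hv, he,
    real_inner_comm u e, real_inner_comm v e] at h
  simp only [Real.norm_eq_abs, mul_one, sq_abs, mul_zero] at h
  nlinarith

/-- The negative power `|cos ∠(y, e)|^{-γ}`, equal to `∞` on the directions orthogonal to `y`. -/
noncomputable def cosinePower {n : ℕ} (γ : ℝ)
    (p : EuclideanSpace ℝ (Fin n) × EuclideanSpace ℝ (Fin n)) : ℝ≥0∞ :=
  ENNReal.ofReal |inner ℝ (‖p.2‖⁻¹ • p.2) p.1| ^ (-γ)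

/-- The kernel `⟨y⟩^p ⟨|y| sin ∠(y, e)⟩^{-q}`. -/
noncomputable def sinePower {n : ℕ} (p q : ℝ)
    (z : EuclideanSpace ℝ (Fin n) × EuclideanSpace ℝ (Fin n)) : ℝ≥0∞ :=
  ENNReal.ofReal (japaneseBracket z.2 ^ p *
    japaneseBracket (‖z.2‖ * Real.sqrt (1 - inner ℝ (‖z.2‖⁻¹ • z.2) z.1 ^ 2)) ^ (-q))

@[fun_prop]
theorem measurable_cosinePower {n : ℕ} {γ : ℝ} : Measurable (cosinePower γ :
    EuclideanSpace ℝ (Fin n) × EuclideanSpace ℝ (Fin n) → ℝ≥0∞) := by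
  unfold cosinePower
  fun_prop

@[fun_prop]
theorem measurable_sinePower {n : ℕ} {p q : ℝ} : Measurable (sinePower p q :
    EuclideanSpace ℝ (Fin n) × EuclideanSpace ℝ (Fin n) → ℝ≥0∞) := by
  unfold sinePower
  fun_prop

theorem setLIntegral_rpow_neg_lt_top {γ : ℝ} (hγ : γ < 1) :
    ∫⁻ t in Set.Ioc (0 : ℝ) 1, ENNReal.ofReal t ^ (-γ) < ∞ := by
  have h := (intervalIntegrable_iff_integrableOn_Ioc_of_le zero_le_one).1
    (intervalIntegral.intervalIntegrable_rpow' (a := 0) (b := 1) (by linarith : -1 < -γ))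
  refine lt_of_eq_of_lt (setLIntegral_congr_fun measurableSet_Ioc fun t ht => ?_)
    h.setLIntegral_lt_top
  exact ENNReal.ofReal_rpow_of_pos ht.1

theorem exists_lintegral_cosinePower_le (m : ℕ) {γ : ℝ} (hγ0 : 0 ≤ γ) (hγ1 : γ < 1) :
    ∃ K : ℝ≥0∞, K ≠ ∞ ∧ ∀ y : EuclideanSpace ℝ (Fin (m + 2)), y ≠ 0 →
      ∫⁻ e, cosinePower γ (e.1, y)
        ∂(volume : Measure (EuclideanSpace ℝ (Fin (m + 2)))).toSphere ≤ K := by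
  refine ⟨(m + 2) * 2 ^ (m + 2) * ∫⁻ t in Set.Ioc (0 : ℝ) 1, ENNReal.ofReal t ^ (-γ), ?_, ?_⟩
  · exact ENNReal.mul_ne_top (by finiteness) (setLIntegral_rpow_neg_lt_top hγ1).ne
  · intro y hy
    have hu : ‖‖y‖⁻¹ • y‖ = 1 := norm_smul_inv_norm hy
    have hmeas : Measurable fun t : ℝ => ENNReal.ofReal t ^ (-γ) := by fun_prop
    have hanti : ∀ a b : ℝ, 0 ≤ a → a ≤ b →
        ENNReal.ofReal b ^ (-γ) ≤ ENNReal.ofReal a ^ (-γ) := fun a b _ hab => by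
      rw [ENNReal.rpow_neg, ENNReal.rpow_neg]
      gcongr
    have h := lintegral_sphere_le_of_antitone hmeas hanti hu
    simpa only [cosinePower] using h

theorem lintegral_japaneseBracket_rpow_lt_top {q : ℝ} (hq : 1 < q) :
    ∫⁻ t : ℝ, ENNReal.ofReal (japaneseBracket t ^ (-q)) < ∞ := by
  have h := integrable_rpow_neg_one_add_norm_sq (E := ℝ) (μ := volume) (r := q) (by simpa using hq)
  have e : (fun t : ℝ => japaneseBracket t ^ (-q)) = fun t : ℝ => (1 + ‖t‖ ^ 2) ^ (-q / 2) := by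
    ext t
    rw [japaneseBracket, Real.sqrt_eq_rpow, ← Real.rpow_mul (by positivity)]
    congr 1; ring
  rw [← e] at h
  exact h.lintegral_lt_top

/-- If `p < 1` the integrand is at most `t^{-max(p, 0)}`; the borderline case `p = 1` uses instead
the integrability of `⟨·⟩^{-q}` on the line. -/
theorem exists_setLIntegral_bracket_le {p q : ℝ} (hpq : p ≤ q) (hq0 : 0 ≤ q)
    (h : p < 1 ∨ p = 1 ∧ 1 < q) :
    ∃ K : ℝ≥0∞, K ≠ ∞ ∧ ∀ N : ℝ, 0 ≤ N → ∫⁻ t in Set.Ioc (0 : ℝ) 1,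
      ENNReal.ofReal (japaneseBracket N ^ p * japaneseBracket (N * t) ^ (-q)) ≤ K := by
  rcases h with hp | ⟨rfl, hq⟩
  · refine ⟨∫⁻ t in Set.Ioc (0 : ℝ) 1, ENNReal.ofReal t ^ (-(max p 0)),
      (setLIntegral_rpow_neg_lt_top (max_lt hp zero_lt_one)).ne, fun N hN => ?_⟩
    refine setLIntegral_mono' measurableSet_Ioc fun t ht => ?_
    have ht0 : 0 < t := ht.1
    have pN := japaneseBracket_pos N
    have pNt := japaneseBracket_pos (N * t)
    rw [ENNReal.ofReal_rpow_of_pos ht0]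
    refine ENNReal.ofReal_le_ofReal ?_
    have h1 : t * japaneseBracket N ≤ japaneseBracket (N * t) := by
      have := japaneseBracket_le_mul (a := N) (b := N * t) (c := t⁻¹) (one_le_inv₀ ht0 |>.2 ht.2)
        (by rw [norm_mul, Real.norm_eq_abs t, abs_of_pos ht0]; field_simp; rfl)
      rwa [le_inv_mul_iff₀ ht0] at this
    calc _ ≤ japaneseBracket N ^ max p 0 * japaneseBracket (N * t) ^ (-(max p 0)) := by
          gcongr
          · exact one_le_japaneseBracket _
          · exact le_max_left _ _
          · exact one_le_japaneseBracket _
          · exact max_le hpq hq0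
      _ ≤ japaneseBracket N ^ max p 0 * (t * japaneseBracket N) ^ (-(max p 0)) := by
          gcongr ?_ * ?_
          exact Real.rpow_le_rpow_of_nonpos (by positivity) h1 (by simp)
      _ = t ^ (-(max p 0)) := by
          rw [Real.mul_rpow ht0.le pN.le, Real.rpow_neg pN.le]
          field_simp
  · refine ⟨1 + ∫⁻ t : ℝ, ENNReal.ofReal (japaneseBracket t ^ (-q)),
      ENNReal.add_ne_top.2 ⟨ENNReal.one_ne_top, (lintegral_japaneseBracket_rpow_lt_top hq).ne⟩,
      fun N hN => ?_⟩
    have h1 : ∀ t, ENNReal.ofReal (japaneseBracket N ^ (1 : ℝ) * japaneseBracket (N * t) ^ (-q)) ≤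
        1 + ENNReal.ofReal N * ENNReal.ofReal (japaneseBracket (0 + N * t) ^ (-q)) := by
      intro t
      have pNt := japaneseBracket_pos (N * t)
      rw [zero_add, ← ENNReal.ofReal_mul hN, ← ENNReal.ofReal_one,
        ← ENNReal.ofReal_add zero_le_one (by positivity), Real.rpow_one]
      refine ENNReal.ofReal_le_ofReal ?_
      have h2 : japaneseBracket (N * t) ^ (-q) ≤ 1 :=
        Real.rpow_le_one_of_one_le_of_nonpos (one_le_japaneseBracket _) (by linarith)
      have h3 := japaneseBracket_le_one_add N
      rw [Real.norm_eq_abs, abs_of_nonneg hN] at h3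
      calc _ ≤ (1 + N) * japaneseBracket (N * t) ^ (-q) := by gcongr
        _ ≤ _ := by rw [add_mul, one_mul]; gcongr
    refine (lintegral_mono h1).trans ?_
    rw [lintegral_add_left measurable_const]
    refine add_le_add ?_ ?_
    · simp
    · refine (setLIntegral_le_lintegral _ _).trans ?_
      rcases hN.eq_or_lt with rfl | hN
      · simp
      · rw [lintegral_const_mul' _ _ (by finiteness)]
        exact lintegral_comp_affine_le
          (φ := fun t => ENNReal.ofReal (japaneseBracket t ^ (-q))) hN 0

/-- With `v` a unit vector orthogonal to `y`, one has `sin ∠(y, e) ≥ |v·e|`, which reduces the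
integral to a decreasing function of `|cos ∠(v, e)|`. -/
theorem exists_lintegral_sinePower_le (m : ℕ) {p q : ℝ} (hpq : p ≤ q) (hq0 : 0 ≤ q)
    (h : p < 1 ∨ p = 1 ∧ 1 < q) :
    ∃ K : ℝ≥0∞, K ≠ ∞ ∧ ∀ y : EuclideanSpace ℝ (Fin (m + 2)), y ≠ 0 →
      ∫⁻ e, sinePower p q (e.1, y)
        ∂(volume : Measure (EuclideanSpace ℝ (Fin (m + 2)))).toSphere ≤ K := by
  obtain ⟨K, hK, hle⟩ := exists_setLIntegral_bracket_le hpq hq0 h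
  refine ⟨(m + 2) * 2 ^ (m + 2) * K, by finiteness, fun y hy => ?_⟩
  obtain ⟨v, hv, hvy⟩ := exists_unit_orthogonal y
  have mono : ∀ {a b : ℝ}, 0 ≤ a → a ≤ b →
      ENNReal.ofReal (japaneseBracket ‖y‖ ^ p * japaneseBracket (‖y‖ * b) ^ (-q)) ≤
      ENNReal.ofReal (japaneseBracket ‖y‖ ^ p * japaneseBracket (‖y‖ * a) ^ (-q)) := by
    intro a b ha hab
    have := japaneseBracket_pos ‖y‖
    refine ENNReal.ofReal_le_ofReal (mul_le_mul_of_nonneg_left ?_ (by positivity))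
    refine Real.rpow_le_rpow_of_nonpos (japaneseBracket_pos _) (japaneseBracket_mono ?_)
      (by linarith)
    rw [norm_mul, norm_mul, Real.norm_eq_abs a, Real.norm_eq_abs b, abs_of_nonneg ha,
      abs_of_nonneg (ha.trans hab)]
    gcongr
  calc _ ≤ ∫⁻ e : Metric.sphere (0 : EuclideanSpace ℝ (Fin (m + 2))) 1,
          ENNReal.ofReal (japaneseBracket ‖y‖ ^ p *
            japaneseBracket (‖y‖ * |inner ℝ v e.1|) ^ (-q))
          ∂(volume : Measure (EuclideanSpace ℝ (Fin (m + 2)))).toSphere := by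
        refine lintegral_mono fun e => ?_
        have e1 : japaneseBracket ‖y‖ = japaneseBracket y := by simp [japaneseBracket]
        simp only [sinePower]
        rw [← e1]
        refine mono (abs_nonneg _) (Real.le_sqrt_of_sq_le ?_)
        have := inner_sq_add_inner_sq_le (u := ‖y‖⁻¹ • y) (norm_smul_inv_norm hy) hv
          (by rw [inner_smul_left, real_inner_comm, hvy, mul_zero]) (e := e.1) (by simp)
        rw [sq_abs]
        linarith
    _ ≤ (m + 2) * 2 ^ (m + 2) * ∫⁻ t in Set.Ioc (0 : ℝ) 1, ENNReal.ofReal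
          (japaneseBracket ‖y‖ ^ p * japaneseBracket (‖y‖ * t) ^ (-q)) :=
        lintegral_sphere_le_of_antitone (ψ := fun t => ENNReal.ofReal
          (japaneseBracket ‖y‖ ^ p * japaneseBracket (‖y‖ * t) ^ (-q))) (by fun_prop)
          (fun a b ha hab => mono ha hab) hv
    _ ≤ _ := by
        gcongr
        exact hle _ (norm_nonneg y)

/-- The relations between the exponents under which both trilinear forms with kernel
`interactionWeight r δ` are bounded in dimension `m + 2`: `δ_lt` makes `|cos|^{-2δ}` integrable over
the sphere, `add_le` is the scaling condition when the output frequency is high, and `low_output`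
governs the case of inputs which nearly cancel. -/
structure WeightExponents (m : ℕ) (r δ : ℝ) : Prop where
  r_pos : 0 < r
  δ_lt : 2 * δ < 1
  add_le : 2 * r + m ≤ 4 * δ
  low_output : 4 * r - 4 * δ + m < 1 ∨ 4 * r - 4 * δ + m = 1 ∧ 1 < 2 * r

theorem WeightExponents.δ_pos {m : ℕ} {r δ : ℝ} (h : WeightExponents m r δ) : 0 < δ := by
  have h1 := h.add_le
  have h2 := h.r_pos
  have h3 : (0 : ℝ) ≤ m := by positivity
  linarith

theorem norm_mul_norm_mul_abs_cosine_le {n : ℕ} {e y : EuclideanSpace ℝ (Fin n)} (hy : y ≠ 0)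
    {ρ : ℝ} (hρ : 0 < ρ) (he : ‖e‖ = 1) :
    ‖ρ • e‖ * ‖y‖ * |inner ℝ (‖y‖⁻¹ • y) e| ≤ |inner ℝ (ρ • e) y| := by
  have hy' := norm_pos_iff.2 hy
  rw [inner_smul_left, inner_smul_left, norm_smul, he, real_inner_comm, abs_mul, abs_mul]
  simp only [Real.norm_eq_abs, conj_trivial, abs_inv, abs_norm]
  field_simp
  rfl

/-- The angular bound on the weight: it holds when the two inputs nearly cancel, when the direction
is that of the smaller input, and in dimension two (`m = 0`) without restriction. -/
theorem exists_ofReal_pow_mul_weight_sq_le {m : ℕ} {r δ : ℝ} (hE : WeightExponents m r δ) :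
    ∃ C : ℝ, 0 < C ∧ ∀ (e y : EuclideanSpace ℝ (Fin (m + 2))) (ρ : ℝ), ‖e‖ = 1 → 0 < ρ →
      (4 * ‖ρ • e + y‖ ≤ ‖y‖ ∨ ‖ρ • e‖ ≤ ‖y‖ ∨ m = 0) →
      ENNReal.ofReal (ρ ^ m) * ENNReal.ofReal (interactionWeight r δ (ρ • e, y)) ^ 2 ≤
        ENNReal.ofReal C * (cosinePower (2 * δ) (e, y) +
          sinePower (4 * r - 4 * δ + m) (2 * r) (e, y)) := by
  set C₁ : ℝ := (5 ^ r * 2 ^ δ) ^ 2 with hC₁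
  set C₂ : ℝ := 2 ^ m * (2 ^ r * 3 ^ δ * 2 ^ r) ^ 2 with hC₂
  have p1 : 0 < C₁ := by positivity
  have p2 : 0 < C₂ := by positivity
  refine ⟨C₁ + C₂, by positivity, fun e y ρ he hρ hcase => ?_⟩
  have hn : ‖ρ • e‖ = ρ := by simp [norm_smul, he, abs_of_pos hρ]
  have hw0 := interactionWeight_nonneg (r := r) (δ := δ) (ρ • e, y)
  rw [← ENNReal.ofReal_pow hw0, ← ENNReal.ofReal_mul (by positivity)]
  by_cases hnear : 4 * ‖ρ • e + y‖ ≤ ‖y‖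
  · refine le_trans ?_ (mul_le_mul' le_rfl le_add_self)
    have hy : y ≠ 0 := by
      rintro rfl
      simp only [add_zero, norm_zero, hn] at hnear
      linarith
    have hu : ‖‖y‖⁻¹ • y‖ = 1 := norm_smul_inv_norm hy
    set c := inner ℝ (‖y‖⁻¹ • y) e with hc
    have ht : ‖ρ • e‖ * |Real.sqrt (1 - c ^ 2)| ≤ ‖ρ • e + y‖ := by
      rw [abs_of_nonneg (Real.sqrt_nonneg _), hn]
      refine abs_le_of_sq_le_sq' ?_ (norm_nonneg _) |>.2
      have hc1 : c ^ 2 ≤ 1 := by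
        have := abs_real_inner_le_norm (‖y‖⁻¹ • y) e
        rw [he, hu, one_mul] at this
        have h2 := abs_le.1 this
        nlinarith [h2.1, h2.2]
      have hyc : inner ℝ e y = ‖y‖ * c := by
        rw [hc, inner_smul_left, real_inner_comm]
        simp only [conj_trivial]
        rw [mul_inv_cancel_left₀ (norm_pos_iff.2 hy).ne']
      rw [mul_pow, Real.sq_sqrt (by linarith), norm_add_sq_real, hn, inner_smul_left, hyc]
      simp only [conj_trivial]
      nlinarith [sq_nonneg (ρ * c + ‖y‖)]
    have h := pow_mul_interactionWeight_sq_le_of_near (m := m) hE.r_pos.le hE.δ_pos.le hnear ht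
    rw [hn] at h
    rw [sinePower, ← ENNReal.ofReal_mul (by positivity)]
    refine ENNReal.ofReal_le_ofReal (h.trans ?_)
    have := japaneseBracket_pos y
    have := japaneseBracket_pos (‖y‖ * Real.sqrt (1 - c ^ 2))
    rw [← hC₂]
    gcongr
    linarith
  · have hmin : ‖ρ • e‖ ≤ ‖y‖ ∨ m = 0 := hcase.resolve_left hnear
    refine le_trans ?_ (mul_le_mul' le_rfl le_self_add)
    rcases eq_or_ne (inner ℝ (‖y‖⁻¹ • y) e) 0 with h0 | h0
    -- on orthogonal directions the right-hand side is infinite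
    · rw [cosinePower, h0, abs_zero, ENNReal.ofReal_zero,
        ENNReal.zero_rpow_of_neg (by linarith [hE.δ_pos]), ENNReal.mul_top (by simp; positivity)]
      exact le_top
    · have hy : y ≠ 0 := by rintro rfl; simp at h0
      have hu : ‖‖y‖⁻¹ • y‖ = 1 := norm_smul_inv_norm hy
      have hc0 : 0 < |inner ℝ (‖y‖⁻¹ • y) e| := abs_pos.2 h0
      have hc1 : |inner ℝ (‖y‖⁻¹ • y) e| ≤ 1 := by
        have := abs_real_inner_le_norm (‖y‖⁻¹ • y) e
        rwa [he, hu, one_mul] at this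
      have h := pow_mul_interactionWeight_sq_le_of_far (m := m) hE.r_pos.le hE.δ_pos.le hE.add_le
        (le_of_not_ge hnear) hmin hc0 hc1 (norm_mul_norm_mul_abs_cosine_le hy hρ he)
      rw [hn] at h
      rw [cosinePower, ENNReal.ofReal_rpow_of_pos hc0, ← ENNReal.ofReal_mul (by positivity)]
      refine ENNReal.ofReal_le_ofReal (h.trans ?_)
      rw [← hC₁]
      gcongr
      linarith

/-! ### The two trilinear estimates -/

/-- Boundedness of the form `∫∫ f(x) g(y) H(x + y, |x|² + |y|²) w(x, y) dx dy`, in which the two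
inputs live on the paraboloid. -/
def OutputBound {n : ℕ} (w : EuclideanSpace ℝ (Fin n) × EuclideanSpace ℝ (Fin n) → ℝ≥0∞)
    (K : ℝ≥0∞) : Prop :=
  ∀ (f g : EuclideanSpace ℝ (Fin n) → ℝ≥0∞) (H : Spacetime n → ℝ≥0∞),
    Measurable f → Measurable g → Measurable H →
    (∫⁻ x, ∫⁻ y, f x * g y * H (x + y, ‖x‖ ^ 2 + ‖y‖ ^ 2) * w (x, y)) ^ 2 ≤
      K * (∫⁻ x, f x ^ 2) * (∫⁻ x, g x ^ 2) * ∫⁻ ζ, H ζ ^ 2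

/-- Boundedness of the form `∫∫ F(x, |x|² + 2 x·y) g(y) h(x + y) w(x, y) dx dy`, in which one input
and the output live on the paraboloid: here `|x|² + 2 x·y = |x + y|² - |y|²`. -/
def InputBound {n : ℕ} (w : EuclideanSpace ℝ (Fin n) × EuclideanSpace ℝ (Fin n) → ℝ≥0∞)
    (K : ℝ≥0∞) : Prop :=
  ∀ (F : Spacetime n → ℝ≥0∞) (g h : EuclideanSpace ℝ (Fin n) → ℝ≥0∞),
    Measurable F → Measurable g → Measurable h →
    (∫⁻ x, ∫⁻ y, F (x, ‖x‖ ^ 2 + 2 * inner ℝ x y) * g y * h (x + y) * w (x, y)) ^ 2 ≤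
      K * (∫⁻ ζ, F ζ ^ 2) * (∫⁻ x, g x ^ 2) * ∫⁻ x, h x ^ 2

theorem ENNReal.add_sq_le_four_mul (a b : ℝ≥0∞) : (a + b) ^ 2 ≤ 4 * (a ^ 2 + b ^ 2) := by
  rcases le_total a b with h | h
  · calc (a + b) ^ 2 ≤ (b + b) ^ 2 := by gcongr
      _ = 4 * b ^ 2 := by ring
      _ ≤ _ := by gcongr; exact le_add_self
  · calc (a + b) ^ 2 ≤ (a + a) ^ 2 := by gcongr
      _ = 4 * a ^ 2 := by ring
      _ ≤ _ := by gcongr; exact le_self_add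

section Bounds

variable {n : ℕ} {w w₁ w₂ : EuclideanSpace ℝ (Fin n) × EuclideanSpace ℝ (Fin n) → ℝ≥0∞}
  {K K₁ K₂ : ℝ≥0∞}

theorem OutputBound.of_le_add (h₁ : OutputBound w₁ K₁) (h₂ : OutputBound w₂ K₂)
    (hm : Measurable w₁) (hle : ∀ p, w p ≤ w₁ p + w₂ p) : OutputBound w (4 * (K₁ + K₂)) := by
  intro f g H hf hg hH
  have hm1 : Measurable fun p : EuclideanSpace ℝ (Fin n) × EuclideanSpace ℝ (Fin n) =>
      f p.1 * g p.2 * H (p.1 + p.2, ‖p.1‖ ^ 2 + ‖p.2‖ ^ 2) * w₁ p := by fun_prop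
  calc _ ≤ ((∫⁻ x, ∫⁻ y, f x * g y * H (x + y, ‖x‖ ^ 2 + ‖y‖ ^ 2) * w₁ (x, y)) +
        ∫⁻ x, ∫⁻ y, f x * g y * H (x + y, ‖x‖ ^ 2 + ‖y‖ ^ 2) * w₂ (x, y)) ^ 2 := by
        rw [← lintegral_add_left hm1.lintegral_prod_right']
        gcongr with x
        rw [← lintegral_add_left (by fun_prop)]
        gcongr with y
        rw [← mul_add]
        gcongr
        exact hle _
    _ ≤ 4 * (K₁ * (∫⁻ x, f x ^ 2) * (∫⁻ x, g x ^ 2) * (∫⁻ ζ, H ζ ^ 2) +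
        K₂ * (∫⁻ x, f x ^ 2) * (∫⁻ x, g x ^ 2) * ∫⁻ ζ, H ζ ^ 2) :=
        (ENNReal.add_sq_le_four_mul _ _).trans
          (by gcongr; exacts [h₁ f g H hf hg hH, h₂ f g H hf hg hH])
    _ = _ := by ring

theorem InputBound.of_le_add (h₁ : InputBound w₁ K₁) (h₂ : InputBound w₂ K₂)
    (hm : Measurable w₁) (hle : ∀ p, w p ≤ w₁ p + w₂ p) : InputBound w (4 * (K₁ + K₂)) := by
  intro F g h hF hg hh
  have hm1 : Measurable fun p : EuclideanSpace ℝ (Fin n) × EuclideanSpace ℝ (Fin n) =>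
      F (p.1, ‖p.1‖ ^ 2 + 2 * inner ℝ p.1 p.2) * g p.2 * h (p.1 + p.2) * w₁ p := by fun_prop
  calc _ ≤ ((∫⁻ x, ∫⁻ y, F (x, ‖x‖ ^ 2 + 2 * inner ℝ x y) * g y * h (x + y) * w₁ (x, y)) +
        ∫⁻ x, ∫⁻ y, F (x, ‖x‖ ^ 2 + 2 * inner ℝ x y) * g y * h (x + y) * w₂ (x, y)) ^ 2 := by
        rw [← lintegral_add_left hm1.lintegral_prod_right']
        gcongr with x
        rw [← lintegral_add_left (by fun_prop)]
        gcongr with y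
        rw [← mul_add]
        gcongr
        exact hle _
    _ ≤ 4 * (K₁ * (∫⁻ ζ, F ζ ^ 2) * (∫⁻ x, g x ^ 2) * (∫⁻ x, h x ^ 2) +
        K₂ * (∫⁻ ζ, F ζ ^ 2) * (∫⁻ x, g x ^ 2) * ∫⁻ x, h x ^ 2) :=
        (ENNReal.add_sq_le_four_mul _ _).trans
          (by gcongr; exacts [h₁ F g h hF hg hh, h₂ F g h hF hg hh])
    _ = _ := by ring

theorem OutputBound.swap (h : OutputBound w K) (hw : Measurable w) :
    OutputBound (fun p => w p.swap) K := by
  intro f g H hf hg hH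
  rw [lintegral_lintegral_swap (by fun_prop)]
  calc _ = (∫⁻ y, ∫⁻ x, g y * f x * H (y + x, ‖y‖ ^ 2 + ‖x‖ ^ 2) * w (y, x)) ^ 2 := by
        congr 1
        refine lintegral_congr fun y => lintegral_congr fun x => ?_
        rw [add_comm x y, add_comm (‖x‖ ^ 2), mul_comm (f x)]
        rfl
    _ ≤ _ := h g f H hg hf hH
    _ = _ := by ring

end Bounds

theorem ofReal_weight_sq {n : ℕ} {r δ : ℝ}
    (p : EuclideanSpace ℝ (Fin n) × EuclideanSpace ℝ (Fin n)) :
    ENNReal.ofReal (interactionWeight r δ p) ^ 2 =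
      ENNReal.ofReal (interactionWeight r δ p ^ 2) :=
  (ENNReal.ofReal_pow (interactionWeight_nonneg p) 2).symm

/-- The region where the derivative of the output time frequency `|x|² + |y|²` along the direction
of `x`, for fixed `x + y`, is less than `|x|`. -/
def parallelRegion (n : ℕ) : Set (EuclideanSpace ℝ (Fin n) × EuclideanSpace ℝ (Fin n)) :=
  {p | |‖p.1‖ ^ 2 - inner ℝ p.1 p.2| < ‖p.1‖ ^ 2 / 2}

theorem measurableSet_parallelRegion (n : ℕ) : MeasurableSet (parallelRegion n) :=
  measurableSet_lt (by fun_prop) (by fun_prop)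

/-- The square integral of the weight over the part in `parallelRegion` of an output sphere. In
dimension two the weight is bounded. In dimension three its square is only bounded by `⟨x⟩⁻¹`, and
the rest of the gain comes from the geometry: the product `x·y` is equal to a constant `k` on the
output sphere, so that `|x| ~ √k` in this region, and `x` ranges over a small cap. -/
theorem exists_parallel_sphere_bound {m : ℕ} (hm : m ≤ 1) {r δ : ℝ} (hE : WeightExponents m r δ) :
    ∃ K : ℝ≥0∞, K ≠ ∞ ∧ ∀ (ξ : EuclideanSpace ℝ (Fin (m + 2))) (R : ℝ), 0 < R →
      ENNReal.ofReal (R ^ m) * ∫⁻ e, (parallelRegion (m + 2)).indicator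
        (fun p => ENNReal.ofReal (interactionWeight r δ p))
          ((1 / 2 : ℝ) • ξ + R • e.1, (1 / 2 : ℝ) • ξ - R • e.1) ^ 2
        ∂(volume : Measure (EuclideanSpace ℝ (Fin (m + 2)))).toSphere ≤ K := by
  set C : ℝ := (5 ^ r * 2 ^ δ) ^ 2 * 2 ^ (2 * δ) with hC
  have pC : 0 < C := by positivity
  have hbound : ∀ p ∈ parallelRegion (m + 2), ENNReal.ofReal (interactionWeight r δ p) ^ 2 ≤
      ENNReal.ofReal (C * (japaneseBracket p.1 ^ m)⁻¹) := fun p hp => by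
    rw [ofReal_weight_sq]
    exact ENNReal.ofReal_le_ofReal
      (interactionWeight_sq_le_of_parallel hE.r_pos.le hE.δ_pos.le hE.add_le hp)
  interval_cases m
  · refine ⟨ENNReal.ofReal C * (volume : Measure (EuclideanSpace ℝ (Fin (0 + 2)))).toSphere
      Set.univ, by finiteness, fun ξ R _ => ?_⟩
    rw [pow_zero, ENNReal.ofReal_one, one_mul, ← lintegral_const]
    refine lintegral_mono fun e => ?_
    by_cases h : ((1 / 2 : ℝ) • ξ + R • e.1, (1 / 2 : ℝ) • ξ - R • e.1) ∈ parallelRegion (0 + 2)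
    · rw [Set.indicator_of_mem h]
      simpa using hbound _ h
    · rw [Set.indicator_of_notMem h]; simp
  · refine ⟨ENNReal.ofReal (2 * C) * ((1 + 2) * 2 ^ (1 + 2) * 2), by finiteness,
      fun ξ R hR => ?_⟩
    obtain ⟨v, hv, hvξ⟩ := exists_unit_orthogonal ξ
    set k := ‖ξ‖ ^ 2 / 4 - R ^ 2 with hk
    have hinner : ∀ e : Metric.sphere (0 : EuclideanSpace ℝ (Fin (1 + 2))) 1,
        inner ℝ ((1 / 2 : ℝ) • ξ + R • e.1) ((1 / 2 : ℝ) • ξ - R • e.1) = k := fun e => by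
      have : ‖R • e.1‖ = R := by simp [norm_smul, abs_of_pos hR]
      rw [inner_add_left, inner_sub_right, inner_sub_right, real_inner_comm (R • e.1),
        real_inner_self_eq_norm_sq, real_inner_self_eq_norm_sq, this, norm_smul]
      norm_num
      rw [hk]; ring
    set ψ : ℝ → ℝ≥0∞ := (Set.Iic (2 * Real.sqrt k / R)).indicator
      (fun _ => ENNReal.ofReal (2 * C / Real.sqrt k)) with hψ
    have hψm : Measurable ψ := measurable_const.indicator measurableSet_Iic
    have hle : ∀ e : Metric.sphere (0 : EuclideanSpace ℝ (Fin (1 + 2))) 1,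
        (parallelRegion (1 + 2)).indicator (fun p => ENNReal.ofReal (interactionWeight r δ p))
          ((1 / 2 : ℝ) • ξ + R • e.1, (1 / 2 : ℝ) • ξ - R • e.1) ^ 2 ≤ ψ |inner ℝ v e.1| := by
      intro e
      by_cases h : ((1 / 2 : ℝ) • ξ + R • e.1, (1 / 2 : ℝ) • ξ - R • e.1) ∈ parallelRegion (1 + 2)
      · rw [Set.indicator_of_mem h]
        have hb := hbound _ h
        have hd := h
        rw [parallelRegion, Set.mem_ofPred_eq, abs_lt, hinner] at hd
        dsimp only at hd hb
        set x := (1 / 2 : ℝ) • ξ + R • e.1 with hx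
        have hk0 : 0 < k := by
          by_contra! hk0
          nlinarith [hd.1, hd.2, sq_nonneg ‖x‖]
        have hs := Real.sqrt_pos.2 hk0
        have hss := Real.sq_sqrt hk0.le
        have hx1 : ‖x‖ ≤ 2 * Real.sqrt k := by
          refine (abs_le_of_sq_le_sq' ?_ (by positivity)).2
          rw [mul_pow, hss]
          nlinarith [hd.1, hd.2]
        have hx2 : Real.sqrt k ≤ 2 * ‖x‖ := by
          refine (abs_le_of_sq_le_sq' ?_ (by positivity)).2
          rw [mul_pow, hss]
          nlinarith [hd.1, hd.2]
        have hve : R * |inner ℝ v e.1| ≤ ‖x‖ := by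
          have h1 := abs_real_inner_le_norm v x
          rw [hv, one_mul, hx, inner_add_right, inner_smul_right, inner_smul_right, hvξ, mul_zero,
            zero_add, abs_mul, abs_of_pos hR, ← hx] at h1
          exact h1
        have hmem : |inner ℝ v e.1| ∈ Set.Iic (2 * Real.sqrt k / R) := by
          rw [Set.mem_Iic, le_div_iff₀ hR]
          linarith
        rw [hψ, Set.indicator_of_mem hmem]
        refine hb.trans (ENNReal.ofReal_le_ofReal ?_)
        rw [pow_one, ← div_eq_mul_inv, div_le_div_iff₀ (japaneseBracket_pos x) hs]
        nlinarith [norm_le_japaneseBracket x]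
      · rw [Set.indicator_of_notMem h]; simp
    have hanti : ∀ a b : ℝ, 0 ≤ a → a ≤ b → ψ b ≤ ψ a := by
      intro a b _ hab
      by_cases hb : b ∈ Set.Iic (2 * Real.sqrt k / R)
      · rw [hψ, Set.indicator_of_mem hb, Set.indicator_of_mem (Set.mem_Iic.2 (hab.trans hb))]
      · rw [hψ, Set.indicator_of_notMem hb]; exact zero_le
    have hint : ∫⁻ t in Set.Ioc (0 : ℝ) 1, ψ t ≤
        ENNReal.ofReal (2 * C / Real.sqrt k) * ENNReal.ofReal (2 * Real.sqrt k / R) := by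
      rw [hψ, setLIntegral_indicator measurableSet_Iic, setLIntegral_const]
      gcongr
      calc _ ≤ volume (Set.Icc (0 : ℝ) (2 * Real.sqrt k / R)) :=
            measure_mono fun t ht => ⟨ht.2.1.le, ht.1⟩
        _ = _ := by rw [Real.volume_Icc, sub_zero]
    have hprod : ENNReal.ofReal (R ^ 1) *
        (ENNReal.ofReal (2 * C / Real.sqrt k) * ENNReal.ofReal (2 * Real.sqrt k / R)) ≤
        ENNReal.ofReal (2 * C) * 2 := by
      have h2 : (2 : ℝ≥0∞) = ENNReal.ofReal 2 := by simp
      have hs := Real.sqrt_nonneg k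
      rw [h2, ← ENNReal.ofReal_mul (by positivity), ← ENNReal.ofReal_mul (by positivity),
        ← ENNReal.ofReal_mul (by positivity)]
      refine ENNReal.ofReal_le_ofReal ?_
      rcases hs.eq_or_lt with h0 | h0
      · rw [← h0]; simp; positivity
      · apply le_of_eq; field_simp
    calc _ ≤ ENNReal.ofReal (R ^ 1) * ((1 + 2) * 2 ^ (1 + 2) *
          (ENNReal.ofReal (2 * C / Real.sqrt k) * ENNReal.ofReal (2 * Real.sqrt k / R))) := by
          gcongr
          refine (lintegral_mono hle).trans ?_
          refine (lintegral_sphere_le_of_antitone (m := 1) hψm hanti hv).trans ?_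
          rw [Nat.cast_one]
          gcongr
      _ = (1 + 2) * 2 ^ (1 + 2) * (ENNReal.ofReal (R ^ 1) *
          (ENNReal.ofReal (2 * C / Real.sqrt k) * ENNReal.ofReal (2 * Real.sqrt k / R))) := by
          ring
      _ ≤ (1 + 2) * 2 ^ (1 + 2) * (ENNReal.ofReal (2 * C) * 2) := by gcongr
      _ = _ := by ring

theorem exists_lintegral_angularKernel_le {m : ℕ} {r δ : ℝ} (hE : WeightExponents m r δ) :
    ∃ K : ℝ≥0∞, K ≠ ∞ ∧ ∀ y : EuclideanSpace ℝ (Fin (m + 2)), y ≠ 0 →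
      ∫⁻ e, (cosinePower (2 * δ) (e.1, y) + sinePower (4 * r - 4 * δ + m) (2 * r) (e.1, y))
        ∂(volume : Measure (EuclideanSpace ℝ (Fin (m + 2)))).toSphere ≤ K := by
  obtain ⟨K₁, hK₁, h₁⟩ := exists_lintegral_cosinePower_le m
    (by linarith [hE.δ_pos] : 0 ≤ 2 * δ) hE.δ_lt
  obtain ⟨K₂, hK₂, h₂⟩ := exists_lintegral_sinePower_le m
    (by linarith [hE.add_le] : 4 * r - 4 * δ + m ≤ 2 * r) (by linarith [hE.r_pos]) hE.low_output
  refine ⟨K₁ + K₂, by finiteness, fun y hy => ?_⟩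
  rw [lintegral_add_left (by fun_prop)]
  exact add_le_add (h₁ y hy) (h₂ y hy)

/-- By symmetry the first input may be taken to be the smaller one. In `parallelRegion`
Cauchy–Schwarz is applied on the output spheres, elsewhere for fixed directions of the first input.
-/
theorem exists_outputBound {m : ℕ} (hm : m ≤ 1) {r δ : ℝ} (hE : WeightExponents m r δ) :
    ∃ K : ℝ≥0∞, K ≠ ∞ ∧ OutputBound (n := m + 2)
      (fun p => ENNReal.ofReal (interactionWeight r δ p)) K := by
  set W : EuclideanSpace ℝ (Fin (m + 2)) × EuclideanSpace ℝ (Fin (m + 2)) → ℝ≥0∞ :=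
    fun p => ENNReal.ofReal (interactionWeight r δ p) with hW
  have hWm : Measurable W := measurable_interactionWeight.ennreal_ofReal
  set A : Set (EuclideanSpace ℝ (Fin (m + 2)) × EuclideanSpace ℝ (Fin (m + 2))) :=
    {p | ‖p.1‖ ≤ ‖p.2‖} with hA
  have hAm : MeasurableSet A := measurableSet_le (by fun_prop) (by fun_prop)
  have hDm := measurableSet_parallelRegion (m + 2)
  obtain ⟨K₁, hK₁, h₁⟩ := exists_parallel_sphere_bound hm hE
  obtain ⟨C, hC, hCle⟩ := exists_ofReal_pow_mul_weight_sq_le hE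
  obtain ⟨K₂, hK₂, h₂⟩ := exists_lintegral_angularKernel_le hE
  have b₁ : OutputBound ((parallelRegion (m + 2)).indicator W) K₁ := fun f g H hf hg hH =>
    sq_lintegral_output_fibre_le (hWm.indicator hDm) h₁ hf hg hH
  have b₂ : OutputBound ((A ∩ (parallelRegion (m + 2))ᶜ).indicator W)
      (2 * (ENNReal.ofReal C * K₂)) := fun f g H hf hg hH => by
    refine sq_lintegral_output_direction_le (hWm.indicator (hAm.inter hDm.compl)) ?_
      (B := fun z => ENNReal.ofReal C * (cosinePower (2 * δ) z +
        sinePower (4 * r - 4 * δ + m) (2 * r) z)) (by fun_prop) ?_ (fun y hy => ?_) hf hg hH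
    · intro x y hxy
      exact not_lt.1 (Set.mem_of_indicator_ne_zero hxy).2
    · intro e y ρ he hρ
      by_cases h : (ρ • e, y) ∈ A ∩ (parallelRegion (m + 2))ᶜ
      · rw [Set.indicator_of_mem h]
        exact hCle e y ρ he hρ (.inr (.inl h.1))
      · rw [Set.indicator_of_notMem h]; simp
    · rw [lintegral_const_mul _ (by fun_prop)]
      gcongr
      exact h₂ y hy
  have b₃ : OutputBound (A.indicator W) _ := b₁.of_le_add b₂ (hWm.indicator hDm) fun p => by
    by_cases hpA : p ∈ A
    · rw [Set.indicator_of_mem hpA]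
      by_cases hpD : p ∈ parallelRegion (m + 2)
      · rw [Set.indicator_of_mem hpD]; exact le_self_add
      · rw [Set.indicator_of_mem (s := A ∩ (parallelRegion (m + 2))ᶜ) ⟨hpA, hpD⟩]
        exact le_add_self
    · rw [Set.indicator_of_notMem hpA]; exact zero_le
  refine ⟨_, ?_, b₃.of_le_add (b₃.swap (hWm.indicator hAm)) (hWm.indicator hAm) fun p => ?_⟩
  · finiteness
  · rcases le_total ‖p.1‖ ‖p.2‖ with h | h
    · rw [Set.indicator_of_mem (show p ∈ A from h)]; exact le_self_add
    · have hs : W p = W p.swap := by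
        rw [hW]; dsimp only; congr 1; exact interactionWeight_comm
      rw [Set.indicator_of_mem (show p.swap ∈ A from h), ← hs]; exact le_add_self

theorem exists_inputBound_two {r δ : ℝ} (hE : WeightExponents 0 r δ) :
    ∃ K : ℝ≥0∞, K ≠ ∞ ∧ InputBound (n := 0 + 2)
      (fun p => ENNReal.ofReal (interactionWeight r δ p)) K := by
  obtain ⟨C, hC, hCle⟩ := exists_ofReal_pow_mul_weight_sq_le hE
  obtain ⟨K, hK, h⟩ := exists_lintegral_angularKernel_le hE
  refine ⟨ENNReal.ofReal C * K, by finiteness, fun F g h' hF hg hh => ?_⟩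
  refine sq_lintegral_input_direction_le (m := 0) measurable_interactionWeight.ennreal_ofReal
      (B := fun z => ENNReal.ofReal C * (cosinePower (2 * δ) z +
        sinePower (4 * r - 4 * δ + (0 : ℕ)) (2 * r) z)) (by fun_prop) ?_ (fun y hy => ?_) hF hg hh
  · intro e y ρ he hρ
    exact hCle e y ρ he hρ (.inr (.inr rfl))
  · rw [lintegral_const_mul _ (by fun_prop)]
    gcongr
    exact h y hy

/-- The part of the three-dimensional form where the second input is at most the cube root of the
first: for fixed `x` the planes `x·y = const` meet this region in sets of diameter `≲ min(|x|,
|x|^{1/3})`. The integral of the squared weight over such a set is `≲ |x|`, and the passage from the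
distance between the planes to the variable `x·y` gives back the factor `|x|⁻¹`. -/
theorem inputBound_three_of_small {r δ : ℝ} (hr : 0 ≤ r) (hr2 : 2 * r ≤ 1) (hδ : 0 ≤ δ)
    {w : EuclideanSpace ℝ (Fin (1 + 2)) × EuclideanSpace ℝ (Fin (1 + 2)) → ℝ≥0∞}
    (hw : Measurable w) (hle : ∀ p, w p ≤ ENNReal.ofReal (interactionWeight r δ p))
    (hsupp : ∀ x y, w (x, y) ≠ 0 → ‖y‖ ≤ 4 * ‖x + y‖ ∧ ‖y‖ ≤ ‖x‖ ∧ ‖y‖ ^ 3 ≤ ‖x‖) :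
    InputBound w (ENNReal.ofReal (8 * (5 ^ r) ^ 2)) := by
  intro F g h hF hg hh
  refine sq_lintegral_input_fibre_le hw (fun x hx φ hφ => ?_) hF hg hh
  set R := ‖x‖ with hR
  have hR0 : 0 < R := norm_pos_iff.2 hx
  set C : ℝ := (5 ^ r) ^ 2 with hC
  have pC : 0 < C := by positivity
  -- `M` bounds the size of the second input
  set M := min R (R ^ (1 / 3 : ℝ)) with hM
  have hM0 : 0 ≤ M := by positivity
  have hcube : (R ^ (1 / 3 : ℝ)) ^ 3 = R := by
    rw [← Real.rpow_natCast, ← Real.rpow_mul hR0.le]; norm_num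
  have hM3 : M ^ 3 ≤ R := by
    calc M ^ 3 ≤ (R ^ (1 / 3 : ℝ)) ^ 3 := by gcongr; exact min_le_right _ _
      _ = R := hcube
  have hM2 : M ^ 2 ≤ R := by
    rcases le_total M 1 with h1 | h1
    · nlinarith [min_le_left R (R ^ (1 / 3 : ℝ))]
    · nlinarith [sq_nonneg M]
  have hu : ‖R⁻¹ • x‖ = 1 := norm_smul_inv_norm hx
  obtain ⟨Ψ, hmp, -, hinner, hb⟩ := exists_line_coordinates hu
  have hin : ∀ a b, inner ℝ x (Ψ (a, b)) = R * a := fun a b => by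
    have := hinner a b
    rw [inner_smul_left] at this
    simp only [conj_trivial] at this
    refine (inv_mul_eq_iff_eq_mul₀ hR0.ne').1 ?_
    exact this
  have hwm : Measurable fun y => φ (inner ℝ x y) * w (x, y) ^ 2 := by fun_prop
  have hpt : ∀ p : ℝ × (Fin (1 + 1) → ℝ), φ (inner ℝ x (Ψ p)) * w (x, Ψ p) ^ 2 ≤
      φ (0 + R * p.1) * (Set.Icc (fun _ => -M) (fun _ => M) : Set (Fin (1 + 1) → ℝ)).indicator
        (fun _ => ENNReal.ofReal (C * (1 + M))) p.2 := by
    rintro ⟨a, b⟩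
    rw [hin, zero_add]
    gcongr
    by_cases h0 : w (x, Ψ (a, b)) = 0
    · simp [h0]
    obtain ⟨hfar, hyx, hy3⟩ := hsupp _ _ h0
    have hyM : ‖Ψ (a, b)‖ ≤ M := by
      refine le_min hyx ?_
      refine le_of_pow_le_pow_left₀ three_ne_zero (by positivity) ?_
      rw [hcube]; exact hy3
    have hmem : b ∈ (Set.Icc (fun _ => -M) (fun _ => M) : Set (Fin (1 + 1) → ℝ)) :=
      ⟨fun i => (abs_le.1 ((hb a b i).trans hyM)).1, fun i => (abs_le.1 ((hb a b i).trans hyM)).2⟩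
    rw [Set.indicator_of_mem hmem]
    calc _ ≤ ENNReal.ofReal (interactionWeight r δ (x, Ψ (a, b))) ^ 2 := by
          gcongr; exact hle _
      _ ≤ _ := by
          rw [ofReal_weight_sq]
          refine ENNReal.ofReal_le_ofReal
            ((interactionWeight_sq_le_of_small hr hr2 hδ hfar).trans ?_)
          gcongr
  rw [← hmp.lintegral_comp hwm]
  refine (lintegral_mono hpt).trans ?_
  rw [Measure.volume_eq_prod, lintegral_prod_mul (f := fun a => φ (0 + R * a)) (g :=
      (Set.Icc (fun _ => -M) (fun _ => M) : Set (Fin (1 + 1) → ℝ)).indicator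
        (fun _ => ENNReal.ofReal (C * (1 + M)))) (by fun_prop)
    (measurable_const.indicator measurableSet_Icc).aemeasurable,
    lintegral_indicator measurableSet_Icc, setLIntegral_const, Real.volume_Icc_pi]
  have hnum : ENNReal.ofReal (C * (1 + M)) * ∏ _i : Fin (1 + 1), ENNReal.ofReal (M - -M) ≤
      ENNReal.ofReal (8 * C) * ENNReal.ofReal R := by
    rw [Finset.prod_const, Finset.card_univ, Fintype.card_fin, ← ENNReal.ofReal_pow (by linarith),
      ← ENNReal.ofReal_mul (by positivity), ← ENNReal.ofReal_mul (by positivity)]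
    refine ENNReal.ofReal_le_ofReal ?_
    have : C * (1 + M) * (M - -M) ^ (1 + 1) = C * (4 * M ^ 2 + 4 * M ^ 3) := by ring
    rw [this]
    nlinarith
  calc _ ≤ (∫⁻ a, φ (0 + R * a)) * (ENNReal.ofReal (8 * C) * ENNReal.ofReal R) := by gcongr
    _ = ENNReal.ofReal (8 * C) * (ENNReal.ofReal R * ∫⁻ a, φ (0 + R * a)) := by ring
    _ ≤ _ := by gcongr; exact lintegral_comp_affine_le hR0 0

/-- The time frequency is free at the first input here, so the two inputs cannot be exchanged, and
the case where the first one is the larger requires the stronger exponent `δ'`: up to `|x| = |y|³`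
the angular gain suffices, and beyond that `inputBound_three_of_small` applies. -/
theorem exists_inputBound_three {r δ δ' : ℝ} (hE : WeightExponents 1 r δ) (hδ : δ ≤ δ')
    (hδ' : 2 * δ' < 1) (hexp : 3 + 2 * r ≤ 8 * δ') :
    ∃ K : ℝ≥0∞, K ≠ ∞ ∧ InputBound (n := 1 + 2)
      (fun p => ENNReal.ofReal (interactionWeight r δ' p)) K := by
  set W : EuclideanSpace ℝ (Fin (1 + 2)) × EuclideanSpace ℝ (Fin (1 + 2)) → ℝ≥0∞ :=
    fun p => ENNReal.ofReal (interactionWeight r δ' p) with hW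
  have hWm : Measurable W := measurable_interactionWeight.ennreal_ofReal
  set G : Set (EuclideanSpace ℝ (Fin (1 + 2)) × EuclideanSpace ℝ (Fin (1 + 2))) :=
    ({p | 4 * ‖p.1 + p.2‖ ≤ ‖p.2‖} ∪ {p | ‖p.1‖ ≤ ‖p.2‖}) ∪ {p | ‖p.1‖ ≤ ‖p.2‖ ^ 3} with hG
  have hGm : MeasurableSet G :=
    ((measurableSet_le (by fun_prop) (by fun_prop)).union
      (measurableSet_le (by fun_prop) (by fun_prop))).union
      (measurableSet_le (by fun_prop) (by fun_prop))
  have hδ0 := hE.δ_pos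
  have hadd := hE.add_le
  norm_num at hadd
  obtain ⟨C, hC, hCle⟩ := exists_ofReal_pow_mul_weight_sq_le hE
  obtain ⟨K₁, hK₁, h₁⟩ := exists_lintegral_angularKernel_le hE
  obtain ⟨K₂, hK₂, h₂⟩ := exists_lintegral_cosinePower_le 1 (by linarith : 0 ≤ 2 * δ') hδ'
  set C' : ℝ := (5 ^ r * 2 ^ r) ^ 2 with hC'
  have b₁ : InputBound (G.indicator W) (ENNReal.ofReal C * K₁ + ENNReal.ofReal C' * K₂) :=
      fun F g h hF hg hh => by
    refine sq_lintegral_input_direction_le (hWm.indicator hGm)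
      (B := fun z => ENNReal.ofReal C * (cosinePower (2 * δ) z +
        sinePower (4 * r - 4 * δ + (1 : ℕ)) (2 * r) z) +
        ENNReal.ofReal C' * cosinePower (2 * δ') z) (by fun_prop) ?_ (fun y hy => ?_) hF hg hh
    · intro e y ρ he hρ
      by_cases hmem : (ρ • e, y) ∈ G
      swap
      · rw [Set.indicator_of_notMem hmem]; simp
      rw [Set.indicator_of_mem hmem]
      by_cases hfirst : 4 * ‖ρ • e + y‖ ≤ ‖y‖ ∨ ‖ρ • e‖ ≤ ‖y‖
      · refine le_trans ?_ le_self_add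
        refine le_trans ?_ (hCle e y ρ he hρ (by tauto))
        gcongr
        exact ENNReal.ofReal_le_ofReal (interactionWeight_anti hδ _)
      · refine le_trans ?_ le_add_self
        push Not at hfirst
        have hcube : ‖ρ • e‖ ≤ ‖y‖ ^ 3 := by
          rcases hmem with (h | h) | h
          · exact absurd h (not_le.2 hfirst.1)
          · exact absurd h (not_le.2 hfirst.2)
          · exact h
        have hn : ‖ρ • e‖ = ρ := by simp [norm_smul, he, abs_of_pos hρ]
        have hy : y ≠ 0 := by
          rintro rfl
          rw [hn] at hcube
          simp at hcube
          linarith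
        rcases eq_or_ne (inner ℝ (‖y‖⁻¹ • y) e) 0 with h0 | h0
        · have hC'0 : ENNReal.ofReal C' ≠ 0 := by
            have : 0 < C' := by positivity
            simpa using this
          rw [cosinePower, h0, abs_zero, ENNReal.ofReal_zero,
            ENNReal.zero_rpow_of_neg (by linarith), ENNReal.mul_top hC'0]
          exact le_top
        · have hc0 : 0 < |inner ℝ (‖y‖⁻¹ • y) e| := abs_pos.2 h0
          have hb := mul_interactionWeight_sq_le_of_le_cube (γ := 2 * δ') hE.r_pos.le hδ'.le
            (by linarith) hfirst.1.le hy hfirst.2.le hcube hc0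
            (norm_mul_norm_mul_abs_cosine_le hy hρ he)
          rw [hn, mul_div_cancel_left₀ _ (two_ne_zero' ℝ)] at hb
          rw [hW]
          dsimp only
          rw [ofReal_weight_sq, ← ENNReal.ofReal_mul (by positivity), pow_one, cosinePower,
            ENNReal.ofReal_rpow_of_pos hc0, ← ENNReal.ofReal_mul (by positivity)]
          exact ENNReal.ofReal_le_ofReal hb
    · rw [lintegral_add_left (by fun_prop), lintegral_const_mul _ (by fun_prop),
        lintegral_const_mul _ (by fun_prop)]
      gcongr
      · exact h₁ y hy
      · exact h₂ y hy
  have b₂ : InputBound (Gᶜ.indicator W) (ENNReal.ofReal (8 * (5 ^ r) ^ 2)) := by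
    refine inputBound_three_of_small hE.r_pos.le (by linarith [hE.δ_lt])
      (by linarith : 0 ≤ δ') (hWm.indicator hGm.compl)
      (fun p => Set.indicator_le_self _ _ _) fun x y hxy => ?_
    have hmem := Set.mem_of_indicator_ne_zero hxy
    simp only [hG, Set.mem_compl_iff, Set.mem_union, Set.mem_ofPred_eq, not_or, not_le] at hmem
    exact ⟨hmem.1.1.le, hmem.1.2.le, hmem.2.le⟩
  refine ⟨_, ?_, b₁.of_le_add b₂ (hWm.indicator hGm) fun p => ?_⟩
  · finiteness
  · by_cases hp : p ∈ G
    · rw [Set.indicator_of_mem hp]; exact le_self_add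
    · rw [Set.indicator_of_mem (show p ∈ Gᶜ from hp)]; exact le_add_self

/-! ### Reduction of the space-time estimate -/

instance isAddHaarMeasure_volume_spacetime {n : ℕ} :
    (volume : Measure (Spacetime n)).IsAddHaarMeasure :=
  inferInstanceAs ((volume : Measure (EuclideanSpace ℝ (Fin n))).prod
    (volume : Measure ℝ)).IsAddHaarMeasure

/-- The distance `τ - |ξ|²` of a space-time frequency from the paraboloid. -/
noncomputable def modulation {n : ℕ} (ζ : Spacetime n) : ℝ := ζ.2 - ‖ζ.1‖ ^ 2

@[fun_prop]
theorem measurable_modulation {n : ℕ} : Measurable (modulation : Spacetime n → ℝ) := by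
  unfold modulation
  fun_prop

/-- The kernel of the trilinear form which is dual to the bilinear estimate with `s = -r`. -/
noncomputable def bilinearKernel {n : ℕ} (r θ : ℝ) (p : Spacetime n × Spacetime n) : ℝ :=
  (japaneseBracket p.1.1 * japaneseBracket p.2.1 / japaneseBracket (p.1.1 + p.2.1)) ^ r *
    (japaneseBracket (modulation (p.1 + p.2)) ^ (θ - 1) *
      japaneseBracket (modulation p.1) ^ (-θ) * japaneseBracket (modulation p.2) ^ (-θ))

/-- The resonance identity: at least one of the three modulations is comparable to `|ξ₁·ξ₂|` or
larger. -/
theorem modulation_add {n : ℕ} (ζ₁ ζ₂ : Spacetime n) :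
    modulation (ζ₁ + ζ₂) = modulation ζ₁ + modulation ζ₂ - 2 * inner ℝ ζ₁.1 ζ₂.1 := by
  simp only [modulation, Prod.fst_add, Prod.snd_add, norm_add_sq_real]
  ring

section Pointwise

variable {θ θ' a b c k : ℝ}

theorem bracket_rpow_le_of_dominant {δ : ℝ} (hδ0 : 0 ≤ δ) (hδ1 : δ ≤ 1) (h : |k| ≤ 2 * |c|) :
    japaneseBracket c ^ (-δ) ≤ 2 * japaneseBracket k ^ (-δ) := by
  have pc := japaneseBracket_pos c
  have pk := japaneseBracket_pos k
  have h1 : japaneseBracket k ≤ 2 * japaneseBracket c := japaneseBracket_le_mul (by norm_num) h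
  have h2 : japaneseBracket c ^ (-δ) ≤ (japaneseBracket k / 2) ^ (-δ) :=
    Real.rpow_le_rpow_of_nonpos (by positivity) (by linarith) (by linarith)
  rw [Real.div_rpow pk.le (by norm_num), Real.rpow_neg (by norm_num : (0 : ℝ) ≤ 2),
    div_inv_eq_mul, mul_comm] at h2
  refine h2.trans ?_
  gcongr
  calc (2 : ℝ) ^ δ ≤ 2 ^ (1 : ℝ) := by gcongr; norm_num
    _ = 2 := Real.rpow_one 2

/-- If an input has a larger modulation than the output, the weights of the two can be exchanged,
because `θ > 1 - θ`; the exchange even leaves room to lower the exponent from `θ` to `θ'`. -/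
theorem bracket_rpow_exchange (h1 : 1 / 2 < θ') (h2 : θ' ≤ θ) (h : |c| ≤ |a|) :
    japaneseBracket c ^ (θ - 1) * japaneseBracket a ^ (-θ) ≤
      japaneseBracket a ^ (-(1 - θ')) * japaneseBracket c ^ (-θ') := by
  have pc := japaneseBracket_pos c
  have pa := japaneseBracket_pos a
  have h3 : japaneseBracket c ≤ japaneseBracket a := japaneseBracket_mono h
  calc _ = japaneseBracket c ^ (θ + θ' - 1) * japaneseBracket c ^ (-θ') *
        japaneseBracket a ^ (-θ) := by
        rw [← Real.rpow_add pc]; congr 2; ring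
    _ ≤ japaneseBracket a ^ (θ + θ' - 1) * japaneseBracket c ^ (-θ') *
        japaneseBracket a ^ (-θ) := by
        gcongr
        linarith
    _ = japaneseBracket a ^ (θ + θ' - 1) * japaneseBracket a ^ (-θ) *
        japaneseBracket c ^ (-θ') := by ring
    _ = _ := by rw [← Real.rpow_add pa]; congr 2; ring

/-- The pointwise form of the resonance identity: the largest of the three modulations is traded for
a power of `⟨k⟩`, and the two other ones are left with the exponent `-θ'`, which is square
integrable. -/
theorem modulation_weight_le (h1 : 1 / 2 < θ') (h2 : θ' ≤ θ) (h3 : θ ≤ 1)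
    (hres : c = a + b - 2 * k) :
    japaneseBracket c ^ (θ - 1) * japaneseBracket a ^ (-θ) * japaneseBracket b ^ (-θ) ≤
      2 * (japaneseBracket k ^ (-(1 - θ)) *
          (japaneseBracket a ^ (-θ') * japaneseBracket b ^ (-θ')) +
        (japaneseBracket k ^ (-(1 - θ')) *
          (japaneseBracket c ^ (-θ') * japaneseBracket b ^ (-θ')) +
        japaneseBracket k ^ (-(1 - θ')) *
          (japaneseBracket c ^ (-θ') * japaneseBracket a ^ (-θ')))) := by
  have pa := japaneseBracket_pos a
  have pb := japaneseBracket_pos b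
  have pc := japaneseBracket_pos c
  have pk := japaneseBracket_pos k
  have mono : ∀ t : ℝ, japaneseBracket t ^ (-θ) ≤ japaneseBracket t ^ (-θ') := fun t =>
    Real.rpow_le_rpow_of_exponent_le (one_le_japaneseBracket t) (by linarith)
  have hk : 2 * |k| ≤ |a| + |b| + |c| := by
    have : 2 * k = a + b - c := by linarith
    calc 2 * |k| = |2 * k| := by rw [abs_mul]; norm_num
      _ = |a + b - c| := by rw [this]
      _ ≤ |a + b| + |c| := abs_sub _ _
      _ ≤ _ := by gcongr; exact abs_add_le _ _
  have q1 : 0 ≤ japaneseBracket k ^ (-(1 - θ)) *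
      (japaneseBracket a ^ (-θ') * japaneseBracket b ^ (-θ')) := by positivity
  have q2 : 0 ≤ japaneseBracket k ^ (-(1 - θ')) *
      (japaneseBracket c ^ (-θ') * japaneseBracket b ^ (-θ')) := by positivity
  have q3 : 0 ≤ japaneseBracket k ^ (-(1 - θ')) *
      (japaneseBracket c ^ (-θ') * japaneseBracket a ^ (-θ')) := by positivity
  by_cases hc : |a| ≤ |c| ∧ |b| ≤ |c|
  · have := bracket_rpow_le_of_dominant (δ := 1 - θ) (by linarith) (by linarith)
      (by linarith [abs_nonneg c] : |k| ≤ 2 * |c|)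
    calc _ = japaneseBracket c ^ (-(1 - θ)) * japaneseBracket a ^ (-θ) *
          japaneseBracket b ^ (-θ) := by rw [neg_sub]
      _ ≤ (2 * japaneseBracket k ^ (-(1 - θ))) * japaneseBracket a ^ (-θ') *
          japaneseBracket b ^ (-θ') := by
          gcongr ?_ * ?_ * ?_
          exacts [mono a, mono b]
      _ = 2 * (japaneseBracket k ^ (-(1 - θ)) *
          (japaneseBracket a ^ (-θ') * japaneseBracket b ^ (-θ'))) := by ring
      _ ≤ _ := by gcongr; linarith
  · have hab : (|c| ≤ |a| ∧ |b| ≤ |a|) ∨ (|c| ≤ |b| ∧ |a| ≤ |b|) := by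
      rcases le_total |a| |b| with h | h
      · refine .inr ⟨?_, h⟩
        by_contra! h'
        exact hc ⟨h.trans h'.le, h'.le⟩
      · refine .inl ⟨?_, h⟩
        by_contra! h'
        exact hc ⟨h'.le, h.trans h'.le⟩
    rcases hab with h | h
    · have e1 := bracket_rpow_le_of_dominant (δ := 1 - θ') (by linarith) (by linarith)
        (by linarith [abs_nonneg a] : |k| ≤ 2 * |a|)
      calc _ ≤ japaneseBracket a ^ (-(1 - θ')) * japaneseBracket c ^ (-θ') *
            japaneseBracket b ^ (-θ') := by
            gcongr ?_ * ?_
            exacts [bracket_rpow_exchange h1 h2 h.1, mono b]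
        _ ≤ 2 * japaneseBracket k ^ (-(1 - θ')) * japaneseBracket c ^ (-θ') *
            japaneseBracket b ^ (-θ') := by gcongr
        _ = 2 * (japaneseBracket k ^ (-(1 - θ')) *
            (japaneseBracket c ^ (-θ') * japaneseBracket b ^ (-θ'))) := by ring
        _ ≤ _ := by gcongr; linarith
    · have e1 := bracket_rpow_le_of_dominant (δ := 1 - θ') (by linarith) (by linarith)
        (by linarith [abs_nonneg b] : |k| ≤ 2 * |b|)
      calc _ = japaneseBracket c ^ (θ - 1) * japaneseBracket b ^ (-θ) *
            japaneseBracket a ^ (-θ) := by ring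
        _ ≤ japaneseBracket b ^ (-(1 - θ')) * japaneseBracket c ^ (-θ') *
            japaneseBracket a ^ (-θ') := by
            gcongr ?_ * ?_
            exacts [bracket_rpow_exchange h1 h2 h.1, mono a]
        _ ≤ 2 * japaneseBracket k ^ (-(1 - θ')) * japaneseBracket c ^ (-θ') *
            japaneseBracket a ^ (-θ') := by gcongr
        _ = 2 * (japaneseBracket k ^ (-(1 - θ')) *
            (japaneseBracket c ^ (-θ') * japaneseBracket a ^ (-θ'))) := by ring
        _ ≤ _ := by gcongr; linarith

end Pointwise

/-- Integration over translates of the paraboloid. -/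
theorem lintegral_shear {n : ℕ} {F : Spacetime n → ℝ≥0∞} (hF : Measurable F) :
    ∫⁻ ζ, F ζ = ∫⁻ σ : ℝ, ∫⁻ ξ : EuclideanSpace ℝ (Fin n), F (ξ, ‖ξ‖ ^ 2 + σ) := by
  rw [Measure.volume_eq_prod, lintegral_prod _ (by fun_prop),
    lintegral_lintegral_swap (f := fun (σ : ℝ) (ξ : EuclideanSpace ℝ (Fin n)) =>
      F (ξ, ‖ξ‖ ^ 2 + σ)) (by fun_prop)]
  refine lintegral_congr fun ξ => ?_
  exact (lintegral_add_left_eq_self (fun τ => F (ξ, τ)) (‖ξ‖ ^ 2)).symm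

/-- Forms that are bounded uniformly in two parameters can be integrated against square-integrable
functions of these parameters. -/
theorem sq_lintegral_lintegral_le {T : ℝ → ℝ → ℝ≥0∞} {α F G : ℝ → ℝ≥0∞} {K : ℝ≥0∞}
    (hα : Measurable α) (hF : Measurable F) (hG : Measurable G)
    (h : ∀ s t, T s t ^ 2 ≤ K * F s * G t) :
    (∫⁻ s, ∫⁻ t, α s * α t * T s t) ^ 2 ≤
      (∫⁻ s, α s ^ 2) ^ 2 * (K * (∫⁻ s, F s) * ∫⁻ t, G t) := by
  have main : (∫⁻ s, ∫⁻ t, α s * α t * T s t) ^ 2 ≤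
      (∫⁻ s, α s ^ 2 * ∫⁻ t, α t ^ 2) * ∫⁻ s, K * F s * ∫⁻ t, G t := by
    refine lintegral_sq_le_of_sq_le (by fun_prop) (by fun_prop) (.of_forall fun s => ?_)
    rw [← lintegral_const_mul _ (by fun_prop), ← lintegral_const_mul _ hG]
    refine lintegral_sq_le_of_sq_le (by fun_prop) (by fun_prop) (.of_forall fun t => ?_)
    rw [mul_pow, mul_pow]
    gcongr
    exact h s t
  refine main.trans (le_of_eq ?_)
  rw [lintegral_mul_const _ (by fun_prop), lintegral_mul_const _ (by fun_prop),
    lintegral_const_mul _ hF]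
  ring

section Forms

variable {n : ℕ} {w : EuclideanSpace ℝ (Fin n) × EuclideanSpace ℝ (Fin n) → ℝ≥0∞} {K : ℝ≥0∞}
  {α : ℝ → ℝ≥0∞} {f g h : Spacetime n → ℝ≥0∞}

/-- The form for functions on the paraboloid, integrated over the modulations of both inputs. -/
theorem OutputBound.spacetime (hB : OutputBound w K) (hw : Measurable w) (hα : Measurable α)
    (hf : Measurable f) (hg : Measurable g) (hh : Measurable h) :
    (∫⁻ ζ₁, ∫⁻ ζ₂, f ζ₁ * g ζ₂ * h (ζ₁ + ζ₂) *
      (w (ζ₁.1, ζ₂.1) * (α (modulation ζ₁) * α (modulation ζ₂)))) ^ 2 ≤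
      (∫⁻ s, α s ^ 2) ^ 2 * K * (∫⁻ ζ, f ζ ^ 2) * (∫⁻ ζ, g ζ ^ 2) * ∫⁻ ζ, h ζ ^ 2 := by
  have hm : Measurable fun p : Spacetime n × Spacetime n => f p.1 * g p.2 * h (p.1 + p.2) *
      (w (p.1.1, p.2.1) * (α (modulation p.1) * α (modulation p.2))) := by fun_prop
  have e1 : ∫⁻ ζ₁, ∫⁻ ζ₂, f ζ₁ * g ζ₂ * h (ζ₁ + ζ₂) *
      (w (ζ₁.1, ζ₂.1) * (α (modulation ζ₁) * α (modulation ζ₂))) =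
      ∫⁻ s, ∫⁻ t, α s * α t * ∫⁻ x, ∫⁻ y, f (x, ‖x‖ ^ 2 + s) * g (y, ‖y‖ ^ 2 + t) *
        h (x + y, ‖x‖ ^ 2 + ‖y‖ ^ 2 + (s + t)) * w (x, y) := by
    rw [lintegral_shear hm.lintegral_prod_right']
    refine lintegral_congr fun s => ?_
    have e2 : ∀ x : EuclideanSpace ℝ (Fin n), ∫⁻ ζ₂ : Spacetime n,
        f (x, ‖x‖ ^ 2 + s) * g ζ₂ * h ((x, ‖x‖ ^ 2 + s) + ζ₂) *
          (w (x, ζ₂.1) * (α (modulation (x, ‖x‖ ^ 2 + s)) * α (modulation ζ₂))) =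
        ∫⁻ t, ∫⁻ y, α s * α t * (f (x, ‖x‖ ^ 2 + s) * g (y, ‖y‖ ^ 2 + t) *
          h (x + y, ‖x‖ ^ 2 + ‖y‖ ^ 2 + (s + t)) * w (x, y)) := fun x => by
      rw [lintegral_shear (by fun_prop)]
      refine lintegral_congr fun t => lintegral_congr fun y => ?_
      simp only [modulation, add_sub_cancel_left, Prod.mk_add_mk]
      rw [show ‖x‖ ^ 2 + s + (‖y‖ ^ 2 + t) = ‖x‖ ^ 2 + ‖y‖ ^ 2 + (s + t) by ring]
      ring
    simp_rw [e2]
    rw [lintegral_lintegral_swap]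
    · refine lintegral_congr fun t => ?_
      rw [← lintegral_const_mul _ (Measurable.lintegral_prod_right' (by fun_prop :
        Measurable fun p : EuclideanSpace ℝ (Fin n) × EuclideanSpace ℝ (Fin n) =>
          f (p.1, ‖p.1‖ ^ 2 + s) * g (p.2, ‖p.2‖ ^ 2 + t) *
          h (p.1 + p.2, ‖p.1‖ ^ 2 + ‖p.2‖ ^ 2 + (s + t)) * w p))]
      refine lintegral_congr fun x => ?_
      rw [← lintegral_const_mul _ (by fun_prop)]
    · exact (Measurable.lintegral_prod_right' (by fun_prop :
        Measurable fun q : (EuclideanSpace ℝ (Fin n) × ℝ) × EuclideanSpace ℝ (Fin n) =>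
          α s * α q.1.2 * (f (q.1.1, ‖q.1.1‖ ^ 2 + s) * g (q.2, ‖q.2‖ ^ 2 + q.1.2) *
          h (q.1.1 + q.2, ‖q.1.1‖ ^ 2 + ‖q.2‖ ^ 2 + (s + q.1.2)) * w (q.1.1, q.2)))).aemeasurable
  rw [e1]
  refine (sq_lintegral_lintegral_le (K := K * ∫⁻ ζ, h ζ ^ 2)
    (F := fun s => ∫⁻ x, f (x, ‖x‖ ^ 2 + s) ^ 2) (G := fun t => ∫⁻ y, g (y, ‖y‖ ^ 2 + t) ^ 2) hα
    (Measurable.lintegral_prod_right' (by fun_prop :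
      Measurable fun q : ℝ × EuclideanSpace ℝ (Fin n) => f (q.2, ‖q.2‖ ^ 2 + q.1) ^ 2))
    (Measurable.lintegral_prod_right' (by fun_prop :
      Measurable fun q : ℝ × EuclideanSpace ℝ (Fin n) => g (q.2, ‖q.2‖ ^ 2 + q.1) ^ 2))
    fun s t => ?_).trans (le_of_eq ?_)
  · refine (hB (fun x => f (x, ‖x‖ ^ 2 + s)) (fun y => g (y, ‖y‖ ^ 2 + t))
      (fun ζ => h (ζ.1, ζ.2 + (s + t))) (by fun_prop) (by fun_prop) (by fun_prop)).trans
      (le_of_eq ?_)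
    have : ∫⁻ ζ : Spacetime n, h (ζ.1, ζ.2 + (s + t)) ^ 2 = ∫⁻ ζ, h ζ ^ 2 := by
      have := lintegral_add_right_eq_self (μ := (volume : Measure (Spacetime n)))
        (fun ζ => h ζ ^ 2) (0, s + t)
      rw [← this]
      refine lintegral_congr fun ζ => ?_
      rw [show ζ + (0, s + t) = (ζ.1, ζ.2 + (s + t)) by ext1 <;> simp]
    rw [this]; ring
  · rw [← lintegral_shear (hf.pow_const 2), ← lintegral_shear (hg.pow_const 2)]
    ring

/-- The form for functions on the paraboloid, integrated over the modulations of the output and of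
the second input. -/
theorem InputBound.spacetime (hB : InputBound w K) (hw : Measurable w) (hα : Measurable α)
    (hf : Measurable f) (hg : Measurable g) (hh : Measurable h) :
    (∫⁻ ζ₁, ∫⁻ ζ₂, f ζ₁ * g ζ₂ * h (ζ₁ + ζ₂) *
      (w (ζ₁.1, ζ₂.1) * (α (modulation (ζ₁ + ζ₂)) * α (modulation ζ₂)))) ^ 2 ≤
      (∫⁻ s, α s ^ 2) ^ 2 * K * (∫⁻ ζ, f ζ ^ 2) * (∫⁻ ζ, g ζ ^ 2) * ∫⁻ ζ, h ζ ^ 2 := by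
  have hm : Measurable fun p : Spacetime n × Spacetime n => f (p.2 - p.1) * g p.1 * h p.2 *
      (w (p.2.1 - p.1.1, p.1.1) * (α (modulation p.2) * α (modulation p.1))) := by fun_prop
  have e0 : ∫⁻ ζ₁, ∫⁻ ζ₂, f ζ₁ * g ζ₂ * h (ζ₁ + ζ₂) *
      (w (ζ₁.1, ζ₂.1) * (α (modulation (ζ₁ + ζ₂)) * α (modulation ζ₂))) =
      ∫⁻ ζ₂, ∫⁻ ζ, f (ζ - ζ₂) * g ζ₂ * h ζ *
        (w (ζ.1 - ζ₂.1, ζ₂.1) * (α (modulation ζ) * α (modulation ζ₂))) := by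
    rw [lintegral_lintegral_swap (by fun_prop)]
    refine lintegral_congr fun ζ₂ => ?_
    rw [← lintegral_sub_right_eq_self _ ζ₂]
    refine lintegral_congr fun ζ => ?_
    rw [sub_add_cancel, Prod.fst_sub]
  have e1 : ∫⁻ ζ₂, ∫⁻ ζ, f (ζ - ζ₂) * g ζ₂ * h ζ *
        (w (ζ.1 - ζ₂.1, ζ₂.1) * (α (modulation ζ) * α (modulation ζ₂))) =
      ∫⁻ s, ∫⁻ t, α s * α t * ∫⁻ x, ∫⁻ y, f (x, ‖x‖ ^ 2 + 2 * inner ℝ x y + (t - s)) *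
        g (y, ‖y‖ ^ 2 + s) * h (x + y, ‖x + y‖ ^ 2 + t) * w (x, y) := by
    rw [lintegral_shear hm.lintegral_prod_right']
    refine lintegral_congr fun s => ?_
    have e2 : ∀ y : EuclideanSpace ℝ (Fin n), ∫⁻ ζ : Spacetime n,
        f (ζ - (y, ‖y‖ ^ 2 + s)) * g (y, ‖y‖ ^ 2 + s) * h ζ *
          (w (ζ.1 - y, y) * (α (modulation ζ) * α (modulation (y, ‖y‖ ^ 2 + s)))) =
        ∫⁻ t, ∫⁻ x, α s * α t * (f (x, ‖x‖ ^ 2 + 2 * inner ℝ x y + (t - s)) *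
          g (y, ‖y‖ ^ 2 + s) * h (x + y, ‖x + y‖ ^ 2 + t) * w (x, y)) := fun y => by
      rw [lintegral_shear (by fun_prop)]
      refine lintegral_congr fun t => ?_
      rw [← lintegral_add_right_eq_self _ y]
      refine lintegral_congr fun x => ?_
      simp only [modulation, add_sub_cancel_left, add_sub_cancel_right, Prod.mk_sub_mk]
      rw [show ‖x + y‖ ^ 2 + t - (‖y‖ ^ 2 + s) = ‖x‖ ^ 2 + 2 * inner ℝ x y + (t - s) by
        rw [norm_add_sq_real]; ring]
      ring
    simp_rw [e2]
    rw [lintegral_lintegral_swap]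
    · refine lintegral_congr fun t => ?_
      rw [lintegral_lintegral_swap (by fun_prop)]
      rw [← lintegral_const_mul _ (Measurable.lintegral_prod_right' (by fun_prop :
        Measurable fun p : EuclideanSpace ℝ (Fin n) × EuclideanSpace ℝ (Fin n) =>
          f (p.1, ‖p.1‖ ^ 2 + 2 * inner ℝ p.1 p.2 + (t - s)) *
          g (p.2, ‖p.2‖ ^ 2 + s) * h (p.1 + p.2, ‖p.1 + p.2‖ ^ 2 + t) * w p))]
      refine lintegral_congr fun x => ?_
      rw [← lintegral_const_mul _ (by fun_prop)]
    · exact (Measurable.lintegral_prod_right' (by fun_prop :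
        Measurable fun q : (EuclideanSpace ℝ (Fin n) × ℝ) × EuclideanSpace ℝ (Fin n) =>
          α s * α q.1.2 * (f (q.2, ‖q.2‖ ^ 2 + 2 * inner ℝ q.2 q.1.1 + (q.1.2 - s)) *
          g (q.1.1, ‖q.1.1‖ ^ 2 + s) * h (q.2 + q.1.1, ‖q.2 + q.1.1‖ ^ 2 + q.1.2) *
          w (q.2, q.1.1)))).aemeasurable
  rw [e0, e1]
  refine (sq_lintegral_lintegral_le (K := K * ∫⁻ ζ, f ζ ^ 2)
    (F := fun s => ∫⁻ x, g (x, ‖x‖ ^ 2 + s) ^ 2) (G := fun t => ∫⁻ y, h (y, ‖y‖ ^ 2 + t) ^ 2) hα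
    (Measurable.lintegral_prod_right' (by fun_prop :
      Measurable fun q : ℝ × EuclideanSpace ℝ (Fin n) => g (q.2, ‖q.2‖ ^ 2 + q.1) ^ 2))
    (Measurable.lintegral_prod_right' (by fun_prop :
      Measurable fun q : ℝ × EuclideanSpace ℝ (Fin n) => h (q.2, ‖q.2‖ ^ 2 + q.1) ^ 2))
    fun s t => ?_).trans (le_of_eq ?_)
  · refine (hB (fun ζ => f (ζ.1, ζ.2 + (t - s))) (fun y => g (y, ‖y‖ ^ 2 + s))
      (fun x => h (x, ‖x‖ ^ 2 + t)) (by fun_prop) (by fun_prop) (by fun_prop)).trans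
      (le_of_eq ?_)
    have : ∫⁻ ζ : Spacetime n, f (ζ.1, ζ.2 + (t - s)) ^ 2 = ∫⁻ ζ, f ζ ^ 2 := by
      have := lintegral_add_right_eq_self (μ := (volume : Measure (Spacetime n)))
        (fun ζ => f ζ ^ 2) (0, t - s)
      rw [← this]
      refine lintegral_congr fun ζ => ?_
      rw [show ζ + (0, t - s) = (ζ.1, ζ.2 + (t - s)) by ext1 <;> simp]
    rw [this]
  · rw [← lintegral_shear (hg.pow_const 2), ← lintegral_shear (hh.pow_const 2)]
    ring

end Forms

/-- The three regions according to the largest modulation. If it is that of the output, the weight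
gains `⟨ξ₁·ξ₂⟩^{-(1-θ)}`; if it is that of an input, the exponent may be improved to `1 - θ'`. -/
theorem exists_trilinear_le {n : ℕ} {r θ θ' : ℝ} (h1 : 1 / 2 < θ') (h2 : θ' ≤ θ) (h3 : θ ≤ 1)
    {K₁ K₂ : ℝ≥0∞} (hK₁ : K₁ ≠ ∞) (hK₂ : K₂ ≠ ∞)
    (hout : OutputBound (n := n) (fun p => ENNReal.ofReal (interactionWeight r (1 - θ) p)) K₁)
    (hin : InputBound (n := n) (fun p => ENNReal.ofReal (interactionWeight r (1 - θ') p)) K₂) :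
    ∃ K : ℝ≥0∞, K ≠ ∞ ∧ ∀ f g h : Spacetime n → ℝ≥0∞,
      Measurable f → Measurable g → Measurable h →
      (∫⁻ ζ₁, ∫⁻ ζ₂, f ζ₁ * g ζ₂ * h (ζ₁ + ζ₂) * ENNReal.ofReal (bilinearKernel r θ (ζ₁, ζ₂))) ^ 2 ≤
        K * (∫⁻ ζ, f ζ ^ 2) * (∫⁻ ζ, g ζ ^ 2) * ∫⁻ ζ, h ζ ^ 2 := by
  set α : ℝ → ℝ≥0∞ := fun s => ENNReal.ofReal (japaneseBracket s ^ (-θ')) with hα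
  have hαm : Measurable α := by fun_prop
  have hA : ∫⁻ s, α s ^ 2 ≠ ∞ := by
    refine ne_of_lt (lt_of_eq_of_lt (lintegral_congr fun s => ?_)
      (lintegral_japaneseBracket_rpow_lt_top (by linarith : 1 < 2 * θ')))
    have ps := japaneseBracket_pos s
    rw [hα, ← ENNReal.ofReal_pow (by positivity), ← Real.rpow_natCast, ← Real.rpow_mul ps.le]
    congr 2; push_cast; ring
  set W₁ : EuclideanSpace ℝ (Fin n) × EuclideanSpace ℝ (Fin n) → ℝ≥0∞ :=
    fun p => ENNReal.ofReal (interactionWeight r (1 - θ) p) with hW₁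
  set W₂ : EuclideanSpace ℝ (Fin n) × EuclideanSpace ℝ (Fin n) → ℝ≥0∞ :=
    fun p => ENNReal.ofReal (interactionWeight r (1 - θ') p) with hW₂
  have hW₁m : Measurable W₁ := measurable_interactionWeight.ennreal_ofReal
  have hW₂m : Measurable W₂ := measurable_interactionWeight.ennreal_ofReal
  have hpt : ∀ ζ₁ ζ₂ : Spacetime n, ENNReal.ofReal (bilinearKernel r θ (ζ₁, ζ₂)) ≤
      ENNReal.ofReal 2 * (W₁ (ζ₁.1, ζ₂.1) * (α (modulation ζ₁) * α (modulation ζ₂)) +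
        (W₂ (ζ₁.1, ζ₂.1) * (α (modulation (ζ₁ + ζ₂)) * α (modulation ζ₂)) +
        W₂ (ζ₁.1, ζ₂.1) * (α (modulation (ζ₁ + ζ₂)) * α (modulation ζ₁)))) := by
    intro ζ₁ ζ₂
    have p1 := japaneseBracket_pos (modulation ζ₁)
    have p2 := japaneseBracket_pos (modulation ζ₂)
    have p3 := japaneseBracket_pos (modulation (ζ₁ + ζ₂))
    have q1 := japaneseBracket_pos ζ₁.1
    have q2 := japaneseBracket_pos ζ₂.1
    have q3 := japaneseBracket_pos (ζ₁.1 + ζ₂.1)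
    have w1 := interactionWeight_nonneg (r := r) (δ := 1 - θ) (ζ₁.1, ζ₂.1)
    have w2 := interactionWeight_nonneg (r := r) (δ := 1 - θ') (ζ₁.1, ζ₂.1)
    simp only [hW₁, hW₂, hα]
    rw [← ENNReal.ofReal_mul (by positivity), ← ENNReal.ofReal_mul (by positivity),
      ← ENNReal.ofReal_mul (by positivity), ← ENNReal.ofReal_mul (by positivity),
      ← ENNReal.ofReal_mul (by positivity), ← ENNReal.ofReal_mul (by positivity),
      ← ENNReal.ofReal_add (by positivity) (by positivity),
      ← ENNReal.ofReal_add (by positivity) (by positivity),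
      ← ENNReal.ofReal_mul (by positivity)]
    refine ENNReal.ofReal_le_ofReal ?_
    have := modulation_weight_le h1 h2 h3 (modulation_add ζ₁ ζ₂)
    simp only [bilinearKernel, interactionWeight]
    refine (mul_le_mul_of_nonneg_left this (by positivity)).trans (le_of_eq ?_)
    ring
  set A := ∫⁻ s, α s ^ 2 with hAdef
  refine ⟨4 * (4 * (A ^ 2 * K₁ + 4 * (A ^ 2 * K₂ + A ^ 2 * K₂))), by finiteness,
    fun f g h hf hg hh => ?_⟩
  have b1 := hout.spacetime hW₁m hαm hf hg hh
  have b2 := hin.spacetime hW₂m hαm hf hg hh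
  have b3 := hin.spacetime hW₂m hαm hg hf hh
  have b3' : (∫⁻ ζ₁, ∫⁻ ζ₂, f ζ₁ * g ζ₂ * h (ζ₁ + ζ₂) *
      (W₂ (ζ₁.1, ζ₂.1) * (α (modulation (ζ₁ + ζ₂)) * α (modulation ζ₁)))) ^ 2 ≤
      A ^ 2 * K₂ * (∫⁻ ζ, f ζ ^ 2) * (∫⁻ ζ, g ζ ^ 2) * ∫⁻ ζ, h ζ ^ 2 := by
    rw [lintegral_lintegral_swap (by fun_prop)]
    refine le_trans (le_of_eq ?_) (b3.trans (le_of_eq (by ring)))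
    congr 1
    refine lintegral_congr fun ζ₂ => lintegral_congr fun ζ₁ => ?_
    have hs : W₂ (ζ₁.1, ζ₂.1) = W₂ (ζ₂.1, ζ₁.1) := by
      simp only [hW₂]; rw [interactionWeight_comm]
    rw [hs, add_comm ζ₁ ζ₂, mul_comm (f ζ₁)]
  have split : ∫⁻ ζ₁, ∫⁻ ζ₂, f ζ₁ * g ζ₂ * h (ζ₁ + ζ₂) *
      ENNReal.ofReal (bilinearKernel r θ (ζ₁, ζ₂)) ≤
      2 * ((∫⁻ ζ₁, ∫⁻ ζ₂, f ζ₁ * g ζ₂ * h (ζ₁ + ζ₂) *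
        (W₁ (ζ₁.1, ζ₂.1) * (α (modulation ζ₁) * α (modulation ζ₂)))) +
      ((∫⁻ ζ₁, ∫⁻ ζ₂, f ζ₁ * g ζ₂ * h (ζ₁ + ζ₂) *
        (W₂ (ζ₁.1, ζ₂.1) * (α (modulation (ζ₁ + ζ₂)) * α (modulation ζ₂)))) +
      ∫⁻ ζ₁, ∫⁻ ζ₂, f ζ₁ * g ζ₂ * h (ζ₁ + ζ₂) *
        (W₂ (ζ₁.1, ζ₂.1) * (α (modulation (ζ₁ + ζ₂)) * α (modulation ζ₁))))) := by
    have hm1 : Measurable fun p : Spacetime n × Spacetime n => f p.1 * g p.2 * h (p.1 + p.2) *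
      (W₁ (p.1.1, p.2.1) * (α (modulation p.1) * α (modulation p.2))) := by fun_prop
    have hm2 : Measurable fun p : Spacetime n × Spacetime n => f p.1 * g p.2 * h (p.1 + p.2) *
      (W₂ (p.1.1, p.2.1) * (α (modulation (p.1 + p.2)) * α (modulation p.2))) := by fun_prop
    rw [← lintegral_add_left hm2.lintegral_prod_right',
      ← lintegral_add_left hm1.lintegral_prod_right', ← lintegral_const_mul' _ _ (by finiteness)]
    refine lintegral_mono fun ζ₁ => ?_
    dsimp only
    rw [← lintegral_add_left (by fun_prop), ← lintegral_add_left (by fun_prop),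
      ← lintegral_const_mul' _ _ (by finiteness)]
    refine lintegral_mono fun ζ₂ => ?_
    refine (mul_le_mul' le_rfl (hpt ζ₁ ζ₂)).trans (le_of_eq ?_)
    rw [ENNReal.ofReal_ofNat]
    ring
  calc _ ≤ _ := pow_le_pow_left' split 2
    _ ≤ 4 * (4 * (A ^ 2 * K₁ * (∫⁻ ζ, f ζ ^ 2) * (∫⁻ ζ, g ζ ^ 2) * (∫⁻ ζ, h ζ ^ 2) +
        4 * (A ^ 2 * K₂ * (∫⁻ ζ, f ζ ^ 2) * (∫⁻ ζ, g ζ ^ 2) * (∫⁻ ζ, h ζ ^ 2) +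
          A ^ 2 * K₂ * (∫⁻ ζ, f ζ ^ 2) * (∫⁻ ζ, g ζ ^ 2) * ∫⁻ ζ, h ζ ^ 2))) := by
        rw [mul_pow, show (2 : ℝ≥0∞) ^ 2 = 4 by norm_num]
        refine mul_le_mul' le_rfl ((ENNReal.add_sq_le_four_mul _ _).trans ?_)
        refine mul_le_mul' le_rfl (add_le_add b1 ((ENNReal.add_sq_le_four_mul _ _).trans ?_))
        exact mul_le_mul' le_rfl (add_le_add b2 b3')
    _ = _ := by ring

/-! ### The trilinear estimate for admissible exponents -/

/-- Admissibility is translated into the conditions on `r = -s` and `δ = 1 - θ` in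
`WeightExponents`, the strict and borderline cases of `low_output` being those of `s > θ - 5/4` and
`s = θ - 5/4` for `n = 2`. -/
theorem Admissible.exists_trilinear_le {n : ℕ} {s θ : ℝ} (h : Admissible n s θ) :
    ∃ K : ℝ≥0∞, K ≠ ∞ ∧ ∀ f g h : Spacetime n → ℝ≥0∞, Measurable f → Measurable g →
      Measurable h →
      (∫⁻ ζ₁, ∫⁻ ζ₂, f ζ₁ * g ζ₂ * h (ζ₁ + ζ₂) *
        ENNReal.ofReal (bilinearKernel (-s) θ (ζ₁, ζ₂))) ^ 2 ≤
      K * (∫⁻ ζ, f ζ ^ 2) * (∫⁻ ζ, g ζ ^ 2) * ∫⁻ ζ, h ζ ^ 2 := by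
  have two : ∀ {s θ : ℝ}, 1 / 2 < θ → θ ≤ 1 → WeightExponents 0 (-s) (1 - θ) →
      ∃ K : ℝ≥0∞, K ≠ ∞ ∧ ∀ f g h : Spacetime 2 → ℝ≥0∞, Measurable f → Measurable g →
        Measurable h →
        (∫⁻ ζ₁, ∫⁻ ζ₂, f ζ₁ * g ζ₂ * h (ζ₁ + ζ₂) *
          ENNReal.ofReal (bilinearKernel (-s) θ (ζ₁, ζ₂))) ^ 2 ≤
        K * (∫⁻ ζ, f ζ ^ 2) * (∫⁻ ζ, g ζ ^ 2) * ∫⁻ ζ, h ζ ^ 2 := by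
    intro s θ h1 h2 hE
    obtain ⟨K₁, hK₁, hout⟩ := exists_outputBound (by norm_num) hE
    obtain ⟨K₂, hK₂, hin⟩ := exists_inputBound_two hE
    exact _root_.exists_trilinear_le (n := 2) h1 le_rfl h2 hK₁ hK₂ hout hin
  rcases h with ⟨rfl, h1, h2, h3, h4⟩ | ⟨rfl, h1, h2, h3⟩ | ⟨rfl, h1, h2, h3⟩
  · have h5 := le_of_max_le_left h3
    have h6 := le_of_max_le_right h3
    refine two h1 (by linarith) ⟨by linarith, by linarith, by norm_num; linarith, ?_⟩
    norm_num
    rcases lt_or_eq_of_le h5 with h7 | h7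
    · left; linarith
    · right
      refine ⟨by linarith, ?_⟩
      -- on the line `s = θ - 5/4` the other constraint reads `θ ≤ 3/4`
      have : θ < 3 / 4 := lt_of_le_of_ne (by linarith) h2
      linarith
  · refine two (by linarith) (by linarith) ⟨by linarith, by linarith, by norm_num; linarith, ?_⟩
    left; norm_num; linarith
  · have hE : WeightExponents 1 (-s) (1 - θ) :=
      ⟨by linarith, by linarith, by norm_num; linarith, Or.inl (by norm_num; linarith)⟩
    obtain ⟨K₁, hK₁, hout⟩ := exists_outputBound le_rfl hE
    -- any exponent strictly between `1/2` and `θ`, and close enough to `1/2`, works here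
    obtain ⟨K₂, hK₂, hin⟩ := exists_inputBound_three (δ' := 1 - (θ + 1 / 2) / 2) hE
      (by linarith) (by linarith) (by linarith)
    exact _root_.exists_trilinear_le (n := 3) (θ' := (θ + 1 / 2) / 2) (by linarith) (by linarith)
      (by linarith) hK₁ hK₂ hout hin

/-! ### Duality -/

/-- A nonnegative function whose pairing with every `h` is at most `√K ‖h‖₂` satisfies
`‖A‖₂ ≤ √K`. -/
theorem lintegral_sq_le_of_forall_lintegral_mul {α : Type*} [MeasurableSpace α] {μ : Measure α}
    [SigmaFinite μ] {A : α → ℝ≥0∞} (hA : Measurable A) {K : ℝ≥0∞}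
    (h : ∀ φ : α → ℝ≥0∞, Measurable φ → (∫⁻ x, A x * φ x ∂μ) ^ 2 ≤ K * ∫⁻ x, φ x ^ 2 ∂μ) :
    ∫⁻ x, A x ^ 2 ∂μ ≤ K := by
  -- test against truncations of `A`, for which the pairing dominates a finite `‖φ‖₂²`
  set φ : ℕ → α → ℝ≥0∞ := fun k => (spanningSets μ k).indicator fun x => min (A x) k with hφ
  have hφm : ∀ k, Measurable (φ k) := fun k =>
    (hA.min measurable_const).indicator (measurableSet_spanningSets μ k)
  have hle : ∀ k x, φ k x ≤ A x := fun k x =>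
    (Set.indicator_le_self _ _ x).trans (min_le_left _ _)
  have hmono : Monotone φ := by
    intro j k hjk x
    refine (Set.indicator_le_indicator_of_subset (monotone_spanningSets μ hjk)
      (fun _ => zero_le) x).trans ?_
    exact Set.indicator_le_indicator (min_le_min le_rfl (by exact_mod_cast hjk))
  have hsup : ∀ x, A x ^ 2 = ⨆ k, φ k x ^ 2 := by
    intro x
    refine le_antisymm ?_ (iSup_le fun k => pow_le_pow_left' (hle k x) 2)
    have hmin : A x = ⨆ k, φ k x := by
      refine le_antisymm (le_of_forall_lt fun c hc => ?_) (iSup_le fun k => hle k x)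
      obtain ⟨i, hi⟩ : ∃ i, x ∈ spanningSets μ i := by
        exact Set.mem_iUnion.1 (by rw [iUnion_spanningSets]; trivial)
      obtain ⟨j, hj⟩ := ENNReal.exists_nat_gt hc.ne_top
      refine lt_of_lt_of_le ?_ (le_iSup _ (max i j))
      have : x ∈ spanningSets μ (max i j) := monotone_spanningSets μ (le_max_left _ _) hi
      simp only [hφ, Set.indicator_of_mem this]
      exact lt_min hc (hj.trans_le (by exact_mod_cast le_max_right _ _))
    have hm : Monotone fun k => φ k x := fun j k hjk => hmono hjk x
    have ht : Filter.Tendsto (fun k => φ k x ^ 2) Filter.atTop (nhds (A x ^ 2)) :=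
      ((ENNReal.continuous_pow 2).tendsto _).comp (hmin ▸ tendsto_atTop_iSup hm)
    exact le_of_tendsto ht (Filter.Eventually.of_forall fun k => le_iSup (fun k => φ k x ^ 2) k)
  have hbd : ∀ k, ∫⁻ x, φ k x ^ 2 ∂μ ≤ K := by
    intro k
    set J := ∫⁻ x, φ k x ^ 2 ∂μ with hJ
    have hfin : J ≠ ∞ := by
      have : J ≤ ∫⁻ x in spanningSets μ k, (k : ℝ≥0∞) ^ 2 ∂μ := by
        rw [← lintegral_indicator (measurableSet_spanningSets μ k)]
        refine lintegral_mono fun x => ?_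
        by_cases hx : x ∈ spanningSets μ k
        · simp only [hφ, Set.indicator_of_mem hx]
          exact pow_le_pow_left' (min_le_right _ _) 2
        · simp [hφ, hx]
      refine ne_top_of_le_ne_top ?_ this
      rw [setLIntegral_const]
      exact ENNReal.mul_ne_top (by finiteness) (measure_spanningSets_lt_top μ k).ne
    have h1 : J * J ≤ K * J := by
      refine le_trans ?_ (h (φ k) (hφm k))
      rw [sq]
      have : J ≤ ∫⁻ x, A x * φ k x ∂μ := lintegral_mono fun x => by
        rw [sq]; exact mul_le_mul' (hle k x) le_rfl
      exact mul_le_mul' this this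
    rcases eq_or_ne J 0 with h0 | h0
    · rw [h0]; exact zero_le
    · exact (ENNReal.mul_le_mul_iff_left h0 hfin).1 h1
  calc ∫⁻ x, A x ^ 2 ∂μ = ∫⁻ x, ⨆ k, φ k x ^ 2 ∂μ := by simp_rw [hsup]
    _ = ⨆ k, ∫⁻ x, φ k x ^ 2 ∂μ := lintegral_iSup (fun k => (hφm k).pow_const 2)
        fun j k hjk x => pow_le_pow_left' (hmono hjk x) 2
    _ ≤ K := iSup_le hbd

/-- The weight `⟨ξ⟩^s ⟨τ - |ξ|²⟩^θ` of the Bourgain norm. -/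
noncomputable def bourgainWeight {n : ℕ} (s θ : ℝ) (ζ : Spacetime n) : ℝ :=
  japaneseBracket ζ.1 ^ s * japaneseBracket (modulation ζ) ^ θ

theorem bourgainWeight_pos {n : ℕ} (s θ : ℝ) (ζ : Spacetime n) : 0 < bourgainWeight s θ ζ :=
  mul_pos (Real.rpow_pos_of_pos (japaneseBracket_pos _) _)
    (Real.rpow_pos_of_pos (japaneseBracket_pos _) _)

@[fun_prop]
theorem measurable_bourgainWeight {n : ℕ} (s θ : ℝ) :
    Measurable (bourgainWeight s θ : Spacetime n → ℝ) := by
  unfold bourgainWeight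
  fun_prop

/-- The kernel is the quotient of the weights on the two sides of the bilinear estimate. -/
theorem bourgainWeight_mul_bilinearKernel {n : ℕ} (s θ : ℝ) (ζ₁ ζ₂ : Spacetime n) :
    bourgainWeight s θ ζ₁ * bourgainWeight s θ ζ₂ * bilinearKernel (-s) θ (ζ₁, ζ₂) =
      bourgainWeight s (θ - 1) (ζ₁ + ζ₂) := by
  simp only [bourgainWeight, bilinearKernel]
  have h1 := japaneseBracket_pos ζ₁.1
  have h2 := japaneseBracket_pos ζ₂.1
  have h3 := japaneseBracket_pos (ζ₁.1 + ζ₂.1)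
  have h4 := japaneseBracket_pos (modulation ζ₁)
  have h5 := japaneseBracket_pos (modulation ζ₂)
  have h6 := japaneseBracket_pos (modulation (ζ₁ + ζ₂))
  rw [Prod.fst_add, Real.div_rpow (by positivity) h3.le, Real.mul_rpow h1.le h2.le,
    Real.rpow_neg h1.le, Real.rpow_neg h2.le, Real.rpow_neg h3.le, Real.rpow_neg h4.le,
    Real.rpow_neg h5.le]
  have := Real.rpow_pos_of_pos h1 s
  have := Real.rpow_pos_of_pos h2 s
  have := Real.rpow_pos_of_pos h3 s
  have := Real.rpow_pos_of_pos h4 θ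
  have := Real.rpow_pos_of_pos h5 θ
  field_simp

theorem bourgainFourierNorm_eq {n : ℕ} (s θ : ℝ) (W : Spacetime n → ℂ) :
    bourgainFourierNorm s θ W =
      (∫⁻ ζ, (ENNReal.ofReal (bourgainWeight s θ ζ) * ‖W ζ‖ₑ) ^ 2) ^ (1 / 2 : ℝ) := by
  rw [bourgainFourierNorm, eLpNorm_eq_lintegral_rpow_enorm_toReal (by simp) (by simp)]
  simp only [ENNReal.toReal_ofNat]
  congr 1
  refine lintegral_congr fun ζ => ?_
  have : japaneseBracket ζ.1 ^ s * japaneseBracket (ζ.2 - ‖ζ.1‖ ^ 2) ^ θ =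
    bourgainWeight s θ ζ := rfl
  rw [this, ENNReal.rpow_ofNat, enorm_mul, ← ofReal_norm (E := ℂ) (bourgainWeight s θ ζ),
    Complex.norm_real, Real.norm_of_nonneg (bourgainWeight_pos s θ ζ).le]

theorem bourgainFourierNorm_sq {n : ℕ} (s θ : ℝ) (W : Spacetime n → ℂ) :
    bourgainFourierNorm s θ W ^ 2 =
      ∫⁻ ζ, (ENNReal.ofReal (bourgainWeight s θ ζ) * ‖W ζ‖ₑ) ^ 2 := by
  rw [bourgainFourierNorm_eq, ← ENNReal.rpow_natCast, ← ENNReal.rpow_mul]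
  norm_num

/-- The bilinear estimate for nonnegative functions on the Fourier side. -/
theorem Admissible.exists_lintegral_convolution_le {n : ℕ} {s θ : ℝ} (h : Admissible n s θ) :
    ∃ K : ℝ≥0∞, K ≠ ∞ ∧ ∀ a b : Spacetime n → ℝ≥0∞, Measurable a → Measurable b →
      ∫⁻ ζ, (ENNReal.ofReal (bourgainWeight s (θ - 1) ζ) * ∫⁻ η, a η * b (ζ - η)) ^ 2 ≤
        K * (∫⁻ ζ, (ENNReal.ofReal (bourgainWeight s θ ζ) * a ζ) ^ 2) *
          ∫⁻ ζ, (ENNReal.ofReal (bourgainWeight s θ ζ) * b ζ) ^ 2 := by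
  obtain ⟨K, hK, hle⟩ := h.exists_trilinear_le
  refine ⟨K, hK, fun a b ha hb => ?_⟩
  have hconv : Measurable fun ζ : Spacetime n => ∫⁻ η, a η * b (ζ - η) :=
    Measurable.lintegral_prod_right' (f := fun p : Spacetime n × Spacetime n =>
      a p.2 * b (p.1 - p.2)) (by fun_prop)
  refine lintegral_sq_le_of_forall_lintegral_mul (by fun_prop) fun φ hφ => ?_
  refine le_trans (le_of_eq ?_) (hle (fun ζ => ENNReal.ofReal (bourgainWeight s θ ζ) * a ζ)
    (fun ζ => ENNReal.ofReal (bourgainWeight s θ ζ) * b ζ) φ (by fun_prop) (by fun_prop) hφ)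
  congr 1
  calc ∫⁻ ζ, ENNReal.ofReal (bourgainWeight s (θ - 1) ζ) * (∫⁻ η, a η * b (ζ - η)) * φ ζ
      = ∫⁻ ζ, ∫⁻ η, ENNReal.ofReal (bourgainWeight s (θ - 1) ζ) * φ ζ * (a η * b (ζ - η)) := by
        refine lintegral_congr fun ζ => ?_
        rw [lintegral_const_mul _ (by fun_prop)]
        ring
    _ = ∫⁻ η, ∫⁻ ζ, ENNReal.ofReal (bourgainWeight s (θ - 1) ζ) * φ ζ * (a η * b (ζ - η)) :=
        lintegral_lintegral_swap (by fun_prop)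
    _ = _ := by
        refine lintegral_congr fun ζ₁ => ?_
        rw [← lintegral_add_left_eq_self _ ζ₁]
        refine lintegral_congr fun ζ₂ => ?_
        rw [← bourgainWeight_mul_bilinearKernel, add_sub_cancel_left,
          ENNReal.ofReal_mul (mul_pos (bourgainWeight_pos _ _ _) (bourgainWeight_pos _ _ _)).le,
          ENNReal.ofReal_mul (bourgainWeight_pos _ _ _).le]
        ring

/-! ### The bilinear estimate on the Fourier side -/

theorem enorm_fourierProduct_le {n : ℕ} (U V : Spacetime n → ℂ) (ζ : Spacetime n) :
    ‖fourierProduct U V ζ‖ₑ ≤ ∫⁻ η, ‖U η‖ₑ * ‖V (ζ - η)‖ₑ := by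
  have h1 : ‖(((2 * Real.pi) ^ (n + 1) : ℝ) : ℂ)⁻¹‖ₑ ≤ 1 := by
    rw [← ofReal_norm, ← ENNReal.ofReal_one]
    refine ENNReal.ofReal_le_ofReal ?_
    rw [norm_inv, Complex.norm_real, Real.norm_of_nonneg (by positivity)]
    exact inv_le_one_of_one_le₀ (one_le_pow₀ (by linarith [Real.pi_gt_three]))
  rw [fourierProduct, enorm_mul]
  refine (mul_le_mul' h1 (enorm_integral_le_lintegral_enorm _)).trans ?_
  simp only [enorm_mul, one_mul, le_refl]

/-- The bilinear estimate on the Fourier side, without finiteness assumptions. -/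
theorem Admissible.exists_fourierProduct_le {n : ℕ} {s θ : ℝ} (h : Admissible n s θ) :
    ∃ C : ℝ≥0, 0 < C ∧ ∀ U V : Spacetime n → ℂ,
      AEStronglyMeasurable U volume → AEStronglyMeasurable V volume →
      (bourgainFourierNorm s θ U < ∞ → bourgainFourierNorm s θ V < ∞ →
        ∀ᵐ ζ : Spacetime n, Integrable (fun η : Spacetime n => U η * V (ζ - η)) volume) ∧
      bourgainFourierNorm s (θ - 1) (fourierProduct U V) ≤
        C * bourgainFourierNorm s θ U * bourgainFourierNorm s θ V := by
  obtain ⟨K, hK, hle⟩ := h.exists_lintegral_convolution_le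
  have hCK : K ≤ ((NNReal.sqrt K.toNNReal + 1 : ℝ≥0) : ℝ≥0∞) ^ 2 := by
    rw [← ENNReal.coe_toNNReal hK]
    norm_cast
    calc K.toNNReal = NNReal.sqrt K.toNNReal ^ 2 := (NNReal.sq_sqrt _).symm
      _ ≤ _ := pow_le_pow_left' (by simp) 2
  refine ⟨NNReal.sqrt K.toNNReal + 1, by positivity, fun U V hU hV => ?_⟩
  -- replace `U` and `V` by measurable representatives
  have hconv : ∀ ζ, ∫⁻ η, ‖U η‖ₑ * ‖V (ζ - η)‖ₑ = ∫⁻ η, ‖hU.mk U η‖ₑ * ‖hV.mk V (ζ - η)‖ₑ := by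
    intro ζ
    refine lintegral_congr_ae ?_
    filter_upwards [hU.ae_eq_mk, (Measure.measurePreserving_sub_left volume
      ζ).quasiMeasurePreserving.ae_eq_comp hV.ae_eq_mk] with η h1 h2
    simp only [Function.comp_apply] at h2
    rw [h1, h2]
  have hnorm : ∀ {W : Spacetime n → ℂ} (hW : AEStronglyMeasurable W volume),
      ∫⁻ ζ, (ENNReal.ofReal (bourgainWeight s θ ζ) * ‖hW.mk W ζ‖ₑ) ^ 2 =
        bourgainFourierNorm s θ W ^ 2 := by
    intro W hW
    rw [bourgainFourierNorm_sq]
    refine lintegral_congr_ae ?_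
    filter_upwards [hW.ae_eq_mk] with η h1
    rw [h1]
  have hUm : Measurable fun η => ‖hU.mk U η‖ₑ := hU.stronglyMeasurable_mk.measurable.enorm
  have hVm : Measurable fun η => ‖hV.mk V η‖ₑ := hV.stronglyMeasurable_mk.measurable.enorm
  have hmain := hle _ _ hUm hVm
  rw [hnorm hU, hnorm hV] at hmain
  simp only [← hconv] at hmain
  refine ⟨fun hUf hVf => ?_, ?_⟩
  · have hfin : ∫⁻ ζ, (ENNReal.ofReal (bourgainWeight s (θ - 1) ζ) *
        ∫⁻ η, ‖U η‖ₑ * ‖V (ζ - η)‖ₑ) ^ 2 ≠ ∞ :=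
      ne_top_of_le_ne_top (by finiteness) hmain
    have hm : Measurable fun ζ => (ENNReal.ofReal (bourgainWeight s (θ - 1) ζ) *
        ∫⁻ η, ‖U η‖ₑ * ‖V (ζ - η)‖ₑ) ^ 2 := by
      simp only [hconv]
      have : Measurable fun ζ : Spacetime n => ∫⁻ η, ‖hU.mk U η‖ₑ * ‖hV.mk V (ζ - η)‖ₑ :=
        Measurable.lintegral_prod_right' (f := fun p : Spacetime n × Spacetime n =>
          ‖hU.mk U p.2‖ₑ * ‖hV.mk V (p.1 - p.2)‖ₑ)
          ((hUm.comp measurable_snd).mul (hVm.comp (by fun_prop)))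
      fun_prop
    filter_upwards [ae_lt_top hm hfin] with ζ hζ
    refine ⟨hU.mul (hV.comp_quasiMeasurePreserving
      (Measure.measurePreserving_sub_left volume ζ).quasiMeasurePreserving), ?_⟩
    rw [hasFiniteIntegral_iff_enorm]
    simp only [enorm_mul]
    by_contra hcon
    rw [not_lt, top_le_iff] at hcon
    rw [hcon, ENNReal.mul_top (ENNReal.ofReal_pos.2 (bourgainWeight_pos _ _ _)).ne'] at hζ
    simp at hζ
  · rw [← ENNReal.pow_le_pow_left_iff two_ne_zero, mul_pow, mul_pow, bourgainFourierNorm_sq]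
    refine (lintegral_mono fun ζ => pow_le_pow_left'
      (mul_le_mul' le_rfl (enorm_fourierProduct_le U V ζ)) 2).trans (hmain.trans ?_)
    gcongr

/-! ### The Fourier transform of a product of Schwartz functions -/

section FourierProduct

open FourierTransform Convolution

/-- The Fourier transform turns products of Schwartz functions into convolutions. -/
theorem SchwartzMap.fourier_mul_apply {E : Type*} [NormedAddCommGroup E] [InnerProductSpace ℝ E]
    [FiniteDimensional ℝ E] [MeasurableSpace E] [BorelSpace E] (u v : 𝓢(E, ℂ)) (x : E) :
    𝓕 (fun y => u y * v y) x = ∫ t, 𝓕 (u : E → ℂ) t * 𝓕 (v : E → ℂ) (x - t) := by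
  have hinv : ∀ (w : 𝓢(E, ℂ)) (y : E), 𝓕 (𝓕 w) (-y) = w y := by
    intro w y
    calc 𝓕 (𝓕 w) (-y) = 𝓕⁻ (𝓕 w) y := by
          rw [SchwartzMap.fourier_coe, SchwartzMap.fourierInv_coe,
            Real.fourierInv_eq_fourier_neg]
      _ = w y := by simp
  have h1 := SchwartzMap.convolution_apply (ContinuousLinearMap.mul ℂ ℂ) (𝓕 u) (𝓕 v) x
  rw [convolution_def] at h1
  simp only [ContinuousLinearMap.mul_apply', SchwartzMap.fourier_coe] at h1
  rw [← h1]
  have h2 : SchwartzMap.convolution (ContinuousLinearMap.mul ℂ ℂ) (𝓕 u) (𝓕 v) =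
      𝓕⁻ (SchwartzMap.pairing (ContinuousLinearMap.mul ℂ ℂ) (𝓕 (𝓕 u)) (𝓕 (𝓕 v))) := by
    rw [← SchwartzMap.fourier_convolution]
    simp
  rw [h2, SchwartzMap.fourierInv_coe, Real.fourierInv_eq_fourier_comp_neg]
  refine congrArg (fun w : E → ℂ => 𝓕 w x) (funext fun y => ?_)
  rw [SchwartzMap.pairing_apply_apply, hinv, hinv]
  rfl

/-- The transform in terms of Mathlib's, which is normalised by `e^{-2πi x·ξ}` and requires the
Euclidean norm on the product space. -/
theorem spacetimeFourier_eq {n : ℕ} (w : Spacetime n → ℂ) (ζ : Spacetime n) :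
    spacetimeFourier w ζ = 𝓕 (fun e : WithLp 2 (Spacetime n) => w e.ofLp)
      (WithLp.toLp 2 ((2 * Real.pi)⁻¹ • ζ)) := by
  rw [Real.fourier_eq', spacetimeFourier,
    ← (WithLp.volume_preserving_ofLp (EuclideanSpace ℝ (Fin n)) ℝ).integral_comp
      (MeasurableEquiv.toLp 2 (Spacetime n)).symm.measurableEmbedding]
  refine integral_congr_ae (Filter.Eventually.of_forall fun e => ?_)
  simp only [smul_eq_mul]
  congr 2
  simp only [WithLp.prod_inner_apply, Prod.smul_fst, Prod.smul_snd, inner_smul_right,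
    smul_eq_mul, RCLike.inner_apply, conj_trivial]
  push_cast
  have : (Real.pi : ℂ) ≠ 0 := by exact_mod_cast Real.pi_ne_zero
  field_simp

/-- The change of normalisation produces the factor `(2π)^{-(n+1)}` of `fourierProduct`. -/
theorem spacetimeFourier_mul {n : ℕ} (u v : 𝓢(Spacetime n, ℂ)) :
    spacetimeFourier (fun p => u p * v p) =
      fourierProduct (spacetimeFourier fun p => u p) (spacetimeFourier fun p => v p) := by
  ext ζ
  set L := WithLp.prodContinuousLinearEquiv 2 ℝ (EuclideanSpace ℝ (Fin n)) ℝ with hL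
  have h := SchwartzMap.fourier_mul_apply
    (SchwartzMap.compCLMOfContinuousLinearEquiv ℂ L u)
    (SchwartzMap.compCLMOfContinuousLinearEquiv ℂ L v)
    (WithLp.toLp 2 ((2 * Real.pi)⁻¹ • ζ))
  have hcomp : ∀ w : 𝓢(Spacetime n, ℂ),
      (SchwartzMap.compCLMOfContinuousLinearEquiv ℂ L w : WithLp 2 (Spacetime n) → ℂ) =
        fun e => w e.ofLp := fun w => rfl
  simp only [hcomp] at h
  rw [spacetimeFourier_eq, h,
    ← (WithLp.volume_preserving_toLp (EuclideanSpace ℝ (Fin n)) ℝ).integral_comp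
      (MeasurableEquiv.toLp 2 (Spacetime n)).measurableEmbedding, fourierProduct]
  simp only [spacetimeFourier_eq]
  have hs := Measure.integral_comp_smul (volume : Measure (Spacetime n))
    (fun p => 𝓕 (fun e : WithLp 2 (Spacetime n) => u e.ofLp) (WithLp.toLp 2 p) *
      𝓕 (fun e : WithLp 2 (Spacetime n) => v e.ofLp)
        (WithLp.toLp 2 ((2 * Real.pi)⁻¹ • ζ) - WithLp.toLp 2 p)) (2 * Real.pi)⁻¹
  have hdim : Module.finrank ℝ (Spacetime n) = n + 1 := by simp
  simp only [hdim] at hs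
  have hpos : 0 < (2 * Real.pi) ^ (n + 1) := by positivity
  rw [inv_pow, inv_inv, abs_of_pos hpos] at hs
  simp only [smul_sub, WithLp.toLp_sub]
  rw [hs, Complex.real_smul, ← mul_assoc, inv_mul_cancel₀ (by exact_mod_cast hpos.ne'), one_mul]

theorem aestronglyMeasurable_spacetimeFourier {n : ℕ} (u : 𝓢(Spacetime n, ℂ)) :
    AEStronglyMeasurable (spacetimeFourier fun p => u p) volume := by
  set L := WithLp.prodContinuousLinearEquiv 2 ℝ (EuclideanSpace ℝ (Fin n)) ℝ with hL
  have h : Continuous (𝓕 (fun e : WithLp 2 (Spacetime n) => u e.ofLp)) := by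
    have := (𝓕 (SchwartzMap.compCLMOfContinuousLinearEquiv ℂ L u)).continuous
    rwa [SchwartzMap.fourier_coe] at this
  have h2 : Continuous fun ζ : Spacetime n => WithLp.toLp 2 ((2 * Real.pi)⁻¹ • ζ) :=
    L.symm.continuous.comp (continuous_const_smul _)
  rw [show (spacetimeFourier fun p => u p) = _ from funext (spacetimeFourier_eq _)]
  exact (h.comp h2).aestronglyMeasurable

end FourierProduct

/-- The bilinear estimate `‖u v‖_{X^{s,θ-1}} ≲ ‖u‖_{X^{s,θ}} ‖v‖_{X^{s,θ}}`: first for Schwartz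
functions with the pointwise product, then for arbitrary elements of `X^{s,θ}`, given by their
Fourier transforms `U`, `V`, the product being given on the Fourier side by convolution. -/
theorem mainTheorem4 (n : ℕ) (s θ : ℝ) (h : Admissible n s θ) :
    ∃ C : ℝ≥0, 0 < C ∧
      (∀ u v : 𝓢(Spacetime n, ℂ),
        bourgainNorm s (θ - 1) (fun p => u p * v p) ≤
          C * bourgainNorm s θ (fun p => u p) * bourgainNorm s θ (fun p => v p)) ∧
      (∀ U V : Spacetime n → ℂ,
        AEStronglyMeasurable U volume → AEStronglyMeasurable V volume →
        bourgainFourierNorm s θ U < ∞ → bourgainFourierNorm s θ V < ∞ →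
        (∀ᵐ ζ : Spacetime n, Integrable (fun η : Spacetime n => U η * V (ζ - η)) volume) ∧
        bourgainFourierNorm s (θ - 1) (fourierProduct U V) ≤
          C * bourgainFourierNorm s θ U * bourgainFourierNorm s θ V) := by
  obtain ⟨C, hC, hmain⟩ := h.exists_fourierProduct_le
  refine ⟨C, hC, fun u v => ?_, fun U V hU hV hUf hVf =>
    ⟨(hmain U V hU hV).1 hUf hVf, (hmain U V hU hV).2⟩⟩
  rw [bourgainNorm, spacetimeFourier_mul]
  exact (hmain _ _ (aestronglyMeasurable_spacetimeFourier u)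
    (aestronglyMeasurable_spacetimeFourier v)).2
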